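/- Let $n\ge 3$ and let $(M,g)$ be a smooth $n$-dimensional Lorentzian manifold of signature $(-,+,\dots,+)$. Call $(M,g)$ a generalized Robertson-Walker (GRW) space-time if it carries a smooth vector field $u$ and scalar fields $\varphi,\xi$ with $$u^ku_k=-1,\qquad \nabla_k u_l=\varphi\,(g_{kl}+u_ku_l),\qquad R_{jk}u^k=\xi u_j .$$ (For a warped product $-dt^2+q(t)^2g^*$ with $u=\partial_t$ one has $\varphi=\dot q/q$.) Let $(M,g)$ be a GRW space-time with such $u$ and $\varphi$, and suppose that $\varphi$ does not vanish identically along any maximal integral curve of $u$ (for a warped product: the scale factor $q$ is not constant). Assume that the Weyl tensor is divergence-free, $\nabla_m C_{jkl}{}^m=0$. Let $\sigma$ be a smooth function on $M$ with $\nabla_k\sigma=-u_k\dot\sigma$, where $\dot\sigma=u^m\nabla_m\sigma$, and let $\bar g=e^{2\sigma}g$. Then $(M,\bar g)$ is a GRW space-time and its Weyl tensor is divergence-free, $\bar\nabla_m\bar C_{jkl}{}^m=0$. -/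

import Mathlib

open scoped Manifold ContDiff Bundle Matrix

noncomputable section

namespace GRW

/-! ## Tensor calculus in one coordinate system

A metric is given by its matrix of components `G x i j = g_{ij}(x)` on (an open part of) `ℝⁿ`.
All indices of the tensors below are in the order in which they are displayed. -/

section Coordinates

variable {n : ℕ}

/-- The partial derivative `∂_i f (x)`. -/
def pd (i : Fin n) (f : EuclideanSpace ℝ (Fin n) → ℝ) (x : EuclideanSpace ℝ (Fin n)) : ℝ :=
  fderiv ℝ f x (EuclideanSpace.single i 1)

/-- Components of a metric as functions of the coordinates. -/
abbrev Components (n : ℕ) : Type :=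
  EuclideanSpace ℝ (Fin n) → Matrix (Fin n) (Fin n) ℝ

/-- Christoffel symbols of the Levi-Civita connection,
`Γ^m_{ij} = ½ g^{ml} (∂_i g_{jl} + ∂_j g_{il} - ∂_l g_{ij})`. -/
def christoffel (G : Components n) (m i j : Fin n) (x : EuclideanSpace ℝ (Fin n)) : ℝ :=
  (1 / 2) * ∑ l, (G x)⁻¹ m l *
    (pd i (fun y => G y j l) x + pd j (fun y => G y i l) x - pd l (fun y => G y i j) x)

/-- The covariant derivative `∇_k w_l = ∂_k w_l - Γ^m_{kl} w_m` of a covector field. -/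
def covDeriv (G : Components n) (w : EuclideanSpace ℝ (Fin n) → Fin n → ℝ) (k l : Fin n)
    (x : EuclideanSpace ℝ (Fin n)) : ℝ :=
  pd k (fun y => w y l) x - ∑ m, christoffel G m k l x * w x m

/-- The Riemann tensor `R_{jkl}{}^m`, with the sign convention
`∇_j ∇_k w_l - ∇_k ∇_j w_l = R_{jkl}{}^m w_m`. -/
def riemann (G : Components n) (j k l m : Fin n) (x : EuclideanSpace ℝ (Fin n)) : ℝ :=
  pd k (christoffel G m j l) x - pd j (christoffel G m k l) x
    + ∑ p, (christoffel G m k p x * christoffel G p j l x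
      - christoffel G m j p x * christoffel G p k l x)

/-- The Ricci tensor `R_{kl} = - R_{mkl}{}^m` (positive on round spheres). -/
def ricci (G : Components n) (k l : Fin n) (x : EuclideanSpace ℝ (Fin n)) : ℝ :=
  - ∑ m, riemann G m k l m x

/-- The Ricci tensor with its second index raised, `R_j{}^m = R_{jp} g^{pm}`. -/
def ricciUp (G : Components n) (j m : Fin n) (x : EuclideanSpace ℝ (Fin n)) : ℝ :=
  ∑ p, ricci G j p x * (G x)⁻¹ p m

/-- The curvature scalar `R = g^{kl} R_{kl}`. -/
def scalarCurv (G : Components n) (x : EuclideanSpace ℝ (Fin n)) : ℝ :=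
  ∑ k, ∑ l, (G x)⁻¹ k l * ricci G k l x

/-- The Kronecker symbol `δ_j^m`. -/
def delta (j m : Fin n) : ℝ := if j = m then 1 else 0

/-- The Weyl (conformal) tensor `C_{jkl}{}^m`, the totally trace-free part of `R_{jkl}{}^m`
(in dimension at least `3`). -/
def weyl (G : Components n) (j k l m : Fin n) (x : EuclideanSpace ℝ (Fin n)) : ℝ :=
  riemann G j k l m x
    + (delta j m * ricci G k l x - delta k m * ricci G j l x
        + ricciUp G j m x * G x k l - ricciUp G k m x * G x j l) / ((n : ℝ) - 2)
    - scalarCurv G x * (delta j m * G x k l - delta k m * G x j l)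
        / (((n : ℝ) - 1) * ((n : ℝ) - 2))

/-- The divergence `∇_m C_{jkl}{}^m` of the Weyl tensor. -/
def weylDiv (G : Components n) (j k l : Fin n) (x : EuclideanSpace ℝ (Fin n)) : ℝ :=
  ∑ m, (pd m (weyl G j k l m) x
    + ∑ p, (christoffel G m m p x * weyl G j k l p x
      - christoffel G p m j x * weyl G p k l m x
      - christoffel G p m k x * weyl G j p l m x
      - christoffel G p m l x * weyl G j k p m x))

end Coordinates

/-! ## Lorentzian manifolds -/

section Manifold

variable (n : ℕ) (M : Type*) [TopologicalSpace M] [ChartedSpace (EuclideanSpace ℝ (Fin n)) M]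
  [IsManifold (𝓡 n) ∞ M]

/-- A smooth Lorentzian metric, of signature `(-,+,…,+)`, on a smooth `n`-manifold. -/
structure LorentzMetric where
  val (p : M) : TangentSpace (𝓡 n) p →L[ℝ] TangentSpace (𝓡 n) p →L[ℝ] ℝ
  symm (p : M) (v w : TangentSpace (𝓡 n) p) : val p v w = val p w v
  signature (p : M) : ∃ v : TangentSpace (𝓡 n) p, val p v v < 0 ∧
    ∀ w : TangentSpace (𝓡 n) p, w ≠ 0 → val p v w = 0 → 0 < val p w w
  contMDiff : ContMDiff (𝓡 n)
    ((𝓡 n).prod 𝓘(ℝ, EuclideanSpace ℝ (Fin n) →L[ℝ] EuclideanSpace ℝ (Fin n) →L[ℝ] ℝ)) ∞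
    (fun p => Bundle.TotalSpace.mk'
      (EuclideanSpace ℝ (Fin n) →L[ℝ] EuclideanSpace ℝ (Fin n) →L[ℝ] ℝ)
      (E := fun p : M => TangentSpace (𝓡 n) p →L[ℝ] TangentSpace (𝓡 n) p →L[ℝ] ℝ) p (val p))

variable {n M}

/-- A smooth coordinate system of the manifold (any chart of its maximal smooth atlas). -/
abbrev IsCoord (e : OpenPartialHomeomorph M (EuclideanSpace ℝ (Fin n))) : Prop :=
  e ∈ IsManifold.maximalAtlas (𝓡 n) ∞ M

/-- The coordinate vector `∂_i` of the chart `e`, at the point with coordinates `x`. -/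
def coordVec (e : OpenPartialHomeomorph M (EuclideanSpace ℝ (Fin n))) (i : Fin n)
    (x : EuclideanSpace ℝ (Fin n)) : TangentSpace (𝓡 n) (e.symm x) :=
  mfderiv (𝓡 n) (𝓡 n) e.symm x
    (show TangentSpace (𝓡 n) x from EuclideanSpace.single i (1 : ℝ))

/-- The components `v^i` of a vector field in the chart `e`. -/
def upper (v : (p : M) → TangentSpace (𝓡 n) p)
    (e : OpenPartialHomeomorph M (EuclideanSpace ℝ (Fin n)))
    (x : EuclideanSpace ℝ (Fin n)) (i : Fin n) : ℝ :=
  (show EuclideanSpace ℝ (Fin n) from mfderiv (𝓡 n) (𝓡 n) e (e.symm x) (v (e.symm x))) i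

/-- The derivative `v(f) = v^k ∇_k f` of a scalar field in the direction of a tangent vector. -/
def dirDeriv (f : M → ℝ) (p : M) (v : TangentSpace (𝓡 n) p) : ℝ :=
  mfderiv (𝓡 n) 𝓘(ℝ, ℝ) f p v

namespace LorentzMetric

variable (g : LorentzMetric n M)

/-- The components `g_{ij}` of the metric in the chart `e`. -/
def coord (e : OpenPartialHomeomorph M (EuclideanSpace ℝ (Fin n))) : Components n :=
  fun x => Matrix.of fun i j => g.val (e.symm x) (coordVec e i x) (coordVec e j x)

/-- The covariant components `v_i = g_{ij} v^j` of a vector field in the chart `e`. -/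
def lower (v : (p : M) → TangentSpace (𝓡 n) p)
    (e : OpenPartialHomeomorph M (EuclideanSpace ℝ (Fin n)))
    (x : EuclideanSpace ℝ (Fin n)) (i : Fin n) : ℝ :=
  g.val (e.symm x) (coordVec e i x) (v (e.symm x))

/-- The conformally rescaled metric `e^{2σ} g`. -/
def conformal (σ : M → ℝ) (hσ : ContMDiff (𝓡 n) 𝓘(ℝ, ℝ) ∞ σ) : LorentzMetric n M where
  val p := Real.exp (2 * σ p) • g.val p
  symm p v w := by simp [g.symm p v w]
  signature p := by
    obtain ⟨v, hv, hw⟩ := g.signature p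
    have hpos : 0 < Real.exp (2 * σ p) := Real.exp_pos _
    refine ⟨v, ?_, fun w hw0 hvw => ?_⟩
    · simpa using mul_neg_of_pos_of_neg hpos hv
    · have h0 : g.val p v w = 0 := by
        simpa [hpos.ne'] using hvw
      simpa using mul_pos hpos (hw w hw0 h0)
  contMDiff := by
    have h : ContMDiff (𝓡 n) 𝓘(ℝ, ℝ) ∞ (fun p => Real.exp (2 * σ p)) :=
      (Real.contDiff_exp.contMDiff).comp
        (((contDiff_const (c := (2 : ℝ))).mul contDiff_id).contMDiff.comp hσ)
    exact h.smul_section g.contMDiff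

/-- `∇_m C_{jkl}{}^m = 0`, in every coordinate system. -/
def WeylDivFree : Prop :=
  ∀ e : OpenPartialHomeomorph M (EuclideanSpace ℝ (Fin n)), IsCoord e → ∀ x ∈ e.target,
    ∀ j k l : Fin n, weylDiv (g.coord e) j k l x = 0

/-- `u` is a smooth time-like unit vector field (`u^2 = -1`), torse-forming with scalar `φ`,
`∇_k u_l = φ (g_{kl} + u_k u_l)`, and an eigenvector of the Ricci tensor, `R_{jk} u^k = ξ u_j`. -/
structure IsTorseForming (u : (p : M) → TangentSpace (𝓡 n) p) (φ : M → ℝ) : Prop where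
  smooth : ContMDiff (𝓡 n) (𝓡 n).tangent ∞
    (fun p => (⟨p, u p⟩ : TangentBundle (𝓡 n) M))
  unit (p : M) : g.val p (u p) (u p) = -1
  torse (e : OpenPartialHomeomorph M (EuclideanSpace ℝ (Fin n))) (he : IsCoord e)
    (x : EuclideanSpace ℝ (Fin n)) (hx : x ∈ e.target) (k l : Fin n) :
    covDeriv (g.coord e) (g.lower u e) k l x
      = φ (e.symm x) * (g.coord e x k l + g.lower u e x k * g.lower u e x l)
  eigen : ∃ ξ : M → ℝ, ∀ e : OpenPartialHomeomorph M (EuclideanSpace ℝ (Fin n)), IsCoord e →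
    ∀ x ∈ e.target, ∀ j : Fin n,
      ∑ k, ricci (g.coord e) j k x * upper u e x k = ξ (e.symm x) * g.lower u e x j

/-- Generalized Robertson-Walker space-times, by their covariant defining property. -/
def IsGRW : Prop :=
  ∃ (u : (p : M) → TangentSpace (𝓡 n) p) (φ : M → ℝ), g.IsTorseForming u φ

end LorentzMetric

/-- The function `f` does not vanish identically along any maximal integral curve of `u`:
through every point there is an integral curve of `u`, on an open interval, along which `f` is
somewhere nonzero. If `f = q'(t) / q(t)` and `u = ∂_t` on a warped product with metric
`-dt² + q(t)² g*`, this says that `q` is not constant. -/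
def NonvanishingAlong (f : M → ℝ) (u : (p : M) → TangentSpace (𝓡 n) p) : Prop :=
  ∀ p : M, ∃ (γ : ℝ → M) (a b : ℝ), IsMIntegralCurveOn γ u (Set.Ioo a b) ∧
    ∃ s ∈ Set.Ioo a b, ∃ t ∈ Set.Ioo a b, γ s = p ∧ f (γ t) ≠ 0

end Manifold

end GRW

end

noncomputable section

namespace GRW

/-! ## Partial derivatives of scalar and matrix valued functions -/

section Calculus

variable {n : ℕ} {U : Set (EuclideanSpace ℝ (Fin n))} {x : EuclideanSpace ℝ (Fin n)}
  {f h : EuclideanSpace ℝ (Fin n) → ℝ}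

/-! Write `∇_k σ = s u_k` with `s = -σ̇` (`negRate`). The tensor governing a conformal change, `T =
-∇∇σ + ∇σ ⊗ ∇σ - ½ |∇σ|² g`, is then a combination of `g` and `u ⊗ u`, because `u` is torse-forming
and `∇s` is parallel to `u`. The Riemann tensor changes by the Kulkarni-Nomizu product of `g` with
`T` (`riemann_conf`). Hence `C_{jkl}{}^m` is unchanged, the Ricci tensor gains only multiples of `g`
and `u ⊗ u`, and `e^{-σ} u` is again torse-forming and a Ricci eigenvector (`IsTorseOn.conf`). This
settles the GRW claim.

The divergence of the Weyl tensor changes only through the connection, by `(n - 3) s u_m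
C_{jkl}{}^m` (`weylDiv_conf`). In dimension three nothing is left to prove. For `n > 3` the
contraction `u_m C_{jkl}{}^m` must vanish, and it does as soon as `E`, the trace-free part of the
Ricci tensor orthogonal to `u` (`spatialRic`), is zero (`weyl_lower_fourth`).

To see that `E = 0`, contract `∇_m C_{jkl}{}^m = 0` with `u^j` and compare with the contracted
Bianchi identity and with the divergence of the known tensor `u^j R_{jkl}{}^m`. Both `φ R_{kl}` and
`u^j ∇_j R_{kl}` turn out to have the form `a g_{kl} + Y_k u_l` (`ricci_of_weylDiv`). The first fact
gives `E = 0` wherever `φ ≠ 0`; the second gives `∇_u E = 0` (`sum_cov2_spatialRic`). So `E` solves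
a homogeneous linear ODE along each integral curve of `u`, and one point with `φ ≠ 0` makes it
vanish on the whole curve (`isFluidAt_propagates`).

The calculus takes place in charts, with connections as matrix valued one-forms, so that the Bianchi
identity, skewness and gauge changes become noncommutative ring identities. Since an integral curve
may cross several charts, the transformation law of the Ricci tensor is needed (`ric_transform`). -/

lemma _root_.ContDiffOn.differentiableAt_of_isOpen (hf : ContDiffOn ℝ ∞ f U) (hU : IsOpen U)
    (hx : x ∈ U) : DifferentiableAt ℝ f x :=
  (hf.contDiffAt (hU.mem_nhds hx)).differentiableAt (by simp)

lemma pd_add (i : Fin n) (hf : DifferentiableAt ℝ f x) (hh : DifferentiableAt ℝ h x) :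
    pd i (fun y => f y + h y) x = pd i f x + pd i h x := by
  simp [pd, fderiv_fun_add hf hh]

lemma pd_sub (i : Fin n) (hf : DifferentiableAt ℝ f x) (hh : DifferentiableAt ℝ h x) :
    pd i (fun y => f y - h y) x = pd i f x - pd i h x := by
  simp [pd, fderiv_fun_sub hf hh]

lemma pd_neg (i : Fin n) : pd i (fun y => - f y) x = - pd i f x := by
  simp [pd, fderiv_fun_neg]

lemma pd_mul (i : Fin n) (hf : DifferentiableAt ℝ f x) (hh : DifferentiableAt ℝ h x) :
    pd i (fun y => f y * h y) x = pd i f x * h x + f x * pd i h x := by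
  simp [pd, fderiv_fun_mul hf hh]; ring

lemma pd_const (i : Fin n) (c : ℝ) : pd i (fun _ => c) x = 0 := by
  simp [pd]

lemma pd_const_mul (i : Fin n) (c : ℝ) (hf : DifferentiableAt ℝ f x) :
    pd i (fun y => c * f y) x = c * pd i f x := by
  simp [pd, fderiv_const_mul hf c]

lemma pd_sum {ι : Type*} (s : Finset ι) (i : Fin n) {F : ι → EuclideanSpace ℝ (Fin n) → ℝ}
    (hF : ∀ a ∈ s, DifferentiableAt ℝ (F a) x) :
    pd i (fun y => ∑ a ∈ s, F a y) x = ∑ a ∈ s, pd i (F a) x := by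
  simp [pd, fderiv_fun_sum hF]

lemma pd_exp (i : Fin n) (hf : DifferentiableAt ℝ f x) :
    pd i (fun y => Real.exp (f y)) x = Real.exp (f x) * pd i f x := by
  simp [pd, fderiv_exp hf]

lemma pd_congr (i : Fin n) (hU : IsOpen U) (hx : x ∈ U) (hfh : ∀ y ∈ U, f y = h y) :
    pd i f x = pd i h x := by
  have : f =ᶠ[nhds x] h := by
    filter_upwards [hU.mem_nhds hx] with y hy using hfh y hy
  simp [pd, this.fderiv_eq]

lemma contDiffOn_pd (i : Fin n) (hU : IsOpen U) (hf : ContDiffOn ℝ ∞ f U) :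
    ContDiffOn ℝ ∞ (pd i f) U :=
  (hf.fderiv_of_isOpen hU (m := ∞) (by simp)).clm_apply contDiffOn_const

lemma pd_comm (i j : Fin n) (hU : IsOpen U) (hf : ContDiffOn ℝ ∞ f U) (hx : x ∈ U) :
    pd i (pd j f) x = pd j (pd i f) x := by
  have hd : DifferentiableAt ℝ (fderiv ℝ f) x :=
    ((hf.fderiv_of_isOpen hU (m := ∞) (by simp)).contDiffAt (hU.mem_nhds hx)).differentiableAt
      (by simp)
  have key : ∀ k l : Fin n, pd k (pd l f) x
      = fderiv ℝ (fderiv ℝ f) x (EuclideanSpace.single k 1) (EuclideanSpace.single l 1) := by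
    intro k l
    unfold pd
    rw [fderiv_clm_apply hd (by fun_prop)]
    simp
  rw [key, key]
  have hs : IsSymmSndFDerivAt ℝ f x :=
    (hf.contDiffAt (hU.mem_nhds hx)).isSymmSndFDerivAt
      (by simpa using WithTop.coe_le_coe.2 (le_top : (2 : ℕ∞) ≤ ⊤))
  exact hs.eq _ _

lemma fderiv_eq_sum_pd (v : EuclideanSpace ℝ (Fin n)) :
    fderiv ℝ f x v = ∑ i, v i * pd i f x := by
  have hv : v = ∑ i, v i • EuclideanSpace.single i (1 : ℝ) := by
    ext j
    simp [Pi.single_apply]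
  conv_lhs => rw [hv]
  simp [pd]

/-- Entrywise partial derivative of a matrix valued function. -/
def pdM (i : Fin n) (A : Components n) : Components n :=
  fun x => Matrix.of fun a b => pd i (fun y => A y a b) x

/-- Entrywise smoothness of a matrix valued function. -/
def SmoothM (A : Components n) (U : Set (EuclideanSpace ℝ (Fin n))) : Prop :=
  ∀ a b, ContDiffOn ℝ ∞ (fun y => A y a b) U

variable {A B : Components n}

lemma SmoothM.diffAt (hA : SmoothM A U) (hU : IsOpen U) (hx : x ∈ U) (a b : Fin n) :
    DifferentiableAt ℝ (fun y => A y a b) x :=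
  (hA a b).differentiableAt_of_isOpen hU hx

lemma SmoothM.add (hA : SmoothM A U) (hB : SmoothM B U) : SmoothM (fun y => A y + B y) U :=
  fun a b => (hA a b).add (hB a b)

lemma SmoothM.sub (hA : SmoothM A U) (hB : SmoothM B U) : SmoothM (fun y => A y - B y) U :=
  fun a b => (hA a b).sub (hB a b)

lemma SmoothM.transpose (hA : SmoothM A U) : SmoothM (fun y => (A y)ᵀ) U :=
  fun a b => hA b a

lemma SmoothM.mul (hA : SmoothM A U) (hB : SmoothM B U) : SmoothM (fun y => A y * B y) U := by
  intro a b
  simp only [Matrix.mul_apply]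
  exact ContDiffOn.sum fun i _ => (hA a i).mul (hB i b)

lemma SmoothM.smul (hf : ContDiffOn ℝ ∞ f U) (hB : SmoothM B U) :
    SmoothM (fun y => f y • B y) U :=
  fun a b => hf.mul (hB a b)

lemma SmoothM.sum {ι : Type*} (s : Finset ι) {F : ι → Components n}
    (hF : ∀ a ∈ s, SmoothM (F a) U) : SmoothM (fun y => ∑ a ∈ s, F a y) U := by
  intro a b
  simp only [Matrix.sum_apply]
  exact ContDiffOn.sum fun i hi => hF i hi a b

lemma SmoothM.pdM (i : Fin n) (hU : IsOpen U) (hA : SmoothM A U) : SmoothM (pdM i A) U :=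
  fun a b => contDiffOn_pd i hU (hA a b)

lemma SmoothM.det (hA : SmoothM A U) : ContDiffOn ℝ ∞ (fun y => (A y).det) U := by
  simp only [Matrix.det_apply']
  exact ContDiffOn.sum fun p _ => contDiffOn_const.mul
    (contDiffOn_prod fun i _ => hA (p i) i)

/-- Cramer's rule: entries of the adjugate are determinants of matrices with one row replaced by a
constant. -/
lemma SmoothM.inv (hA : SmoothM A U) (hdet : ∀ y ∈ U, IsUnit (A y).det) :
    SmoothM (fun y => (A y)⁻¹) U := by
  intro a b
  have h1 : ContDiffOn ℝ ∞ (fun y => (A y).adjugate a b) U := by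
    simp only [Matrix.adjugate_apply]
    refine SmoothM.det (A := fun y => (A y).updateRow b (Pi.single a 1)) fun c d => ?_
    by_cases hc : c = b
    · subst hc
      simpa using contDiffOn_const
    · simpa [Matrix.updateRow_apply, hc] using hA c d
  have h2 : ContDiffOn ℝ ∞ (fun y => ((A y).det)⁻¹) U :=
    hA.det.inv fun y hy => (hdet y hy).ne_zero
  refine (h2.mul h1).congr fun y _ => ?_
  simp [Matrix.inv_def]

lemma pdM_congr (i : Fin n) (hU : IsOpen U) (hx : x ∈ U) (hAB : ∀ y ∈ U, A y = B y) :
    pdM i A x = pdM i B x := by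
  ext a b
  exact pd_congr i hU hx fun y hy => by rw [hAB y hy]

lemma pdM_add (i : Fin n) (hU : IsOpen U) (hA : SmoothM A U) (hB : SmoothM B U) (hx : x ∈ U) :
    pdM i (fun y => A y + B y) x = pdM i A x + pdM i B x := by
  ext a b
  exact pd_add i (hA.diffAt hU hx a b) (hB.diffAt hU hx a b)

lemma pdM_sub (i : Fin n) (hU : IsOpen U) (hA : SmoothM A U) (hB : SmoothM B U) (hx : x ∈ U) :
    pdM i (fun y => A y - B y) x = pdM i A x - pdM i B x := by
  ext a b
  exact pd_sub i (hA.diffAt hU hx a b) (hB.diffAt hU hx a b)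

lemma pdM_transpose (i : Fin n) : pdM i (fun y => (A y)ᵀ) x = (pdM i A x)ᵀ := rfl

lemma pdM_mul (i : Fin n) (hU : IsOpen U) (hA : SmoothM A U) (hB : SmoothM B U) (hx : x ∈ U) :
    pdM i (fun y => A y * B y) x = pdM i A x * B x + A x * pdM i B x := by
  ext a b
  simp only [pdM, Matrix.of_apply, Matrix.add_apply, Matrix.mul_apply]
  rw [pd_sum (F := fun k y => A y a k * B y k b) _ _
    fun k _ => (hA.diffAt hU hx a k).fun_mul (hB.diffAt hU hx k b), ← Finset.sum_add_distrib]
  exact Finset.sum_congr rfl fun k _ => pd_mul i (hA.diffAt hU hx a k) (hB.diffAt hU hx k b)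

lemma pdM_smul (i : Fin n) (hU : IsOpen U) (hf : ContDiffOn ℝ ∞ f U) (hB : SmoothM B U)
    (hx : x ∈ U) : pdM i (fun y => f y • B y) x = pd i f x • B x + f x • pdM i B x := by
  ext a b
  exact pd_mul i (hf.differentiableAt_of_isOpen hU hx) (hB.diffAt hU hx a b)

lemma pdM_sum {ι : Type*} (s : Finset ι) (i : Fin n) (hU : IsOpen U) {F : ι → Components n}
    (hF : ∀ a ∈ s, SmoothM (F a) U) (hx : x ∈ U) :
    pdM i (fun y => ∑ a ∈ s, F a y) x = ∑ a ∈ s, pdM i (F a) x := by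
  ext a b
  simp only [pdM, Matrix.of_apply, Matrix.sum_apply]
  exact pd_sum s i fun k hk => (hF k hk).diffAt hU hx a b

lemma pdM_comm (i j : Fin n) (hU : IsOpen U) (hA : SmoothM A U) (hx : x ∈ U) :
    pdM i (pdM j A) x = pdM j (pdM i A) x := by
  ext a b
  exact pd_comm i j hU (hA a b) hx

end Calculus

/-! ## Connections as matrix valued one-forms -/

section Connection

variable {n : ℕ} {U : Set (EuclideanSpace ℝ (Fin n))} {x : EuclideanSpace ℝ (Fin n)}

/-- The curvature `∂_k A_j - ∂_j A_k + [A_k, A_j]` of a matrix valued one-form `A`. -/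
def curv (A : Fin n → Components n) (j k : Fin n) : Components n :=
  fun x => pdM k (A j) x - pdM j (A k) x + (A k x * A j x - A j x * A k x)

/-- The Christoffel symbols as a matrix valued one-form, `(Γ_i)^m_l = Γ^m_{il}`. -/
def gam (G : Components n) (i : Fin n) : Components n :=
  fun x => Matrix.of fun m l => christoffel G m i l x

/-- The dictionary between matrix identities and index identities: the row is the upper index `m`,
the column the lower index `l`. -/
lemma curv_gam_apply (G : Components n) (j k l m : Fin n) :
    curv (gam G) j k x m l = riemann G j k l m x := by
  simp [curv, gam, riemann, pdM, Matrix.mul_apply, Finset.sum_sub_distrib]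

lemma curv_antisymm (A : Fin n → Components n) (j k : Fin n) :
    curv A j k x = - curv A k j x := by
  simp only [curv]; abel

lemma smoothM_curv (hU : IsOpen U) {A : Fin n → Components n} (hA : ∀ i, SmoothM (A i) U)
    (j k : Fin n) : SmoothM (curv A j k) U :=
  (((hA j).pdM k hU).sub ((hA k).pdM j hU)).add
    (((hA k).mul (hA j)).sub ((hA j).mul (hA k)))

/-- The second Bianchi identity, for an arbitrary connection. -/
lemma curv_bianchi (hU : IsOpen U) {A : Fin n → Components n} (hA : ∀ i, SmoothM (A i) U)
    (hx : x ∈ U) (i j k : Fin n) :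
    (pdM i (curv A j k) x + A i x * curv A j k x - curv A j k x * A i x)
    + (pdM j (curv A k i) x + A j x * curv A k i x - curv A k i x * A j x)
    + (pdM k (curv A i j) x + A k x * curv A i j x - curv A i j x * A k x) = 0 := by
  have key : ∀ i j k : Fin n, pdM i (curv A j k) x
      = pdM i (pdM k (A j)) x - pdM i (pdM j (A k)) x
        + ((pdM i (A k) x * A j x + A k x * pdM i (A j) x)
          - (pdM i (A j) x * A k x + A j x * pdM i (A k) x)) := by
    intro i j k
    unfold curv
    rw [pdM_add i hU (((hA j).pdM k hU).sub ((hA k).pdM j hU))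
      (((hA k).mul (hA j)).sub ((hA j).mul (hA k))) hx,
      pdM_sub i hU ((hA j).pdM k hU) ((hA k).pdM j hU) hx,
      pdM_sub i hU ((hA k).mul (hA j)) ((hA j).mul (hA k)) hx,
      pdM_mul i hU (hA k) (hA j) hx, pdM_mul i hU (hA j) (hA k) hx]
  -- Once second derivatives commute, the cyclic sum cancels formally in the noncommutative ring of
  -- matrices.
  rw [key, key, key, pdM_comm i k hU (hA j) hx, pdM_comm i j hU (hA k) hx,
    pdM_comm j k hU (hA i) hx]
  simp only [curv]
  noncomm_ring

/-- The curvature of a metric connection is skew. -/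
lemma curv_skew (hU : IsOpen U) {A : Fin n → Components n} (hA : ∀ i, SmoothM (A i) U)
    {G : Components n} (hG : SmoothM G U)
    (hc : ∀ i, ∀ y ∈ U, pdM i G y = (A i y)ᵀ * G y + G y * A i y) (hx : x ∈ U) (j k : Fin n) :
    (curv A j k x)ᵀ * G x + G x * curv A j k x = 0 := by
  have key : ∀ i j : Fin n, pdM i (pdM j G) x
      = (pdM i (A j) x)ᵀ * G x + (A j x)ᵀ * ((A i x)ᵀ * G x + G x * A i x)
        + (((A i x)ᵀ * G x + G x * A i x) * A j x + G x * pdM i (A j) x) := by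
    intro i j
    rw [pdM_congr i hU hx (hc j), pdM_add i hU ((hA j).transpose.mul hG) (hG.mul (hA j)) hx,
      pdM_mul i hU (hA j).transpose hG hx, pdM_mul i hU hG (hA j) hx, hc i x hx,
      pdM_transpose]
  -- Metric compatibility is differentiated once more and antisymmetrised; the second partials of
  -- `G` cancel and what remains is the failure of the curvature to be skew.
  have h := pdM_comm k j hU hG hx
  rw [key, key] at h
  rw [← sub_eq_zero] at h
  rw [← h]
  simp only [curv, Matrix.transpose_add, Matrix.transpose_sub, Matrix.transpose_mul]
  noncomm_ring

/-- A smooth pseudo-Riemannian metric on an open set, in components. -/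
structure IsMetricOn (G : Components n) (U : Set (EuclideanSpace ℝ (Fin n))) : Prop where
  isOpen : IsOpen U
  smooth : SmoothM G U
  symm : ∀ y ∈ U, ∀ i j, G y i j = G y j i
  det : ∀ y ∈ U, IsUnit (G y).det

variable {G : Components n}

namespace IsMetricOn

lemma transpose (hG : IsMetricOn G U) (hx : x ∈ U) : (G x)ᵀ = G x := by
  ext i j; exact hG.symm x hx j i

lemma inv_symm (hG : IsMetricOn G U) (hx : x ∈ U) (i j : Fin n) :
    (G x)⁻¹ i j = (G x)⁻¹ j i := by
  have : ((G x)⁻¹)ᵀ = (G x)⁻¹ := by rw [Matrix.transpose_nonsing_inv, hG.transpose hx]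
  exact congrFun (congrFun this j) i

lemma mul_inv (hG : IsMetricOn G U) (hx : x ∈ U) : G x * (G x)⁻¹ = 1 :=
  Matrix.mul_nonsing_inv _ (hG.det x hx)

lemma inv_mul (hG : IsMetricOn G U) (hx : x ∈ U) : (G x)⁻¹ * G x = 1 :=
  Matrix.nonsing_inv_mul _ (hG.det x hx)

lemma smoothInv (hG : IsMetricOn G U) : SmoothM (fun y => (G y)⁻¹) U := hG.smooth.inv hG.det

lemma pd_symm (hG : IsMetricOn G U) (hx : x ∈ U) (l i j : Fin n) :
    pd l (fun y => G y i j) x = pd l (fun y => G y j i) x :=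
  pd_congr l hG.isOpen hx fun y hy => hG.symm y hy i j

lemma christoffel_symm (hG : IsMetricOn G U) (hx : x ∈ U) (m i j : Fin n) :
    christoffel G m i j x = christoffel G m j i x := by
  unfold christoffel
  congr 1
  refine Finset.sum_congr rfl fun l _ => ?_
  rw [hG.pd_symm hx l i j]
  ring

lemma smoothGam (hG : IsMetricOn G U) (i : Fin n) : SmoothM (gam G i) U := by
  intro m l
  simp only [gam, Matrix.of_apply, christoffel]
  refine contDiffOn_const.mul (ContDiffOn.sum fun p _ => (hG.smoothInv m p).mul ?_)
  exact ((contDiffOn_pd i hG.isOpen (hG.smooth _ _)).add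
    (contDiffOn_pd l hG.isOpen (hG.smooth _ _))).sub
    (contDiffOn_pd p hG.isOpen (hG.smooth _ _))

/-- The Christoffel symbols of the first kind. -/
lemma sum_mul_christoffel (hG : IsMetricOn G U) (hx : x ∈ U) (q i j : Fin n) :
    ∑ m, G x q m * christoffel G m i j x = (1 / 2) *
      (pd i (fun y => G y j q) x + pd j (fun y => G y i q) x - pd q (fun y => G y i j) x) := by
  set k : Fin n → ℝ := fun l =>
    pd i (fun y => G y j l) x + pd j (fun y => G y i l) x - pd l (fun y => G y i j) x
  have h1 : (fun m => christoffel G m i j x) = (1 / 2 : ℝ) • ((G x)⁻¹ *ᵥ k) := by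
    ext m; simp [christoffel, Matrix.mulVec, dotProduct, k]
  have h2 : G x *ᵥ (fun m => christoffel G m i j x) = (1 / 2 : ℝ) • k := by
    rw [h1, Matrix.mulVec_smul, Matrix.mulVec_mulVec, hG.mul_inv hx, Matrix.one_mulVec]
  exact congrFun h2 q

/-- The Levi-Civita connection is metric. -/
lemma compat (hG : IsMetricOn G U) (hx : x ∈ U) (i : Fin n) :
    pdM i G x = (gam G i x)ᵀ * G x + G x * gam G i x := by
  ext a b
  have h1 := hG.sum_mul_christoffel hx a i b
  have h2 := hG.sum_mul_christoffel hx b i a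
  have h3 : ((gam G i x)ᵀ * G x) a b = ∑ m, G x b m * christoffel G m i a x := by
    simp only [Matrix.mul_apply, Matrix.transpose_apply, gam, Matrix.of_apply]
    exact Finset.sum_congr rfl fun m _ => by rw [hG.symm x hx m b]; ring
  have h4 : (G x * gam G i x) a b = ∑ m, G x a m * christoffel G m i b x := rfl
  rw [Matrix.add_apply, h3, h4, h1, h2, hG.pd_symm hx i b a, hG.pd_symm hx a i b,
    hG.pd_symm hx b i a]
  simp only [pdM, Matrix.of_apply]
  rw [hG.pd_symm hx b a i, hG.pd_symm hx a b i]
  ring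

/-- The Levi-Civita connection is the only torsion-free metric connection. -/
lemma gam_unique (hG : IsMetricOn G U) (hx : x ∈ U) (X : Fin n → Matrix (Fin n) (Fin n) ℝ)
    (hs : ∀ m i l, X i m l = X l m i)
    (hc : ∀ i, pdM i G x = (X i)ᵀ * G x + G x * X i) (i : Fin n) :
    gam G i x = X i := by
  have hG' : G x * gam G i x = G x * X i := by
    ext q j
    have hd : ∀ i a b, pd i (fun y => G y a b) x
        = ∑ m, G x b m * X i m a + ∑ m, G x a m * X i m b := by
      intro i a b
      have := congrFun (congrFun (hc i) a) b
      simp only [pdM, Matrix.of_apply, Matrix.add_apply, Matrix.mul_apply,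
        Matrix.transpose_apply] at this
      rw [this]
      congr 1
      exact Finset.sum_congr rfl fun m _ => by rw [hG.symm x hx m b]; ring
    have h1 : (G x * gam G i x) q j = ∑ m, G x q m * christoffel G m i j x := rfl
    rw [h1, hG.sum_mul_christoffel hx, hd, hd, hd, Matrix.mul_apply]
    -- Koszul's argument: of the six terms, symmetry of `X` in its lower indices cancels four and
    -- makes the other two equal.
    have e1 : ∀ m, X j m i = X i m j := fun m => hs m j i
    have e2 : ∀ m, X q m i = X i m q := fun m => hs m q i
    have e3 : ∀ m, X q m j = X j m q := fun m => hs m q j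
    simp only [e1, e2, e3]
    ring
  have := congrArg (fun Z => (G x)⁻¹ * Z) hG'
  simpa [← Matrix.mul_assoc, hG.inv_mul hx] using this

/-- The Riemann tensor with all indices down, `R_{jklm} = R_{jkl}{}^p g_{pm}`. -/
lemma riemann_skew (hG : IsMetricOn G U) (hx : x ∈ U) (j k l m : Fin n) :
    ∑ p, riemann G j k l p x * G x p m = - ∑ p, riemann G j k m p x * G x p l := by
  have h := curv_skew hG.isOpen hG.smoothGam hG.smooth (fun i y hy => hG.compat hy i) hx j k
  have h' := congrFun (congrFun h l) m
  simp only [Matrix.add_apply, Matrix.mul_apply, Matrix.transpose_apply, curv_gam_apply,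
    Matrix.zero_apply] at h'
  rw [eq_neg_iff_add_eq_zero, ← h']
  congr 1
  exact Finset.sum_congr rfl fun p _ => by rw [hG.symm x hx p l]; ring

/-- Absence of torsion suffices: with symmetric Christoffel symbols, derivative and quadratic terms
cancel in pairs. -/
lemma riemann_bianchi (hG : IsMetricOn G U) (hx : x ∈ U) (j k l m : Fin n) :
    riemann G j k l m x + riemann G k l j m x + riemann G l j k m x = 0 := by
  have hp : ∀ i a b, pd i (christoffel G m a b) x = pd i (christoffel G m b a) x := fun i a b =>
    pd_congr i hG.isOpen hx fun y hy => hG.christoffel_symm hy m a b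
  simp only [riemann, Finset.sum_sub_distrib]
  rw [hp k j l, hp l k j, hp j l k]
  simp only [hG.christoffel_symm hx _ l j, hG.christoffel_symm hx _ k j,
    hG.christoffel_symm hx _ l k]
  ring

lemma riemann_antisymm (G : Components n) (j k l m : Fin n) :
    riemann G j k l m x = - riemann G k j l m x := by
  rw [← curv_gam_apply, ← curv_gam_apply, curv_antisymm]; rfl

end IsMetricOn

end Connection

/-! ## Behaviour of the Ricci tensor under a change of coordinates -/

section ChangeOfCoordinates

variable {n : ℕ} {U V : Set (EuclideanSpace ℝ (Fin n))} {x : EuclideanSpace ℝ (Fin n)}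

/-- The curvatures of gauge equivalent connections are conjugate. -/
lemma curv_gauge (hU : IsOpen U) {A B : Fin n → Components n} (hA : ∀ i, SmoothM (A i) U)
    (hB : ∀ i, SmoothM (B i) U) {J : Components n} (hJ : SmoothM J U)
    (h : ∀ i, ∀ y ∈ U, J y * B i y = A i y * J y + pdM i J y) (hx : x ∈ U) (i j : Fin n) :
    J x * curv B i j x = curv A i j x * J x := by
  -- This is the derivative of the gauge relation `J B_i = A_i J + ∂_i J`. Its term `∂_j J B_i` will
  -- cancel against the one in `J B_j B_i`.
  have key : ∀ i j : Fin n, J x * pdM j (B i) x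
      = pdM j (A i) x * J x + A i x * pdM j J x + pdM j (pdM i J) x - pdM j J x * B i x := by
    intro i j
    have h1 := pdM_congr j hU hx (h i)
    rw [pdM_mul j hU hJ (hB i) hx, pdM_add j hU ((hA i).mul hJ) (hJ.pdM i hU) hx,
      pdM_mul j hU (hA i) hJ hx] at h1
    rw [← h1]; abel
  have e1 : J x * (B j x * B i x) = (A j x * J x + pdM j J x) * B i x := by
    rw [← mul_assoc, h j x hx]
  have e2 : J x * (B i x * B j x) = (A i x * J x + pdM i J x) * B j x := by
    rw [← mul_assoc, h i x hx]
  have e3 : A j x * J x * B i x = A j x * (A i x * J x + pdM i J x) := by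
    rw [mul_assoc, h i x hx]
  have e4 : A i x * J x * B j x = A i x * (A j x * J x + pdM j J x) := by
    rw [mul_assoc, h j x hx]
  simp only [curv, mul_add, mul_sub, add_mul, sub_mul] at *
  rw [key i j, key j i, e1, e2, e3, e4, pdM_comm i j hU hJ hx]
  noncomm_ring

/-- The Jacobian matrix of a map, `J^a_i = ∂_i ψ^a`. -/
def jac (ψ : EuclideanSpace ℝ (Fin n) → EuclideanSpace ℝ (Fin n)) : Components n :=
  fun y => Matrix.of fun a i => pd i (fun z => ψ z a) y

variable {ψ : EuclideanSpace ℝ (Fin n) → EuclideanSpace ℝ (Fin n)}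

lemma contDiffOn_coord (hψ : ContDiffOn ℝ ∞ ψ V) (a : Fin n) :
    ContDiffOn ℝ ∞ (fun z => ψ z a) V :=
  (EuclideanSpace.proj (𝕜 := ℝ) a).contDiff.comp_contDiffOn hψ

lemma smoothM_jac (hV : IsOpen V) (hψ : ContDiffOn ℝ ∞ ψ V) : SmoothM (jac ψ) V :=
  fun a i => contDiffOn_pd i hV (contDiffOn_coord hψ a)

lemma pdM_jac_symm (hV : IsOpen V) (hψ : ContDiffOn ℝ ∞ ψ V) (hx : x ∈ V) (i l a : Fin n) :
    pdM i (jac ψ) x a l = pdM l (jac ψ) x a i :=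
  pd_comm i l hV (contDiffOn_coord hψ a) hx

lemma fderiv_apply_single (hV : IsOpen V) (hψ : ContDiffOn ℝ ∞ ψ V) (hx : x ∈ V) (i a : Fin n) :
    fderiv ℝ ψ x (EuclideanSpace.single i 1) a = jac ψ x a i := by
  have hd : DifferentiableAt ℝ ψ x := (hψ.contDiffAt (hV.mem_nhds hx)).differentiableAt (by simp)
  have := ((EuclideanSpace.proj (𝕜 := ℝ) a).hasFDerivAt.comp x hd.hasFDerivAt).fderiv
  have h2 : jac ψ x a i = fderiv ℝ (⇑(EuclideanSpace.proj (𝕜 := ℝ) a) ∘ ψ) x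
    (EuclideanSpace.single i 1) := rfl
  rw [h2, this]; rfl

/-- The chain rule. -/
lemma pd_comp (hU : IsOpen U) (hV : IsOpen V) (hψ : ContDiffOn ℝ ∞ ψ V) (hVU : Set.MapsTo ψ V U)
    {f : EuclideanSpace ℝ (Fin n) → ℝ} (hf : ContDiffOn ℝ ∞ f U) (hx : x ∈ V) (i : Fin n) :
    pd i (fun y => f (ψ y)) x = ∑ a, jac ψ x a i * pd a f (ψ x) := by
  have hd : DifferentiableAt ℝ ψ x := (hψ.contDiffAt (hV.mem_nhds hx)).differentiableAt (by simp)
  have hf' := hf.differentiableAt_of_isOpen hU (hVU hx)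
  have : fderiv ℝ (fun y => f (ψ y)) x = (fderiv ℝ f (ψ x)).comp (fderiv ℝ ψ x) :=
    fderiv_comp x hf' hd
  rw [pd, this, ContinuousLinearMap.comp_apply, fderiv_eq_sum_pd]
  exact Finset.sum_congr rfl fun a _ => by rw [fderiv_apply_single hV hψ hx]

lemma SmoothM.comp (hψ : ContDiffOn ℝ ∞ ψ V) (hVU : Set.MapsTo ψ V U) {A : Components n}
    (hA : SmoothM A U) : SmoothM (fun y => A (ψ y)) V :=
  fun a b => (hA a b).comp hψ hVU

lemma pdM_comp (hU : IsOpen U) (hV : IsOpen V) (hψ : ContDiffOn ℝ ∞ ψ V)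
    (hVU : Set.MapsTo ψ V U) {A : Components n} (hA : SmoothM A U) (hx : x ∈ V) (i : Fin n) :
    pdM i (fun y => A (ψ y)) x = ∑ a, jac ψ x a i • pdM a A (ψ x) := by
  ext p q
  simp only [pdM, Matrix.of_apply, Matrix.sum_apply, Matrix.smul_apply, smul_eq_mul]
  exact pd_comp hU hV hψ hVU (hA p q) hx i

/-- The pullback of a matrix valued one-form. -/
def pullback (ψ : EuclideanSpace ℝ (Fin n) → EuclideanSpace ℝ (Fin n)) (A : Fin n → Components n)
    (i : Fin n) : Components n :=
  fun y => ∑ a, jac ψ y a i • A a (ψ y)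

lemma smoothM_pullback (hV : IsOpen V) (hψ : ContDiffOn ℝ ∞ ψ V) (hVU : Set.MapsTo ψ V U)
    {A : Fin n → Components n} (hA : ∀ i, SmoothM (A i) U) (i : Fin n) :
    SmoothM (pullback ψ A i) V :=
  SmoothM.sum (F := fun a y => jac ψ y a i • A a (ψ y)) _ fun a _ =>
    SmoothM.smul (smoothM_jac hV hψ a i) ((hA a).comp hψ hVU)

/-- Curvature pulls back as a two-form: the second derivatives of `ψ` are symmetric (`pdM_jac_symm`)
and drop out on antisymmetrising. -/
lemma curv_pullback (hU : IsOpen U) (hV : IsOpen V) (hψ : ContDiffOn ℝ ∞ ψ V)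
    (hVU : Set.MapsTo ψ V U) {A : Fin n → Components n} (hA : ∀ i, SmoothM (A i) U)
    (hx : x ∈ V) (i j : Fin n) :
    curv (pullback ψ A) i j x
      = ∑ a, ∑ b, (jac ψ x a i * jac ψ x b j) • curv A a b (ψ x) := by
  have key : ∀ i j : Fin n, pdM j (pullback ψ A i) x
      = ∑ a, pdM j (jac ψ) x a i • A a (ψ x)
        + ∑ a, ∑ b, (jac ψ x a i * jac ψ x b j) • pdM b (A a) (ψ x) := by
    intro i j
    unfold pullback
    rw [pdM_sum (F := fun a y => jac ψ y a i • A a (ψ y)) _ j hV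
      (fun a _ => SmoothM.smul (smoothM_jac hV hψ a i) ((hA a).comp hψ hVU)) hx,
      ← Finset.sum_add_distrib]
    refine Finset.sum_congr rfl fun a _ => ?_
    rw [pdM_smul j hV (smoothM_jac hV hψ a i) ((hA a).comp hψ hVU) hx,
      pdM_comp hU hV hψ hVU (hA a) hx, Finset.smul_sum]
    simp only [smul_smul]
    rfl
  have hmul : ∀ i j : Fin n, pullback ψ A i x * pullback ψ A j x
      = ∑ a, ∑ b, (jac ψ x a i * jac ψ x b j) • (A a (ψ x) * A b (ψ x)) := by
    intro i j
    simp only [pullback, Finset.sum_mul_sum, smul_mul_smul_comm]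
  have hswap : ∀ F : Fin n → Fin n → Matrix (Fin n) (Fin n) ℝ,
      ∑ a, ∑ b, (jac ψ x a j * jac ψ x b i) • F a b
        = ∑ a, ∑ b, (jac ψ x a i * jac ψ x b j) • F b a := by
    intro F
    rw [Finset.sum_comm]
    simp only [mul_comm]
  have hs : ∀ a, pdM i (jac ψ) x a j = pdM j (jac ψ) x a i :=
    fun a => pdM_jac_symm hV hψ hx i j a
  unfold curv
  rw [key, key, hmul, hmul, hswap, hswap]
  simp only [hs, smul_add, smul_sub, Finset.sum_add_distrib, Finset.sum_sub_distrib]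
  abel

variable {G G' : Components n}

/-- Nondegeneracy of the pulled back metric already forces the Jacobian to be invertible, so `ψ`
need not be known to be a diffeomorphism. -/
lemma IsMetricOn.isUnit_jac (hG' : IsMetricOn G' V)
    (h : ∀ y ∈ V, G' y = (jac ψ y)ᵀ * G (ψ y) * jac ψ y) (hx : x ∈ V) :
    IsUnit (jac ψ x).det := by
  have h1 := hG'.det x hx
  rw [h x hx, Matrix.det_mul] at h1
  exact isUnit_of_mul_isUnit_right h1

/-- The transformation law of the Christoffel symbols. -/
lemma IsMetricOn.gam_transform (hG : IsMetricOn G U) (hG' : IsMetricOn G' V)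
    (hψ : ContDiffOn ℝ ∞ ψ V) (hVU : Set.MapsTo ψ V U)
    (h : ∀ y ∈ V, G' y = (jac ψ y)ᵀ * G (ψ y) * jac ψ y) (hx : x ∈ V) (i : Fin n) :
    jac ψ x * gam G' i x = pullback ψ (gam G) i x * jac ψ x + pdM i (jac ψ) x := by
  have hV := hG'.isOpen
  have hu := hG'.isUnit_jac h hx
  set J := jac ψ x with hJ
  set Y : Fin n → Matrix (Fin n) (Fin n) ℝ := fun i =>
    pullback ψ (gam G) i x * J + pdM i (jac ψ) x with hY
  have hJJ : J * J⁻¹ = 1 := Matrix.mul_nonsing_inv _ hu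
  have hJX : ∀ i, J * (J⁻¹ * Y i) = Y i := fun i => by rw [← mul_assoc, hJJ, one_mul]
  have hsY : ∀ a i l, Y i a l = Y l a i := by
    intro a i l
    simp only [hY, Matrix.add_apply, pullback, Matrix.sum_mul, Matrix.sum_apply, smul_mul_assoc,
      Matrix.smul_apply, Matrix.mul_apply, smul_eq_mul, Finset.mul_sum]
    rw [pdM_jac_symm hV hψ hx i l a, Finset.sum_comm]
    congr 1
    refine Finset.sum_congr rfl fun b _ => Finset.sum_congr rfl fun c _ => ?_
    simp only [gam, Matrix.of_apply]
    rw [hG.christoffel_symm (hVU hx)]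
    ring
  -- The candidate `J⁻¹ Y` is torsion-free and metric for `G'`, so `gam_unique` identifies it
  -- without computing any Christoffel symbol.
  have hmain : gam G' i x = J⁻¹ * Y i := by
    refine hG'.gam_unique hx (fun i => J⁻¹ * Y i) ?_ ?_ i
    · intro m i l
      simp only [Matrix.mul_apply, hsY _ i l]
    · intro i
      have hJs := smoothM_jac hV hψ
      have hGs := hG.smooth.comp hψ hVU
      have hc : pdM i (fun y => G (ψ y)) x
          = (pullback ψ (gam G) i x)ᵀ * G (ψ x) + G (ψ x) * pullback ψ (gam G) i x := by
        rw [pdM_comp hG.isOpen hV hψ hVU hG.smooth hx]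
        simp only [hG.compat (hVU hx), pullback, Matrix.transpose_sum, Matrix.transpose_smul,
          Finset.sum_mul, Finset.mul_sum, smul_mul_assoc, mul_smul_comm, smul_add,
          Finset.sum_add_distrib]
      rw [pdM_congr i hV hx h, pdM_mul i hV (hJs.transpose.mul hGs) hJs hx,
        pdM_mul i hV hJs.transpose hGs hx, hc, pdM_transpose, h x hx]
      have e1 : Jᵀ * G (ψ x) * J * (J⁻¹ * Y i) = Jᵀ * G (ψ x) * Y i := by
        rw [mul_assoc _ J, hJX]
      have e2 : (J⁻¹ * Y i)ᵀ * (Jᵀ * G (ψ x) * J) = (Y i)ᵀ * G (ψ x) * J := by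
        rw [← mul_assoc, ← mul_assoc, ← Matrix.transpose_mul, hJX]
      rw [e1, e2]
      simp only [hY, Matrix.transpose_add, Matrix.transpose_mul]
      noncomm_ring
  rw [hmain, hJX]

/-- The Ricci tensor as a matrix valued function. -/
def ric (G : Components n) : Components n := fun x => Matrix.of fun k l => ricci G k l x

/-- The transformation law of the Ricci tensor. -/
lemma IsMetricOn.ric_transform (hG : IsMetricOn G U) (hG' : IsMetricOn G' V)
    (hψ : ContDiffOn ℝ ∞ ψ V) (hVU : Set.MapsTo ψ V U)
    (h : ∀ y ∈ V, G' y = (jac ψ y)ᵀ * G (ψ y) * jac ψ y) (hx : x ∈ V) :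
    ric G' x = (jac ψ x)ᵀ * ric G (ψ x) * jac ψ x := by
  have hV := hG'.isOpen
  have hu := hG'.isUnit_jac h hx
  have hgauge := curv_gauge hV (fun i => smoothM_pullback hV hψ hVU hG.smoothGam i)
    hG'.smoothGam (smoothM_jac hV hψ)
    (fun i y hy => hG.gam_transform hG' hψ hVU h hy i) hx
  set J := jac ψ x with hJ
  -- The curvature is pulled back in its form indices and conjugated by the Jacobian in its matrix
  -- indices; in the Ricci trace one factor `J` meets `J⁻¹`.
  have hF : ∀ i j, curv (gam G') i j x
      = J⁻¹ * (∑ a, ∑ b, (J a i * J b j) • curv (gam G) a b (ψ x)) * J := by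
    intro i j
    rw [← curv_pullback hG.isOpen hV hψ hVU hG.smoothGam hx, mul_assoc, ← hgauge, ← mul_assoc,
      Matrix.nonsing_inv_mul _ hu, one_mul]
  have hJJ : ∀ a p, ∑ m, J a m * J⁻¹ m p = (1 : Matrix (Fin n) (Fin n) ℝ) a p := by
    intro a p
    rw [← Matrix.mul_apply, Matrix.mul_nonsing_inv _ hu]
  ext k l
  have e1 : ric G' x k l = - ∑ m, curv (gam G') m k x m l := by
    simp [ric, ricci, curv_gam_apply]
  have e2 : ∀ b c, ric G (ψ x) b c = - ∑ m, curv (gam G) m b (ψ x) m c := by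
    intro b c
    simp [ric, ricci, curv_gam_apply]
  have e3 : ∑ m, curv (gam G') m k x m l
      = ∑ b, ∑ c, J b k * J c l * ∑ a, ∑ p, (∑ m, J a m * J⁻¹ m p)
        * curv (gam G) a b (ψ x) p c := by
    simp only [hF, Matrix.mul_apply, Matrix.sum_apply, Matrix.smul_apply, smul_eq_mul,
      Finset.mul_sum, Finset.sum_mul]
    have hc : ∀ f : Fin n → Fin n → Fin n → Fin n → Fin n → ℝ,
        ∑ m, ∑ c, ∑ a, ∑ b, ∑ p, f m c a b p = ∑ b, ∑ c, ∑ a, ∑ p, ∑ m, f m c a b p := by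
      intro f
      calc _ = ∑ c, ∑ m, ∑ a, ∑ b, ∑ p, f m c a b p := Finset.sum_comm
        _ = ∑ c, ∑ m, ∑ b, ∑ a, ∑ p, f m c a b p :=
          Finset.sum_congr rfl fun c _ => Finset.sum_congr rfl fun m _ => Finset.sum_comm
        _ = ∑ c, ∑ b, ∑ a, ∑ p, ∑ m, f m c a b p := by
          refine Finset.sum_congr rfl fun c _ => ?_
          rw [Finset.sum_comm]
          refine Finset.sum_congr rfl fun b _ => ?_
          rw [Finset.sum_comm]
          exact Finset.sum_congr rfl fun a _ => Finset.sum_comm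
        _ = _ := Finset.sum_comm
    rw [hc]
    refine Finset.sum_congr rfl fun b _ => Finset.sum_congr rfl fun c _ =>
      Finset.sum_congr rfl fun a _ => Finset.sum_congr rfl fun p _ =>
      Finset.sum_congr rfl fun m _ => ?_
    ring
  rw [e1, e3]
  simp only [hJJ, Matrix.one_apply, ite_mul, one_mul, zero_mul, Finset.sum_ite_eq,
    Finset.mem_univ, if_true]
  simp only [Matrix.mul_apply, Matrix.transpose_apply, e2, Finset.sum_mul]
  rw [Finset.sum_comm, ← Finset.sum_neg_distrib]
  refine Finset.sum_congr rfl fun b _ => ?_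
  rw [← Finset.sum_neg_distrib]
  exact Finset.sum_congr rfl fun c _ => by ring

end ChangeOfCoordinates

/-! ## Symmetries of the curvature tensor -/

section Symmetries

variable {n : ℕ} {U : Set (EuclideanSpace ℝ (Fin n))} {x : EuclideanSpace ℝ (Fin n)}
  {G : Components n}

/-- The octahedron argument: four cyclic identities are combined, and the two antisymmetries
identify the terms. -/
lemma pair_symm {ι : Type*} {T : ι → ι → ι → ι → ℝ} (h12 : ∀ j k l m, T j k l m = - T k j l m)
    (h34 : ∀ j k l m, T j k l m = - T j k m l)
    (hc : ∀ j k l m, T j k l m + T k l j m + T l j k m = 0) (j k l m : ι) :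
    T j k l m = T l m j k := by
  linarith [hc j k l m, hc k l m j, hc l m j k, hc m j k l, h12 j k l m, h34 j k l m,
    h12 k l j m, h34 k l j m, h12 l j k m, h34 l j k m, h12 k l m j, h34 k l m j,
    h12 l m k j, h34 l m k j, h12 m k l j, h34 m k l j, h12 l m j k, h34 l m j k,
    h12 m j l k, h34 m j l k, h12 j l m k, h34 j l m k, h12 m j k l, h34 m j k l,
    h12 j k m l, h34 j k m l, h12 k m j l, h34 k m j l]

/-- The last index of a `(1,3)`-tensor, lowered. -/
def low4 (g : Matrix (Fin n) (Fin n) ℝ) (T : Fin n → Fin n → Fin n → Fin n → ℝ)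
    (j k l m : Fin n) : ℝ := ∑ p, T j k l p * g p m

/-- The algebraic symmetries of a curvature tensor `T_{jkl}{}^m`, with respect to the metric
matrix `g`. -/
structure IsCurvatureLike (g : Matrix (Fin n) (Fin n) ℝ)
    (T : Fin n → Fin n → Fin n → Fin n → ℝ) : Prop where
  antisymm (j k l m : Fin n) : T j k l m = - T k j l m
  bianchi (j k l m : Fin n) : T j k l m + T k l j m + T l j k m = 0
  skew (j k l m : Fin n) : low4 g T j k l m = - low4 g T j k m l

lemma IsCurvatureLike.pair {g : Matrix (Fin n) (Fin n) ℝ}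
    {T : Fin n → Fin n → Fin n → Fin n → ℝ} (h : IsCurvatureLike g T) (j k l m : Fin n) :
    low4 g T j k l m = low4 g T l m j k := by
  refine pair_symm (T := low4 g T) (fun j k l m => ?_) h.skew (fun j k l m => ?_) j k l m
  · simp only [low4, ← Finset.sum_neg_distrib]
    exact Finset.sum_congr rfl fun p _ => by rw [h.antisymm j k l p]; ring
  · simp only [low4, ← Finset.sum_add_distrib, ← add_mul, h.bianchi, zero_mul,
      Finset.sum_const_zero]

lemma raise_low4 {g : Matrix (Fin n) (Fin n) ℝ} (hg : IsUnit g.det)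
    (T : Fin n → Fin n → Fin n → Fin n → ℝ) (j k l q : Fin n) :
    ∑ m, low4 g T j k l m * g⁻¹ m q = T j k l q := by
  -- The last slot is viewed as a one-row matrix, so that lowering and raising cancel by
  -- associativity.
  have h1 : (Matrix.of fun (_ : Unit) p => T j k l p) * g * g⁻¹
      = Matrix.of fun (_ : Unit) p => T j k l p := by
    rw [Matrix.mul_assoc, Matrix.mul_nonsing_inv _ hg, Matrix.mul_one]
  have h2 := congrFun (congrFun h1 ()) q
  simpa [Matrix.mul_apply, low4] using h2

lemma IsMetricOn.curvatureLike (hG : IsMetricOn G U) (hx : x ∈ U) :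
    IsCurvatureLike (G x) (fun j k l m => riemann G j k l m x) where
  antisymm j k l m := IsMetricOn.riemann_antisymm G j k l m
  bianchi := hG.riemann_bianchi hx
  skew := hG.riemann_skew hx

/-- The trace `- T_{mkl}{}^m` of a curvature-like tensor is symmetric. -/
lemma IsCurvatureLike.trace_symm {g : Matrix (Fin n) (Fin n) ℝ} (hg : IsUnit g.det)
    (hs : ∀ i j, g⁻¹ i j = g⁻¹ j i)
    {T : Fin n → Fin n → Fin n → Fin n → ℝ} (h : IsCurvatureLike g T) (k l : Fin n) :
    ∑ m, T m k l m = ∑ m, T m l k m := by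
  have e : ∀ k l, ∑ m, T m k l m = ∑ m, ∑ p, low4 g T m k l p * g⁻¹ p m := fun k l =>
    Finset.sum_congr rfl fun m _ => (raise_low4 hg T m k l m).symm
  have h12 : ∀ j k l m, low4 g T j k l m = - low4 g T k j l m := by
    intro j k l m
    simp only [low4, ← Finset.sum_neg_distrib]
    exact Finset.sum_congr rfl fun p _ => by rw [h.antisymm j k l p]; ring
  rw [e, e, Finset.sum_comm]
  refine Finset.sum_congr rfl fun p _ => Finset.sum_congr rfl fun m _ => ?_
  rw [h.pair m k l p, h12 l p m k, h.skew p l m k, hs]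
  ring

lemma IsMetricOn.ricci_symm (hG : IsMetricOn G U) (hx : x ∈ U) (k l : Fin n) :
    ricci G k l x = ricci G l k x := by
  unfold ricci
  rw [(hG.curvatureLike hx).trace_symm (hG.det x hx) (hG.inv_symm hx) k l]

end Symmetries

/-! ## Torse-forming vector fields in coordinates -/

section Torse

variable {n : ℕ} {U : Set (EuclideanSpace ℝ (Fin n))} {x : EuclideanSpace ℝ (Fin n)}
  {G : Components n}

/-- Entrywise partial derivative of a tuple of functions. -/
def pdV (i : Fin n) (v : EuclideanSpace ℝ (Fin n) → Fin n → ℝ) (x : EuclideanSpace ℝ (Fin n)) :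
    Fin n → ℝ := fun m => pd i (fun y => v y m) x

/-- Entrywise smoothness of a tuple of functions. -/
def SmoothV (v : EuclideanSpace ℝ (Fin n) → Fin n → ℝ) (U : Set (EuclideanSpace ℝ (Fin n))) :
    Prop := ∀ m, ContDiffOn ℝ ∞ (fun y => v y m) U

lemma SmoothV.diffAt {v : EuclideanSpace ℝ (Fin n) → Fin n → ℝ} (hv : SmoothV v U)
    (hU : IsOpen U) (hx : x ∈ U) (m : Fin n) : DifferentiableAt ℝ (fun y => v y m) x :=
  (hv m).differentiableAt_of_isOpen hU hx

lemma SmoothV.mulVec {A : Components n} {v : EuclideanSpace ℝ (Fin n) → Fin n → ℝ}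
    (hA : SmoothM A U) (hv : SmoothV v U) : SmoothV (fun y => A y *ᵥ v y) U := by
  intro m
  simp only [Matrix.mulVec, dotProduct]
  exact ContDiffOn.sum fun p _ => (hA m p).mul (hv p)

lemma pdV_mulVec (i : Fin n) (hU : IsOpen U) {A : Components n}
    {v : EuclideanSpace ℝ (Fin n) → Fin n → ℝ} (hA : SmoothM A U) (hv : SmoothV v U)
    (hx : x ∈ U) : pdV i (fun y => A y *ᵥ v y) x = pdM i A x *ᵥ v x + A x *ᵥ pdV i v x := by
  ext m
  simp only [pdV, pdM, Matrix.mulVec, dotProduct, Pi.add_apply, Matrix.of_apply]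
  rw [pd_sum (F := fun p y => A y m p * v y p) _ i
    fun p _ => (hA.diffAt hU hx m p).fun_mul (hv.diffAt hU hx p), ← Finset.sum_add_distrib]
  exact Finset.sum_congr rfl fun p _ => pd_mul i (hA.diffAt hU hx m p) (hv.diffAt hU hx p)

lemma pdV_congr (i : Fin n) (hU : IsOpen U) {v w : EuclideanSpace ℝ (Fin n) → Fin n → ℝ}
    (hx : x ∈ U) (h : ∀ y ∈ U, v y = w y) : pdV i v x = pdV i w x := by
  ext m
  exact pd_congr i hU hx fun y hy => by rw [h y hy]

/-- The Ricci identity for a vector field with covariant derivatives `V_k`. -/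
lemma curv_mulVec (hU : IsOpen U) {A : Fin n → Components n} (hA : ∀ i, SmoothM (A i) U)
    {w : EuclideanSpace ℝ (Fin n) → Fin n → ℝ} (hw : SmoothV w U)
    {V : Fin n → EuclideanSpace ℝ (Fin n) → Fin n → ℝ} (hV : ∀ k, SmoothV (V k) U)
    (h : ∀ k, ∀ y ∈ U, pdV k w y = V k y - A k y *ᵥ w y) (hx : x ∈ U) (j k : Fin n) :
    curv A j k x *ᵥ w x
      = (pdV k (V j) x + A k x *ᵥ V j x) - (pdV j (V k) x + A j x *ᵥ V k x) := by
  have key : ∀ j k, pdV j (pdV k w) x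
      = pdV j (V k) x - (pdM j (A k) x *ᵥ w x + A k x *ᵥ (V j x - A j x *ᵥ w x)) := by
    intro j k
    rw [← h j x hx, ← pdV_mulVec j hU (hA k) hw hx, pdV_congr j hU hx (h k)]
    ext m
    exact pd_sub j ((hV k).diffAt hU hx m) ((SmoothV.mulVec (hA k) hw).diffAt hU hx m)
  have hcomm : pdV j (pdV k w) x = pdV k (pdV j w) x := by
    ext m
    exact pd_comm j k hU (hw m) hx
  rw [key, key] at hcomm
  simp only [Matrix.mulVec_sub, Matrix.mulVec_mulVec] at hcomm
  simp only [curv, Matrix.add_mulVec, Matrix.sub_mulVec]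
  ext m
  have := congrFun hcomm m
  simp only [Pi.add_apply, Pi.sub_apply] at this ⊢
  linarith

/-- A torse-forming unit time-like vector field, with covariant components `u` and contravariant
components `w`, which is an eigenvector of the Ricci tensor. -/
structure IsTorseOn (G : Components n) (u w : EuclideanSpace ℝ (Fin n) → Fin n → ℝ)
    (f ξ : EuclideanSpace ℝ (Fin n) → ℝ) (U : Set (EuclideanSpace ℝ (Fin n))) : Prop where
  metric : IsMetricOn G U
  smooth : SmoothV u U
  smoothUp : SmoothV w U
  smooth_f : ContDiffOn ℝ ∞ f U
  lower : ∀ y ∈ U, u y = G y *ᵥ w y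
  unit : ∀ y ∈ U, ∑ l, w y l * u y l = -1
  torse : ∀ y ∈ U, ∀ k l, covDeriv G u k l y = f y * (G y k l + u y k * u y l)
  eigen : ∀ y ∈ U, ∀ j, ∑ k, ricci G j k y * w y k = ξ y * u y j

namespace IsTorseOn

variable {u w : EuclideanSpace ℝ (Fin n) → Fin n → ℝ} {f ξ : EuclideanSpace ℝ (Fin n) → ℝ}

lemma isOpen (h : IsTorseOn G u w f ξ U) : IsOpen U := h.metric.isOpen

lemma pd_lower (h : IsTorseOn G u w f ξ U) (hx : x ∈ U) (k l : Fin n) :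
    pd k (fun y => u y l) x
      = ∑ m, christoffel G m k l x * u x m + f x * (G x k l + u x k * u x l) := by
  rw [← h.torse x hx]; simp [covDeriv]

/-- The covariant derivative `∇_k u^m = φ (δ_k^m + u_k u^m)`. -/
lemma pd_upper (h : IsTorseOn G u w f ξ U) (hx : x ∈ U) (k : Fin n) :
    pdV k w x = f x • (Pi.single k 1 + u x k • w x) - gam G k x *ᵥ w x := by
  have hm := h.metric
  have h1 : pdV k u x = pdM k G x *ᵥ w x + G x *ᵥ pdV k w x := by
    rw [pdV_congr k hm.isOpen hx h.lower, pdV_mulVec k hm.isOpen hm.smooth h.smoothUp hx]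
  have h2 : pdV k u x = (gam G k x)ᵀ *ᵥ u x + f x • (G x *ᵥ (Pi.single k 1 + u x k • w x)) := by
    ext l
    rw [Matrix.mulVec_add, Matrix.mulVec_smul, ← h.lower x hx]
    simp only [pdV, h.pd_lower hx, Pi.add_apply, Pi.smul_apply, smul_eq_mul, Matrix.mulVec,
      dotProduct, Matrix.transpose_apply, gam, Matrix.of_apply, Pi.single_apply, mul_ite, mul_one,
      mul_zero, Finset.sum_ite_eq', Finset.mem_univ, if_true]
    rw [hm.symm x hx k l]
  -- The two expressions for `∂_k u` come from `u = G w` and from the torse-forming equation. Metric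
  -- compatibility removes the connection terms on `u`, and `G` is then inverted.
  have h3 : G x *ᵥ (pdV k w x + gam G k x *ᵥ w x)
      = G x *ᵥ (f x • (Pi.single k 1 + u x k • w x)) := by
    rw [h1, hm.compat hx, Matrix.add_mulVec, ← Matrix.mulVec_mulVec, ← Matrix.mulVec_mulVec,
      ← h.lower x hx, add_assoc, add_right_inj] at h2
    rw [Matrix.mulVec_add, add_comm, h2, Matrix.mulVec_smul]
  have h4 := congrArg (fun v => (G x)⁻¹ *ᵥ v) h3
  simp only [Matrix.mulVec_mulVec, hm.inv_mul hx, Matrix.one_mulVec] at h4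
  rw [← h4]; abel

/-- Closedness of the one-form `u`: `∇_k u_l` is symmetric and the connection has no torsion. -/
lemma lower_closed (h : IsTorseOn G u w f ξ U) (hx : x ∈ U) (j k : Fin n) :
    pd j (fun y => u y k) x = pd k (fun y => u y j) x := by
  rw [h.pd_lower hx, h.pd_lower hx, h.metric.symm x hx j k]
  simp only [h.metric.christoffel_symm hx _ j k]
  ring

/-- `R_{jkl}{}^m u^l` in terms of the derivatives of `φ`. -/
lemma riemann_up_aux (h : IsTorseOn G u w f ξ U) (hx : x ∈ U) (j k m : Fin n) :
    ∑ l, riemann G j k l m x * w x l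
      = (pd k f x - f x ^ 2 * u x k) * delta j m - (pd j f x - f x ^ 2 * u x j) * delta k m
        + (pd k f x * u x j - pd j f x * u x k) * w x m := by
  have hm := h.metric
  have hU := h.isOpen
  have hVs : ∀ k, SmoothV (fun y => f y • (Pi.single k 1 + u y k • w y)) U := fun k m =>
    h.smooth_f.mul (contDiffOn_const.add ((h.smooth k).mul (h.smoothUp m)))
  have key := curv_mulVec hU hm.smoothGam h.smoothUp
    (V := fun k y => f y • (Pi.single k 1 + u y k • w y)) hVs
    (fun k y hy => h.pd_upper hy k) hx j k
  have hpd : ∀ j k, pdV k (fun y => f y • (Pi.single j 1 + u y j • w y)) x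
      = pd k f x • (Pi.single j 1 + u x j • w x)
        + f x • (pd k (fun y => u y j) x • w x + u x j • pdV k w x) := by
    intro j k
    ext m
    have hf := h.smooth_f.differentiableAt_of_isOpen hU hx
    have hu := h.smooth.diffAt hU hx j
    have hw := h.smoothUp.diffAt hU hx m
    have e1 : pd k (fun y => f y * (Pi.single (M := fun _ => ℝ) j 1 m + u y j * w y m)) x = _ :=
      pd_mul (h := fun y => Pi.single (M := fun _ => ℝ) j 1 m + u y j * w y m) k hf
        ((differentiableAt_const _).fun_add (hu.fun_mul hw))
    rw [pd_add (f := fun _ => Pi.single (M := fun _ => ℝ) j 1 m) k (differentiableAt_const _)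
      (hu.fun_mul hw), pd_const, pd_mul k hu hw] at e1
    simp only [pdV, Pi.add_apply, Pi.smul_apply, smul_eq_mul]
    rw [e1]
    ring
  have hG : ∀ j k, gam G k x *ᵥ Pi.single j 1 = gam G j x *ᵥ Pi.single k 1 := by
    intro j k
    ext m
    simp [gam, hm.christoffel_symm hx m k j]
  have hl : (curv (gam G) j k x *ᵥ w x) m = ∑ l, riemann G j k l m x * w x l := by
    simp [Matrix.mulVec, dotProduct, curv_gam_apply]
  rw [← hl, key, hpd, hpd, h.pd_upper hx, h.pd_upper hx]
  simp only [Matrix.mulVec_smul, Matrix.mulVec_add, hG j k, h.lower_closed hx j k]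
  simp only [Pi.add_apply, Pi.sub_apply, Pi.smul_apply, smul_eq_mul, Pi.single_apply, delta,
    eq_comm (a := m)]
  ring

lemma sum_delta_mul (F : Fin n → ℝ) (k : Fin n) : ∑ m, delta k m * F m = F k := by
  simp [delta]

lemma sum_mul_delta (F : Fin n → ℝ) (k : Fin n) : ∑ m, F m * delta m k = F k := by
  simp [delta]

lemma sum_mul_delta' (F : Fin n → ℝ) (k : Fin n) : ∑ m, F m * delta k m = F k := by
  simp [delta]

lemma sum_delta_self : ∑ m : Fin n, delta m m = n := by
  simp [delta]

/-- The eigenvalue `ξ = (n-1) (φ̇ + φ²)` of the Ricci tensor, and `∇_k φ = - u_k φ̇`. -/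
lemma eigenvalue (hn : 3 ≤ n) (h : IsTorseOn G u w f ξ U) (hx : x ∈ U) :
    ξ x = (n - 1) * (∑ m, w x m * pd m f x + f x ^ 2)
      ∧ ∀ k, pd k f x = -(∑ m, w x m * pd m f x) * u x k := by
  have hn' : (3 : ℝ) ≤ n := by exact_mod_cast hn
  set d := ∑ m, w x m * pd m f x with hd
  have hu := h.unit x hx
  -- The trace of `riemann_up_aux`. Contracting it with `u^k` determines `ξ`; substituting back
  -- leaves `(n - 2)(∂_k φ + φ̇ u_k) = 0`.
  have h1 : ∀ k, (2 - n) * (pd k f x - f x ^ 2 * u x k) + (d + f x ^ 2) * u x k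
      = ξ x * u x k := by
    intro k
    have e1 : ∑ l, ricci G k l x * w x l = - ∑ m, ∑ l, riemann G m k l m x * w x l := by
      simp only [ricci, neg_mul, Finset.sum_mul, Finset.sum_neg_distrib]
      rw [Finset.sum_comm]
    rw [← h.eigen x hx k, e1]
    simp only [h.riemann_up_aux hx]
    have e2 : ∀ m, (pd k f x - f x ^ 2 * u x k) * delta m m
        - (pd m f x - f x ^ 2 * u x m) * delta k m
        + (pd k f x * u x m - pd m f x * u x k) * w x m
        = (pd k f x - f x ^ 2 * u x k) * delta m m
        - (pd m f x - f x ^ 2 * u x m) * delta k m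
        + pd k f x * (w x m * u x m) - u x k * (w x m * pd m f x) := fun m => by ring
    simp only [e2, Finset.sum_add_distrib, Finset.sum_sub_distrib, ← Finset.mul_sum,
      sum_delta_self, hu, sum_mul_delta' (fun m => pd m f x - f x ^ 2 * u x m), ← hd]
    ring
  have h2 : ξ x = (n - 1) * (d + f x ^ 2) := by
    have e1 : ∑ k, w x k * ((2 - n) * (pd k f x - f x ^ 2 * u x k) + (d + f x ^ 2) * u x k)
        = ∑ k, w x k * (ξ x * u x k) := Finset.sum_congr rfl fun k _ => by rw [h1]
    have e2 : ∀ k, w x k * ((2 - n) * (pd k f x - f x ^ 2 * u x k) + (d + f x ^ 2) * u x k)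
        = (2 - n) * (w x k * pd k f x)
          + (-(2 - n) * f x ^ 2 + d + f x ^ 2) * (w x k * u x k) := fun k => by ring
    have e3 : ∀ k, w x k * (ξ x * u x k) = ξ x * (w x k * u x k) := fun k => by ring
    simp only [e2, e3, Finset.sum_add_distrib, ← Finset.mul_sum, hu, ← hd] at e1
    linarith
  refine ⟨h2, fun k => ?_⟩
  have h3 := h1 k
  rw [h2] at h3
  have h4 : ((n : ℝ) - 2) * (pd k f x + d * u x k) = 0 := by linear_combination -h3
  have h5 : (n : ℝ) - 2 ≠ 0 := by linarith
  have h6 := (mul_eq_zero.1 h4).resolve_left h5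
  linarith

/-- `R_{jkl}{}^m u^l = (ξ / (n - 1)) (u_j δ_k^m - u_k δ_j^m)`. -/
lemma riemann_up_third (hn : 3 ≤ n) (h : IsTorseOn G u w f ξ U) (hx : x ∈ U) (j k m : Fin n) :
    ∑ l, riemann G j k l m x * w x l
      = ξ x / (n - 1) * (u x j * delta k m - u x k * delta j m) := by
  have hn' : (3 : ℝ) ≤ n := by exact_mod_cast hn
  obtain ⟨h1, h2⟩ := h.eigenvalue hn hx
  have h3 : ξ x / (n - 1) = ∑ m, w x m * pd m f x + f x ^ 2 := by
    rw [h1, mul_div_cancel_left₀]; linarith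
  rw [h.riemann_up_aux hx, h2 j, h2 k, h3]
  ring

lemma sum_upper_mul_metric (h : IsTorseOn G u w f ξ U) (hx : x ∈ U) (m : Fin n) :
    ∑ p, w x p * G x p m = u x m := by
  rw [h.lower x hx]
  simp only [Matrix.mulVec, dotProduct]
  exact Finset.sum_congr rfl fun p _ => by rw [h.metric.symm x hx p m]; ring

lemma low4_up_third (hn : 3 ≤ n) (h : IsTorseOn G u w f ξ U) (hx : x ∈ U) (j k m : Fin n) :
    ∑ l, low4 (G x) (fun j k l m => riemann G j k l m x) j k l m * w x l
      = ξ x / (n - 1) * (u x j * G x k m - u x k * G x j m) := by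
  simp only [low4, Finset.sum_mul]
  rw [Finset.sum_comm]
  have e1 : ∀ p, ∑ l, riemann G j k l p x * G x p m * w x l
      = ξ x / (n - 1) * (u x j * (delta k p * G x p m) - u x k * (delta j p * G x p m)) := by
    intro p
    have := h.riemann_up_third hn hx j k p
    calc _ = (∑ l, riemann G j k l p x * w x l) * G x p m := by
          rw [Finset.sum_mul]; exact Finset.sum_congr rfl fun _ _ => by ring
      _ = _ := by rw [this]; ring
  simp only [e1, ← Finset.mul_sum, Finset.sum_sub_distrib,
    sum_delta_mul (fun p => G x p m)]

/-- `R_{jkl}{}^m u_m = - (ξ / (n - 1)) (u_j g_{kl} - u_k g_{jl})`. -/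
lemma riemann_lower_fourth (hn : 3 ≤ n) (h : IsTorseOn G u w f ξ U) (hx : x ∈ U)
    (j k l : Fin n) :
    ∑ m, riemann G j k l m x * u x m
      = - (ξ x / (n - 1)) * (u x j * G x k l - u x k * G x j l) := by
  have e1 : ∑ m, riemann G j k l m x * u x m
      = ∑ m, low4 (G x) (fun j k l m => riemann G j k l m x) j k l m * w x m := by
    simp only [low4, Finset.sum_mul, h.lower x hx, Matrix.mulVec, dotProduct, Finset.mul_sum]
    rw [Finset.sum_comm]
    exact Finset.sum_congr rfl fun m _ => Finset.sum_congr rfl fun p _ => by ring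
  rw [e1]
  have hs := (h.metric.curvatureLike hx).skew
  simp only [hs j k l, neg_mul, Finset.sum_neg_distrib]
  rw [h.low4_up_third hn hx]

/-- `u^j R_{jkl}{}^m = (ξ / (n - 1)) (u_l δ_k^m - u^m g_{kl})`. -/
lemma riemann_up_first (hn : 3 ≤ n) (h : IsTorseOn G u w f ξ U) (hx : x ∈ U)
    (k l m : Fin n) :
    ∑ j, riemann G j k l m x * w x j
      = ξ x / (n - 1) * (u x l * delta k m - w x m * G x k l) := by
  have hm := h.metric
  -- Pair symmetry carries the contracted index from the first slot to the third, where the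
  -- contraction is known.
  have e1 : ∀ j, riemann G j k l m x
      = ∑ q, low4 (G x) (fun j k l m => riemann G j k l m x) l q j k * (G x)⁻¹ q m := by
    intro j
    rw [← raise_low4 (hm.det x hx) (fun j k l m => riemann G j k l m x) j k l m]
    exact Finset.sum_congr rfl fun q _ => by rw [(hm.curvatureLike hx).pair]
  simp only [e1, Finset.sum_mul]
  rw [Finset.sum_comm]
  have e2 : ∀ q, ∑ j, low4 (G x) (fun j k l m => riemann G j k l m x) l q j k
        * (G x)⁻¹ q m * w x j
      = ξ x / (n - 1) * (u x l * (G x k q * (G x)⁻¹ q m) - G x k l * ((G x)⁻¹ m q * u x q)) := by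
    intro q
    calc _ = (∑ j, low4 (G x) (fun j k l m => riemann G j k l m x) l q j k * w x j)
          * (G x)⁻¹ q m := by
          rw [Finset.sum_mul]; exact Finset.sum_congr rfl fun _ _ => by ring
      _ = _ := by
        rw [h.low4_up_third hn hx, hm.symm x hx q k, hm.symm x hx l k, hm.inv_symm hx q m]; ring
  have e3 : ∑ q, G x k q * (G x)⁻¹ q m = delta k m := by
    rw [← Matrix.mul_apply, hm.mul_inv hx]; rfl
  have e4 : ∑ q, (G x)⁻¹ m q * u x q = w x m := by
    have : ((G x)⁻¹ *ᵥ u x) m = w x m := by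
      rw [h.lower x hx, Matrix.mulVec_mulVec, hm.inv_mul hx, Matrix.one_mulVec]
    exact this
  simp only [e2, ← Finset.mul_sum, Finset.sum_sub_distrib, e3, e4]
  ring

end IsTorseOn

end Torse

/-! ## The Weyl tensor -/

section Weyl

variable {n : ℕ} {U : Set (EuclideanSpace ℝ (Fin n))} {x : EuclideanSpace ℝ (Fin n)}
  {G : Components n}

open IsTorseOn (sum_delta_mul sum_mul_delta sum_mul_delta' sum_delta_self)

lemma IsMetricOn.sum_inv_mul (hG : IsMetricOn G U) (hx : x ∈ U) (j m : Fin n) :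
    ∑ p, (G x)⁻¹ j p * G x p m = delta j m := by
  rw [← Matrix.mul_apply, hG.inv_mul hx]; rfl

lemma IsMetricOn.sum_mul_inv (hG : IsMetricOn G U) (hx : x ∈ U) (j m : Fin n) :
    ∑ p, G x j p * (G x)⁻¹ p m = delta j m := by
  rw [← Matrix.mul_apply, hG.mul_inv hx]; rfl

lemma IsMetricOn.lower_raise (hG : IsMetricOn G U) (hx : x ∈ U) (T : Fin n → Fin n → ℝ)
    (j m : Fin n) : ∑ p, (∑ q, T j q * (G x)⁻¹ q p) * G x p m = T j m := by
  simp only [Finset.sum_mul]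
  rw [Finset.sum_comm]
  simp only [mul_assoc, ← Finset.mul_sum, hG.sum_inv_mul hx, sum_mul_delta]

/-- The Kulkarni-Nomizu type tensor `δ_j^m T_{kl} - δ_k^m T_{jl} + T_j^m g_{kl} - T_k^m g_{jl}`. -/
def kulkarni (g : Matrix (Fin n) (Fin n) ℝ) (T : Fin n → Fin n → ℝ) (j k l m : Fin n) : ℝ :=
  delta j m * T k l - delta k m * T j l + (∑ p, T j p * g⁻¹ p m) * g k l
    - (∑ p, T k p * g⁻¹ p m) * g j l

lemma weyl_eq (G : Components n) (j k l m : Fin n) :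
    weyl G j k l m x = riemann G j k l m x
      + kulkarni (G x) (fun k l => ricci G k l x) j k l m / ((n : ℝ) - 2)
      - scalarCurv G x * (delta j m * G x k l - delta k m * G x j l)
        / (((n : ℝ) - 1) * ((n : ℝ) - 2)) := rfl

lemma IsMetricOn.trace_kulkarni (hG : IsMetricOn G U) (hx : x ∈ U) (T : Fin n → Fin n → ℝ)
    (k l : Fin n) :
    ∑ m, kulkarni (G x) T m k l m
      = (n - 2) * T k l + (∑ m, ∑ p, T m p * (G x)⁻¹ p m) * G x k l := by
  simp only [kulkarni, Finset.sum_sub_distrib, Finset.sum_add_distrib]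
  rw [hG.lower_raise hx, ← Finset.sum_mul, ← Finset.sum_mul, sum_delta_self,
    sum_delta_mul (fun m => T m l)]
  ring

lemma IsMetricOn.low4_kulkarni (hG : IsMetricOn G U) (hx : x ∈ U) (T : Fin n → Fin n → ℝ)
    (j k l m : Fin n) :
    low4 (G x) (kulkarni (G x) T) j k l m
      = G x j m * T k l - G x k m * T j l + T j m * G x k l - T k m * G x j l := by
  have e : ∀ p, kulkarni (G x) T j k l p * G x p m
      = delta j p * G x p m * T k l - delta k p * G x p m * T j l
        + (∑ q, T j q * (G x)⁻¹ q p) * G x p m * G x k l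
        - (∑ q, T k q * (G x)⁻¹ q p) * G x p m * G x j l := fun p => by
    simp only [kulkarni]; ring
  simp only [low4, e, Finset.sum_add_distrib, Finset.sum_sub_distrib]
  simp only [← Finset.sum_mul, hG.lower_raise hx, sum_delta_mul (fun p => G x p m)]

lemma IsMetricOn.low4_weyl (hG : IsMetricOn G U) (hx : x ∈ U) (j k l m : Fin n) :
    low4 (G x) (fun j k l m => weyl G j k l m x) j k l m
      = low4 (G x) (fun j k l m => riemann G j k l m x) j k l m
        + (G x j m * ricci G k l x - G x k m * ricci G j l x + ricci G j m x * G x k l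
            - ricci G k m x * G x j l) / ((n : ℝ) - 2)
        - scalarCurv G x * (G x j m * G x k l - G x k m * G x j l)
          / (((n : ℝ) - 1) * ((n : ℝ) - 2)) := by
  rw [← hG.low4_kulkarni hx (fun k l => ricci G k l x) j k l m]
  have e : ∀ p, weyl G j k l p x * G x p m = riemann G j k l p x * G x p m
      + kulkarni (G x) (fun k l => ricci G k l x) j k l p * G x p m / ((n : ℝ) - 2)
      - (delta j p * G x p m * G x k l - delta k p * G x p m * G x j l) *
        (scalarCurv G x / (((n : ℝ) - 1) * ((n : ℝ) - 2))) := fun p => by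
    rw [weyl_eq]; ring
  simp only [low4, e, Finset.sum_add_distrib, Finset.sum_sub_distrib]
  simp only [← Finset.sum_mul, ← Finset.sum_div, Finset.sum_sub_distrib,
    sum_delta_mul (fun p => G x p m)]
  ring

/-- The corrections to the Riemann tensor are Kulkarni-Nomizu products of symmetric tensors, hence
have its symmetries. The pair symmetry and cyclic identity are needed in `weylDiv_conf`. -/
lemma IsMetricOn.weyl_curvatureLike (hG : IsMetricOn G U) (hx : x ∈ U) :
    IsCurvatureLike (G x) (fun j k l m => weyl G j k l m x) where
  antisymm j k l m := by
    simp only [weyl_eq, kulkarni, IsMetricOn.riemann_antisymm G j k l m]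
    ring
  bianchi j k l m := by
    have h1 := hG.riemann_bianchi hx j k l m
    simp only [weyl_eq, kulkarni]
    rw [hG.symm x hx l j, hG.symm x hx k j, hG.symm x hx l k, hG.ricci_symm hx l j,
      hG.ricci_symm hx k j, hG.ricci_symm hx l k]
    linear_combination h1
  skew j k l m := by
    have h1 := hG.riemann_skew hx j k l m
    rw [hG.low4_weyl hx, hG.low4_weyl hx]
    simp only [low4]
    rw [h1]
    ring

/-- The Weyl tensor is trace-free. -/
lemma IsMetricOn.weyl_trace (hn : 3 ≤ n) (hG : IsMetricOn G U) (hx : x ∈ U) (k l : Fin n) :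
    ∑ m, weyl G m k l m x = 0 := by
  have hn' : (3 : ℝ) ≤ n := by exact_mod_cast hn
  have h2 : (n : ℝ) - 2 ≠ 0 := by linarith
  have h1 : (n : ℝ) - 1 ≠ 0 := by linarith
  have hs : ∑ m, ∑ p, ricci G m p x * (G x)⁻¹ p m = scalarCurv G x := by
    simp only [scalarCurv]
    exact Finset.sum_congr rfl fun m _ => Finset.sum_congr rfl fun p _ => by
      rw [hG.inv_symm hx p m]; ring
  have e : ∀ m, weyl G m k l m x = riemann G m k l m x
      + kulkarni (G x) (fun k l => ricci G k l x) m k l m / ((n : ℝ) - 2)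
      - (delta m m * G x k l - delta k m * G x m l) *
        (scalarCurv G x / (((n : ℝ) - 1) * ((n : ℝ) - 2))) := fun m => by
    rw [weyl_eq]; ring
  have hr : ∑ m, riemann G m k l m x = - ricci G k l x := by simp [ricci]
  simp only [e, Finset.sum_add_distrib, Finset.sum_sub_distrib]
  simp only [← Finset.sum_mul, ← Finset.sum_div, hG.trace_kulkarni hx, hr, hs,
    Finset.sum_sub_distrib, sum_delta_self, sum_delta_mul (fun p => G x p l)]
  field_simp
  ring

/-- The Weyl tensor of a metric `c g` whose Riemann tensor differs from the one of `g` by a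
Kulkarni-Nomizu product. -/
lemma IsMetricOn.weyl_conformal (hn : 3 ≤ n) (hG : IsMetricOn G U) (hx : x ∈ U)
    {G' : Components n} {c : ℝ} (hc : c ≠ 0) (hG' : G' x = c • G x)
    {T : Fin n → Fin n → ℝ}
    (h : ∀ j k l m, riemann G' j k l m x = riemann G j k l m x - kulkarni (G x) T j k l m) :
    (∀ k l, ricci G' k l x = ricci G k l x + (n - 2) * T k l
      + (∑ m, ∑ p, T m p * (G x)⁻¹ p m) * G x k l)
    ∧ ∀ j k l m, weyl G' j k l m x = weyl G j k l m x := by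
  have hn' : (3 : ℝ) ≤ n := by exact_mod_cast hn
  have h2 : (n : ℝ) - 2 ≠ 0 := by linarith
  have h1 : (n : ℝ) - 1 ≠ 0 := by linarith
  set t := ∑ m, ∑ p, T m p * (G x)⁻¹ p m with ht
  have hric : ∀ k l, ricci G' k l x = ricci G k l x + (n - 2) * T k l + t * G x k l := by
    intro k l
    simp only [ricci, h, Finset.sum_sub_distrib]
    rw [hG.trace_kulkarni hx]
    ring
  refine ⟨hric, fun j k l m => ?_⟩
  have hinv : (G' x)⁻¹ = c⁻¹ • (G x)⁻¹ := by
    rw [hG']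
    have : IsUnit c := isUnit_iff_ne_zero.2 hc
    refine Matrix.inv_eq_left_inv ?_
    rw [smul_mul_smul_comm, inv_mul_cancel₀ hc, hG.inv_mul hx, one_smul]
  have hup : ∀ j m, ricciUp G' j m x = c⁻¹ * (ricciUp G j m x
      + (n - 2) * (∑ p, T j p * (G x)⁻¹ p m) + t * delta j m) := by
    intro j m
    simp only [ricciUp, hinv, Matrix.smul_apply, smul_eq_mul, hric]
    rw [← hG.sum_mul_inv hx j m]
    simp only [Finset.mul_sum, ← Finset.sum_add_distrib]
    exact Finset.sum_congr rfl fun p _ => by ring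
  have hsc : scalarCurv G' x = c⁻¹ * (scalarCurv G x + 2 * (n - 1) * t) := by
    have e1 : ∀ k l, (G' x)⁻¹ k l * ricci G' k l x = c⁻¹ * ((G x)⁻¹ k l * ricci G k l x
        + (n - 2) * (T k l * (G x)⁻¹ l k) + t * (G x k l * (G x)⁻¹ l k)) := by
      intro k l
      rw [hinv, hric, hG.inv_symm hx l k, Matrix.smul_apply, smul_eq_mul]; ring
    simp only [scalarCurv, e1, ← Finset.mul_sum, Finset.sum_add_distrib, hG.sum_mul_inv hx,
      sum_delta_self, ← ht]
    ring
  -- Each `c⁻¹` from raising an index meets the `c` of a metric factor, and the Ricci and scalar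
  -- corrections cancel the Kulkarni-Nomizu product.
  simp only [weyl, hup, hsc, hric, h, hG', Matrix.smul_apply, smul_eq_mul, kulkarni]
  field_simp
  ring

end Weyl

/-! ## Conformal change in the direction of the torse-forming field -/

section Conformal

variable {n : ℕ} {U : Set (EuclideanSpace ℝ (Fin n))} {x : EuclideanSpace ℝ (Fin n)}
  {G : Components n} {u w : EuclideanSpace ℝ (Fin n) → Fin n → ℝ}
  {f ξ σ s : EuclideanSpace ℝ (Fin n) → ℝ}

open IsTorseOn (sum_delta_mul sum_mul_delta sum_mul_delta' sum_delta_self)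

/-- The conformally rescaled metric `e^{2σ} g`, in components. -/
def confMetric (σ : EuclideanSpace ℝ (Fin n) → ℝ) (G : Components n) : Components n :=
  fun y => Real.exp (2 * σ y) • G y

/-- The difference of the Levi-Civita connections of `e^{2σ} g` and `g`, for `∇_i σ = s u_i`. -/
def confDiff (G : Components n) (u w : EuclideanSpace ℝ (Fin n) → Fin n → ℝ)
    (s : EuclideanSpace ℝ (Fin n) → ℝ) (i : Fin n) : Components n :=
  fun y => Matrix.of fun m l =>
    s y * (delta i m * u y l + delta l m * u y i - G y i l * w y m)

/-- The correction is the exterior covariant derivative of `D` plus `D ∧ D`. The derivative acts on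
matrix indices only: Christoffel terms on the form index are symmetric and would cancel. -/
lemma curv_add (hU : IsOpen U) {A D : Fin n → Components n} (hA : ∀ i, SmoothM (A i) U)
    (hD : ∀ i, SmoothM (D i) U) (hx : x ∈ U) (j k : Fin n) :
    curv (fun i y => A i y + D i y) j k x = curv A j k x
      + ((pdM k (D j) x + A k x * D j x - D j x * A k x)
        - (pdM j (D k) x + A j x * D k x - D k x * A j x))
      + (D k x * D j x - D j x * D k x) := by
  unfold curv
  rw [pdM_add k hU (hA j) (hD j) hx, pdM_add j hU (hA k) (hD k) hx]
  noncomm_ring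

lemma curv_congr (hU : IsOpen U) {A B : Fin n → Components n} (hAB : ∀ i, ∀ y ∈ U, A i y = B i y)
    (hx : x ∈ U) (j k : Fin n) : curv A j k x = curv B j k x := by
  unfold curv
  rw [pdM_congr k hU hx (hAB j), pdM_congr j hU hx (hAB k), hAB j x hx, hAB k x hx]

lemma IsMetricOn.conf (hG : IsMetricOn G U) (hσ : ContDiffOn ℝ ∞ σ U) :
    IsMetricOn (confMetric σ G) U where
  isOpen := hG.isOpen
  smooth := SmoothM.smul (Real.contDiff_exp.comp_contDiffOn (contDiffOn_const.mul hσ)) hG.smooth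
  symm y hy i j := by simp [confMetric, hG.symm y hy i j]
  det y hy := by
    rw [confMetric, Matrix.det_smul]
    exact (isUnit_iff_ne_zero.2 (pow_ne_zero _ (Real.exp_pos _).ne')).mul (hG.det y hy)

namespace IsTorseOn

lemma smoothM_confDiff (h : IsTorseOn G u w f ξ U) (hs : ContDiffOn ℝ ∞ s U) (i : Fin n) :
    SmoothM (confDiff G u w s i) U := fun m l =>
  hs.mul (((contDiffOn_const.mul (h.smooth l)).add (contDiffOn_const.mul (h.smooth i))).sub
    ((h.metric.smooth i l).mul (h.smoothUp m)))

/-- Uniqueness of the Levi-Civita connection again: the sum is torsion-free and compatible with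
`e^{2σ} g`. -/
lemma gam_conf (h : IsTorseOn G u w f ξ U) (hσ : ContDiffOn ℝ ∞ σ U)
    (hgrad : ∀ y ∈ U, ∀ k, pd k σ y = s y * u y k) (hx : x ∈ U) (i : Fin n) :
    gam (confMetric σ G) i x = gam G i x + confDiff G u w s i x := by
  have hm := h.metric
  refine (hm.conf hσ).gam_unique hx (fun i => gam G i x + confDiff G u w s i x) ?_ ?_ i
  · intro m i l
    simp only [Matrix.add_apply, gam, confDiff, Matrix.of_apply]
    rw [hm.christoffel_symm hx m i l, hm.symm x hx i l]
    ring
  · intro i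
    have hd := hσ.differentiableAt_of_isOpen hm.isOpen hx
    have h1 : pdM i (confMetric σ G) x
        = (2 * (s x * u x i)) • confMetric σ G x + Real.exp (2 * σ x) • pdM i G x := by
      unfold confMetric
      have he : ContDiffOn ℝ ∞ (fun y => Real.exp (2 * σ y)) U :=
        Real.contDiff_exp.comp_contDiffOn (contDiffOn_const.mul hσ)
      rw [pdM_smul i hm.isOpen he hm.smooth hx]
      rw [pd_exp i ((differentiableAt_const _).fun_mul hd), pd_const_mul i 2 hd, hgrad x hx,
        smul_smul]
      congr 2
      ring
    have h2 : ∀ a b, (G x * confDiff G u w s i x) a b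
        = s x * (G x a i * u x b + G x a b * u x i - G x i b * u x a) := by
      intro a b
      have e : ∀ m, G x a m * (s x * (delta i m * u x b + delta b m * u x i - G x i b * w x m))
          = s x * (G x a m * delta i m * u x b + G x a m * delta b m * u x i
            - G x i b * (w x m * G x m a)) := fun m => by rw [hm.symm x hx a m]; ring
      simp only [Matrix.mul_apply, confDiff, Matrix.of_apply, e, ← Finset.mul_sum,
        Finset.sum_sub_distrib, Finset.sum_add_distrib, ← Finset.sum_mul,
        sum_mul_delta' (fun m => G x a m), h.sum_upper_mul_metric hx]
    -- The symmetrised difference tensor must account exactly for the logarithmic derivative `2 ∂_i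
    -- σ = 2 s u_i` of the conformal factor.
    have h3 : (confDiff G u w s i x)ᵀ * G x + G x * confDiff G u w s i x
        = (2 * (s x * u x i)) • G x := by
      have : (confDiff G u w s i x)ᵀ * G x = (G x * confDiff G u w s i x)ᵀ := by
        rw [Matrix.transpose_mul, hm.transpose hx]
      rw [this]
      ext a b
      rw [Matrix.add_apply, Matrix.transpose_apply, h2, h2, Matrix.smul_apply, smul_eq_mul,
        hm.symm x hx b i, hm.symm x hx a i, hm.symm x hx b a]
      ring
    rw [h1, hm.compat hx]
    simp only [confMetric, Matrix.transpose_add, add_mul, mul_add, mul_smul_comm,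
      smul_mul_assoc]
    rw [smul_comm, ← h3]
    simp only [smul_add]
    abel

/-- `∇_k s = - u_k ṡ` if `s u_k` is a gradient. -/
lemma pd_gradient_factor (h : IsTorseOn G u w f ξ U) (hσ : ContDiffOn ℝ ∞ σ U)
    (hs : ContDiffOn ℝ ∞ s U)
    (hgrad : ∀ y ∈ U, ∀ k, pd k σ y = s y * u y k) (hx : x ∈ U) (k : Fin n) :
    pd k s x = -(∑ m, w x m * pd m s x) * u x k := by
  have hU := h.isOpen
  have hsd := hs.differentiableAt_of_isOpen hU hx
  -- Both `s u = dσ` and `u` are closed, so `ds ∧ u = 0`; contraction with `u` then makes `ds` a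
  -- multiple of `u`.
  have h1 : ∀ j k, pd j s x * u x k = pd k s x * u x j := by
    intro j k
    have h2 := pd_comm j k hU hσ hx
    rw [pd_congr j hU hx (fun y hy => hgrad y hy k), pd_congr k hU hx (fun y hy => hgrad y hy j),
      pd_mul j hsd (h.smooth.diffAt hU hx k), pd_mul k hsd (h.smooth.diffAt hU hx j),
      h.lower_closed hx j k] at h2
    linarith
  have h2 : ∑ j, w x j * (pd j s x * u x k) = ∑ j, w x j * (pd k s x * u x j) :=
    Finset.sum_congr rfl fun j _ => by rw [h1]
  have e1 : ∀ j, w x j * (pd j s x * u x k) = w x j * pd j s x * u x k := fun j => by ring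
  have e2 : ∀ j, w x j * (pd k s x * u x j) = pd k s x * (w x j * u x j) := fun j => by ring
  simp only [e1, e2, ← Finset.mul_sum, ← Finset.sum_mul, h.unit x hx] at h2
  linarith

/-- The coefficient tensor of the conformal change of the curvature. -/
def confTensor (G : Components n) (u : EuclideanSpace ℝ (Fin n) → Fin n → ℝ)
    (x : EuclideanSpace ℝ (Fin n)) (α β : ℝ) (k l : Fin n) : ℝ := α * G x k l + β * (u x k * u x l)

lemma confTensor_up (h : IsTorseOn G u w f ξ U) (hx : x ∈ U) (α β : ℝ) (j m : Fin n) :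
    ∑ p, confTensor G u x α β j p * (G x)⁻¹ p m = α * delta j m + β * (u x j * w x m) := by
  have hm := h.metric
  have e : ∀ p, confTensor G u x α β j p * (G x)⁻¹ p m
      = α * (G x j p * (G x)⁻¹ p m) + β * (u x j * ((G x)⁻¹ m p * u x p)) := fun p => by
    rw [confTensor, hm.inv_symm hx p m]; ring
  have e4 : ∑ q, (G x)⁻¹ m q * u x q = w x m := by
    have : ((G x)⁻¹ *ᵥ u x) m = w x m := by
      rw [h.lower x hx, Matrix.mulVec_mulVec, hm.inv_mul hx, Matrix.one_mulVec]
    exact this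
  simp only [e, Finset.sum_add_distrib, ← Finset.mul_sum, hm.sum_mul_inv hx, e4]

/-- The covariant derivative of `confDiff`, up to a part symmetric in the form indices. -/
lemma cov_confDiff (h : IsTorseOn G u w f ξ U) (hs : ContDiffOn ℝ ∞ s U) (hx : x ∈ U)
    (j k m l : Fin n) :
    (pdM k (confDiff G u w s j) x + gam G k x * confDiff G u w s j x
      - confDiff G u w s j x * gam G k x) m l
    = pd k s x * (delta j m * u x l + delta l m * u x j - G x j l * w x m)
      + s x * f x * (delta j m * (G x k l + u x k * u x l)
        - G x j l * (delta k m + u x k * w x m))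
      + s x * (delta l m * (∑ p, christoffel G p k j x * u x p + f x * (G x k j + u x k * u x j))
        - (∑ p, christoffel G p k j x * G x p l) * w x m + christoffel G m k j x * u x l) := by
  have hU := h.isOpen
  have hm := h.metric
  have hsd := hs.differentiableAt_of_isOpen hU hx
  have hud := fun l => h.smooth.diffAt hU hx l
  have hwd := fun l => h.smoothUp.diffAt hU hx l
  have hgd := fun a b => hm.smooth.diffAt hU hx a b
  have hcl : ∀ (c : ℝ) (l : Fin n), DifferentiableAt ℝ (fun y => c * u y l) x := fun c l =>
    (hud l).const_mul c
  have e1 : pdM k (confDiff G u w s j) x m l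
      = pd k s x * (delta j m * u x l + delta l m * u x j - G x j l * w x m)
        + s x * (delta j m * pd k (fun y => u y l) x + delta l m * pd k (fun y => u y j) x
          - (pd k (fun y => G y j l) x * w x m + G x j l * pd k (fun y => w y m) x)) := by
    change pd k (fun y => s y * (delta j m * u y l + delta l m * u y j - G y j l * w y m)) x = _
    rw [pd_mul (h := fun y => delta j m * u y l + delta l m * u y j - G y j l * w y m) k hsd
      (((hcl _ l).fun_add (hcl _ j)).fun_sub ((hgd j l).fun_mul (hwd m))),
      pd_sub (f := fun y => delta j m * u y l + delta l m * u y j) k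
        ((hcl _ l).fun_add (hcl _ j)) ((hgd j l).fun_mul (hwd m)),
      pd_add k (hcl _ l) (hcl _ j), pd_const_mul k _ (hud l), pd_const_mul k _ (hud j),
      pd_mul k (hgd j l) (hwd m)]
  have e2 : pd k (fun y => G y j l) x = ∑ p, christoffel G p k j x * G x p l
      + ∑ p, G x j p * christoffel G p k l x := by
    have := congrFun (congrFun (hm.compat hx k) j) l
    simpa [pdM, Matrix.mul_apply, gam] using this
  have e3 : pd k (fun y => w y m) x
      = f x * (delta k m + u x k * w x m) - ∑ p, christoffel G m k p x * w x p := by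
    have := congrFun (h.pd_upper hx k) m
    simpa [pdV, Matrix.mulVec, dotProduct, gam, delta, Pi.single_apply, eq_comm, mul_add] using this
  have e4 : (gam G k x * confDiff G u w s j x) m l
      = s x * (christoffel G m k j x * u x l + christoffel G m k l x * u x j
        - G x j l * ∑ p, christoffel G m k p x * w x p) := by
    have e : ∀ p, christoffel G m k p x
          * (s x * (delta j p * u x l + delta l p * u x j - G x j l * w x p))
        = s x * (christoffel G m k p x * delta j p * u x l
          + christoffel G m k p x * delta l p * u x j
          - G x j l * (christoffel G m k p x * w x p)) := fun p => by ring
    simp only [Matrix.mul_apply, gam, confDiff, Matrix.of_apply, e, ← Finset.mul_sum,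
      Finset.sum_sub_distrib, Finset.sum_add_distrib, ← Finset.sum_mul,
      sum_mul_delta' (fun p => christoffel G m k p x)]
  have e5 : (confDiff G u w s j x * gam G k x) m l
      = s x * (delta j m * (∑ p, christoffel G p k l x * u x p) + christoffel G m k l x * u x j
        - (∑ p, G x j p * christoffel G p k l x) * w x m) := by
    have e : ∀ p, s x * (delta j m * u x p + delta p m * u x j - G x j p * w x m)
          * christoffel G p k l x
        = s x * (delta j m * (christoffel G p k l x * u x p)
          + christoffel G p k l x * delta p m * u x j
          - G x j p * christoffel G p k l x * w x m) := fun p => by ring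
    simp only [Matrix.mul_apply, gam, confDiff, Matrix.of_apply, e, ← Finset.mul_sum,
      Finset.sum_sub_distrib, Finset.sum_add_distrib, ← Finset.sum_mul,
      sum_mul_delta (fun p => christoffel G p k l x)]
  rw [Matrix.sub_apply, Matrix.add_apply, e1, e2, e3, e4, e5, h.pd_lower hx, h.pd_lower hx]
  ring

lemma confDiff_mul (h : IsTorseOn G u w f ξ U) (hx : x ∈ U) (j k m l : Fin n) :
    (confDiff G u w s k x * confDiff G u w s j x) m l
      = s x ^ 2 * (delta k m * (2 * (u x j * u x l) + G x j l) + delta j m * (u x k * u x l)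
        + delta l m * (u x k * u x j) - w x m * G x k j * u x l - w x m * G x k l * u x j) := by
  have e : ∀ p, s x * (delta k m * u x p + delta p m * u x k - G x k p * w x m)
        * (s x * (delta j p * u x l + delta l p * u x j - G x j l * w x p))
      = s x ^ 2 * (delta k m * (u x p * delta j p * u x l + u x p * delta l p * u x j
          - G x j l * (w x p * u x p))
        + u x k * (delta p m * delta j p * u x l + delta p m * delta l p * u x j
          - G x j l * (w x p * delta p m))
        - w x m * (G x k p * delta j p * u x l + G x k p * delta l p * u x j
          - G x j l * (w x p * G x p k))) := fun p => by
    rw [h.metric.symm x hx k p]; ring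
  simp only [Matrix.mul_apply, confDiff, Matrix.of_apply, e, ← Finset.mul_sum,
    Finset.sum_sub_distrib, Finset.sum_add_distrib, ← Finset.sum_mul, h.unit x hx,
    sum_mul_delta' (fun p => u x p), sum_mul_delta' (fun p => delta p m),
    sum_mul_delta (fun p => w x p), sum_mul_delta' (fun p => G x k p),
    h.sum_upper_mul_metric hx]
  ring

/-- The Riemann tensor of `e^{2σ} g`. -/
lemma riemann_conf (h : IsTorseOn G u w f ξ U) (hσ : ContDiffOn ℝ ∞ σ U)
    (hs : ContDiffOn ℝ ∞ s U)
    (hgrad : ∀ y ∈ U, ∀ k, pd k σ y = s y * u y k) (hx : x ∈ U) (j k l m : Fin n) :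
    riemann (confMetric σ G) j k l m x = riemann G j k l m x
      - kulkarni (G x) (confTensor G u x (s x ^ 2 / 2 - s x * f x)
        (∑ m, w x m * pd m s x - s x * f x + s x ^ 2)) j k l m := by
  have hU := h.isOpen
  have hm := h.metric
  rw [← curv_gam_apply, curv_congr hU (fun i y hy => h.gam_conf hσ hgrad hy i) hx,
    curv_add hU hm.smoothGam (h.smoothM_confDiff hs) hx, Matrix.add_apply, Matrix.add_apply,
    Matrix.sub_apply (pdM k (confDiff G u w s j) x + _ - _), h.cov_confDiff hs hx,
    h.cov_confDiff hs hx, Matrix.sub_apply, h.confDiff_mul hx, h.confDiff_mul hx, curv_gam_apply,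
    h.pd_gradient_factor hσ hs hgrad hx k, h.pd_gradient_factor hσ hs hgrad hx j]
  -- Terms with Christoffel symbols or with `δ_l^m` are symmetric in `j`, `k` and drop out; for the
  -- one containing `∇s` this uses that `∇s` is parallel to `u`. The coefficients of `g` and `u ⊗ u`
  -- are those of `-∇∇σ + ∇σ ⊗ ∇σ - ½ |∇σ|² g`.
  simp only [kulkarni, h.confTensor_up hx]
  simp only [confTensor, hm.christoffel_symm hx _ k j,
    hm.symm x hx k j]
  ring

end IsTorseOn

end Conformal

/-! ### Conformal change of the Ricci tensor, of the field and of the Weyl divergence. -/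

section Conformal

variable {n : ℕ} {U : Set (EuclideanSpace ℝ (Fin n))} {x : EuclideanSpace ℝ (Fin n)}
  {G : Components n} {u w : EuclideanSpace ℝ (Fin n) → Fin n → ℝ}
  {f ξ σ s : EuclideanSpace ℝ (Fin n) → ℝ}

namespace IsTorseOn

/-- With `α`, `β` the coefficients of `g` and `u ⊗ u` in the conformal tensor, its trace is `n α -
β` since `u` has square `-1`. The Ricci tensor therefore keeps `u` as an eigenvector. -/
lemma ricci_weyl_conf (hn : 3 ≤ n) (h : IsTorseOn G u w f ξ U) (hσ : ContDiffOn ℝ ∞ σ U)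
    (hs : ContDiffOn ℝ ∞ s U) (hgrad : ∀ y ∈ U, ∀ k, pd k σ y = s y * u y k) (hx : x ∈ U) :
    (∀ k l, ricci (confMetric σ G) k l x = ricci G k l x
      + (n - 2) * confTensor G u x (s x ^ 2 / 2 - s x * f x)
        (∑ m, w x m * pd m s x - s x * f x + s x ^ 2) k l
      + (n * (s x ^ 2 / 2 - s x * f x)
        - (∑ m, w x m * pd m s x - s x * f x + s x ^ 2)) * G x k l)
    ∧ ∀ j k l m, weyl (confMetric σ G) j k l m x = weyl G j k l m x := by
  have key := h.metric.weyl_conformal hn hx (G' := confMetric σ G) (Real.exp_pos (2 * σ x)).ne'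
    rfl (h.riemann_conf hσ hs hgrad hx)
  refine ⟨fun k l => ?_, key.2⟩
  rw [key.1]
  congr 2
  simp only [h.confTensor_up hx, Finset.sum_add_distrib, ← Finset.mul_sum, sum_delta_self]
  have : ∑ m, u x m * w x m = -1 := by
    rw [← h.unit x hx]; exact Finset.sum_congr rfl fun _ _ => mul_comm _ _
  rw [this]
  ring

/-- `e^{-σ} u` is torse-forming for `e^{2σ} g`. -/
lemma conf (hn : 3 ≤ n) (h : IsTorseOn G u w f ξ U) (hσ : ContDiffOn ℝ ∞ σ U)
    (hs : ContDiffOn ℝ ∞ s U) (hgrad : ∀ y ∈ U, ∀ k, pd k σ y = s y * u y k) :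
    IsTorseOn (confMetric σ G) (fun y l => Real.exp (σ y) * u y l)
      (fun y l => Real.exp (-σ y) * w y l) (fun y => Real.exp (-σ y) * (f y - s y))
      (fun y => Real.exp (-(2 * σ y)) *
        (ξ y - (n - 1) * (∑ m, w y m * pd m s y + s y * f y))) U where
  metric := h.metric.conf hσ
  smooth l := (Real.contDiff_exp.comp_contDiffOn hσ).mul (h.smooth l)
  smoothUp l := (Real.contDiff_exp.comp_contDiffOn hσ.neg).mul (h.smoothUp l)
  smooth_f := (Real.contDiff_exp.comp_contDiffOn hσ.neg).mul (h.smooth_f.sub hs)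
  lower y hy := by
    have e : (fun l => Real.exp (-σ y) * w y l) = Real.exp (-σ y) • w y := rfl
    rw [e, confMetric, Matrix.smul_mulVec, Matrix.mulVec_smul, ← h.lower y hy, smul_smul,
      ← Real.exp_add]
    ext l
    rw [Pi.smul_apply, smul_eq_mul]
    congr 2
    ring
  unit y hy := by
    rw [← h.unit y hy]
    refine Finset.sum_congr rfl fun l _ => ?_
    have : Real.exp (-σ y) * Real.exp (σ y) = 1 := by rw [← Real.exp_add]; simp
    linear_combination (w y l * u y l) * this
  torse y hy k l := by
    have hm := h.metric
    have hd := hσ.differentiableAt_of_isOpen hm.isOpen hy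
    have e1 : pd k (fun z => Real.exp (σ z) * u z l) y
        = Real.exp (σ y) * (s y * u y k) * u y l + Real.exp (σ y)
          * (∑ m, christoffel G m k l y * u y m + f y * (G y k l + u y k * u y l)) := by
      rw [pd_mul (f := fun z => Real.exp (σ z)) k hd.exp (h.smooth.diffAt hm.isOpen hy l),
        pd_exp k hd, hgrad y hy, h.pd_lower hy]
    have e2 : ∑ m, christoffel (confMetric σ G) m k l y * (Real.exp (σ y) * u y m)
        = Real.exp (σ y) * (∑ m, christoffel G m k l y * u y m
          + s y * (2 * (u y k * u y l) + G y k l)) := by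
      have e : ∀ m, christoffel (confMetric σ G) m k l y * (Real.exp (σ y) * u y m)
          = Real.exp (σ y) * (christoffel G m k l y * u y m + s y * (u y m * delta k m * u y l
            + u y m * delta l m * u y k - G y k l * (w y m * u y m))) := by
        intro m
        have := congrFun (congrFun (h.gam_conf hσ hgrad hy k) m) l
        simp only [gam, confDiff, Matrix.add_apply, Matrix.of_apply] at this
        rw [this]
        ring
      simp only [e, ← Finset.mul_sum, Finset.sum_add_distrib, Finset.sum_sub_distrib,
        ← Finset.sum_mul, h.unit y hy, sum_mul_delta' (fun m => u y m)]
      ring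
    have e3 : Real.exp (2 * σ y) = Real.exp (σ y) * Real.exp (σ y) := by
      rw [← Real.exp_add]; ring_nf
    have e4 : Real.exp (-σ y) * Real.exp (σ y) = 1 := by rw [← Real.exp_add]; simp
    rw [covDeriv, e1, e2]
    simp only [confMetric, Matrix.smul_apply, smul_eq_mul, e3]
    linear_combination -(f y - s y) * (G y k l + u y k * u y l) * Real.exp (σ y) * e4
  eigen y hy j := by
    -- Applied to `u`, the added terms give `(n - 1)(2α - β) = -(n - 1)(ṡ + s φ)`, which is the
    -- shift in the eigenvalue.
    have hE : ∀ k, ricci (confMetric σ G) j k y * (Real.exp (-σ y) * w y k)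
        = Real.exp (-σ y) * (ricci G j k y * w y k
          + ((n - 2) * (s y ^ 2 / 2 - s y * f y) + (n * (s y ^ 2 / 2 - s y * f y)
            - (∑ m, w y m * pd m s y - s y * f y + s y ^ 2))) * (w y k * G y k j)
          + (n - 2) * (∑ m, w y m * pd m s y - s y * f y + s y ^ 2) * u y j
            * (w y k * u y k)) := by
      intro k
      rw [(h.ricci_weyl_conf hn hσ hs hgrad hy).1, confTensor, h.metric.symm y hy j k]
      ring
    have e1 : Real.exp (-(2 * σ y)) * Real.exp (σ y) = Real.exp (-σ y) := by
      rw [← Real.exp_add]; ring_nf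
    simp only [hE, ← Finset.mul_sum, Finset.sum_add_distrib, h.eigen y hy,
      h.sum_upper_mul_metric hy, h.unit y hy]
    rw [← e1]
    ring

/-- The divergence of the Weyl tensor under a conformal change. -/
lemma weylDiv_conf (hn : 3 ≤ n) (h : IsTorseOn G u w f ξ U) (hσ : ContDiffOn ℝ ∞ σ U)
    (hs : ContDiffOn ℝ ∞ s U) (hgrad : ∀ y ∈ U, ∀ k, pd k σ y = s y * u y k) (hx : x ∈ U)
    (j k l : Fin n) :
    weylDiv (confMetric σ G) j k l x = weylDiv G j k l x
      + (n - 3) * s x * ∑ m, weyl G j k l m x * u x m := by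
  have hm := h.metric
  have hC := hm.weyl_curvatureLike hx
  have htr := hm.weyl_trace hn hx
  set C : Fin n → Fin n → Fin n → Fin n → ℝ := fun j k l m => weyl G j k l m x with hCdef
  have hchr : ∀ a b c, christoffel (confMetric σ G) a b c x = christoffel G a b c x
      + s x * (delta b a * u x c + delta c a * u x b - G x b c * w x a) := fun a b c =>
    congrFun (congrFun (h.gam_conf hσ hgrad hx b) a) c
  have hpd : ∀ m, pd m (weyl (confMetric σ G) j k l m) x = pd m (weyl G j k l m) x := fun m =>
    pd_congr m hm.isOpen hx fun y hy => (h.ricci_weyl_conf hn hσ hs hgrad hy).2 j k l m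
  have hweyl : ∀ j k l m, weyl (confMetric σ G) j k l m x = C j k l m :=
    (h.ricci_weyl_conf hn hσ hs hgrad hx).2
  set W : Fin n → Fin n → Fin n → ℝ := fun j k l => ∑ m, C j k l m * u x m with hW
  have hWlow : ∀ j k l, ∑ p, low4 (G x) C j k l p * w x p = W j k l := by
    intro j k l
    simp only [low4, hW, Finset.sum_mul, h.lower x hx, Matrix.mulVec, dotProduct,
      Finset.mul_sum]
    rw [Finset.sum_comm]
    exact Finset.sum_congr rfl fun m _ => Finset.sum_congr rfl fun p _ => by ring
  have hlow : ∀ j k l q, ∑ m, G x m q * C j k l m = low4 (G x) C j k l q := fun j k l q =>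
    Finset.sum_congr rfl fun m _ => mul_comm _ _
  have t1 : ∑ m, ∑ p, (delta m m * u x p + delta p m * u x m - G x m p * w x m) * C j k l p
      = n * W j k l := by
    have e : ∀ m p, (delta m m * u x p + delta p m * u x m - G x m p * w x m) * C j k l p
        = delta m m * (C j k l p * u x p) + C j k l p * (u x m * delta p m)
          - C j k l p * (w x m * G x m p) := fun m p => by ring
    simp only [e, Finset.sum_add_distrib, Finset.sum_sub_distrib]
    simp only [← Finset.mul_sum]
    rw [Finset.sum_comm (f := fun m p => C j k l p * (u x m * delta p m)),
      Finset.sum_comm (f := fun m p => C j k l p * (w x m * G x m p))]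
    simp only [← Finset.mul_sum, ← Finset.sum_mul, h.sum_upper_mul_metric hx,
      sum_mul_delta' (fun m => u x m), sum_delta_self]
    ring
  -- One formula serves all three lower indices. For the Weyl tensor the trace vanishes, and the
  -- other two terms are contractions with `u` that the curvature symmetries reduce to `W`.
  have hgen : ∀ (T : Fin n → Fin n → ℝ) (q : Fin n),
      ∑ m, ∑ p, (delta m p * u x q + delta q p * u x m - G x m q * w x p) * T p m
      = u x q * ∑ m, T m m + ∑ m, T q m * u x m - ∑ p, (∑ m, G x m q * T p m) * w x p := by
    intro T q
    have e : ∀ m p, (delta m p * u x q + delta q p * u x m - G x m q * w x p) * T p m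
        = u x q * (T p m * delta m p) + u x m * (T p m * delta q p)
          - G x m q * T p m * w x p := fun m p => by ring
    simp only [e, Finset.sum_add_distrib, Finset.sum_sub_distrib]
    simp only [← Finset.mul_sum]
    rw [Finset.sum_comm (f := fun m p => G x m q * T p m * w x p)]
    have e1 : ∀ m, ∑ p, T p m * delta m p = T m m := fun m =>
      sum_mul_delta' (fun p => T p m) m
    have e2 : ∀ m, ∑ p, T p m * delta q p = T q m := fun m =>
      sum_mul_delta' (fun p => T p m) q
    simp only [e1, e2, ← Finset.sum_mul]
    congr 2
    exact Finset.sum_congr rfl fun m _ => mul_comm _ _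
  have tr2 : ∀ j l, ∑ m, C j m l m = 0 := by
    intro j l
    rw [← neg_eq_zero, ← htr j l, ← Finset.sum_neg_distrib]
    exact Finset.sum_congr rfl fun m _ => by rw [hC.antisymm j m l m, neg_neg]
  have tr3 : ∑ m, C j k m m = 0 := by
    have : ∀ m, C j k m m = - C k m j m - C m j k m := fun m => by
      linarith [hC.bianchi j k m m]
    simp only [this, Finset.sum_sub_distrib, Finset.sum_neg_distrib, tr2]
    have := htr j k
    simp only [hCdef]
    rw [this]
    simp
  have t2 : ∑ m, ∑ p, (delta m p * u x j + delta j p * u x m - G x m j * w x p) * C p k l m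
      = W j k l + W l j k := by
    rw [hgen (fun p m => C p k l m) j]
    simp only [hlow]
    have e : ∀ p, low4 (G x) C p k l j = - low4 (G x) C l j k p := fun p => by
      rw [hC.pair, hC.skew]
    have e0 : ∑ m, C m k l m = 0 := htr k l
    simp only [e, neg_mul, Finset.sum_neg_distrib, hWlow, e0]
    ring
  have t3 : ∑ m, ∑ p, (delta m p * u x k + delta k p * u x m - G x m k * w x p) * C j p l m
      = W j k l - W l k j := by
    rw [hgen (fun p m => C j p l m) k]
    simp only [hlow]
    have e : ∀ p, low4 (G x) C j p l k = low4 (G x) C l k j p := fun p => hC.pair _ _ _ _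
    simp only [e, hWlow, tr2]
    ring
  have t4 : ∑ m, ∑ p, (delta m p * u x l + delta l p * u x m - G x m l * w x p) * C j k p m
      = W j k l + W j k l := by
    rw [hgen (fun p m => C j k p m) l]
    simp only [hlow]
    have e : ∀ p, low4 (G x) C j k p l = - low4 (G x) C j k l p := fun p => hC.skew _ _ _ _
    simp only [e, neg_mul, Finset.sum_neg_distrib, hWlow, tr3]
    ring
  have hcyc : W j k l + W k l j + W l j k = 0 := by
    simp only [hW, ← Finset.sum_add_distrib, ← add_mul, hC.bianchi, zero_mul,
      Finset.sum_const_zero]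
  have hanti : W l k j = - W k l j := by
    simp only [hW, ← Finset.sum_neg_distrib]
    exact Finset.sum_congr rfl fun m _ => by rw [hC.antisymm l k j m]; ring
  have hsum : weylDiv (confMetric σ G) j k l x = weylDiv G j k l x + s x *
      (∑ m, ∑ p, (delta m m * u x p + delta p m * u x m - G x m p * w x m) * C j k l p
      - ∑ m, ∑ p, (delta m p * u x j + delta j p * u x m - G x m j * w x p) * C p k l m
      - ∑ m, ∑ p, (delta m p * u x k + delta k p * u x m - G x m k * w x p) * C j p l m
      - ∑ m, ∑ p, (delta m p * u x l + delta l p * u x m - G x m l * w x p) * C j k p m) := by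
    simp only [weylDiv, hpd, hchr, hweyl]
    simp only [← Finset.sum_sub_distrib, Finset.mul_sum, ← Finset.sum_add_distrib]
    refine Finset.sum_congr rfl fun m _ => ?_
    rw [add_assoc, ← Finset.sum_add_distrib]
    congr 1
    refine Finset.sum_congr rfl fun p _ => ?_
    simp only [hCdef]
    ring
  -- The total is `(n - 4) W_{jkl} - W_{ljk} + W_{lkj}`; antisymmetry and the cyclic identity turn
  -- the last two terms into one more `W_{jkl}`, whence `n - 3`.
  rw [hsum, t1, t2, t3, t4]
  change _ = weylDiv G j k l x + (n - 3) * s x * W j k l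
  linear_combination s x * hanti - s x * hcyc

end IsTorseOn

end Conformal

/-! ## The divergence of curvature tensors -/

section Divergence

variable {n : ℕ} {U : Set (EuclideanSpace ℝ (Fin n))} {x : EuclideanSpace ℝ (Fin n)}
  {G : Components n}

open IsTorseOn (sum_delta_mul sum_mul_delta sum_mul_delta' sum_delta_self)

/-- The covariant derivative `∇_i T` of a `(0,2)`-tensor. -/
def cov2 (G : Components n) (T : Components n) (i : Fin n) : Components n :=
  fun x => pdM i T x - (gam G i x)ᵀ * T x - T x * gam G i x

lemma cov2_apply (T : Components n) (i k l : Fin n) :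
    cov2 G T i x k l = pd i (fun y => T y k l) x - ∑ p, christoffel G p i k x * T x p l
      - ∑ p, christoffel G p i l x * T x k p := by
  simp only [cov2, pdM, Matrix.sub_apply, Matrix.of_apply, Matrix.mul_apply,
    Matrix.transpose_apply, gam]
  congr 1
  exact Finset.sum_congr rfl fun p _ => mul_comm _ _

/-- The divergence `∇_m T_{jkl}{}^m`. -/
def div4 (G : Components n) (T : Fin n → Fin n → Fin n → Fin n → EuclideanSpace ℝ (Fin n) → ℝ)
    (j k l : Fin n) (x : EuclideanSpace ℝ (Fin n)) : ℝ :=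
  ∑ m, (pd m (T j k l m) x
    + ∑ p, (christoffel G m m p x * T j k l p x - christoffel G p m j x * T p k l m x
      - christoffel G p m k x * T j p l m x - christoffel G p m l x * T j k p m x))

lemma weylDiv_eq_div4 (j k l : Fin n) : weylDiv G j k l x = div4 G (weyl G) j k l x := rfl

section Linear

variable {T S : Fin n → Fin n → Fin n → Fin n → EuclideanSpace ℝ (Fin n) → ℝ}

lemma div4_add (hT : ∀ j k l m, DifferentiableAt ℝ (T j k l m) x)
    (hS : ∀ j k l m, DifferentiableAt ℝ (S j k l m) x) (j k l : Fin n) :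
    div4 G (fun j k l m y => T j k l m y + S j k l m y) j k l x
      = div4 G T j k l x + div4 G S j k l x := by
  simp only [div4, ← Finset.sum_add_distrib]
  refine Finset.sum_congr rfl fun m _ => ?_
  rw [pd_add m (hT j k l m) (hS j k l m), add_add_add_comm, ← Finset.sum_add_distrib]
  congr 1
  exact Finset.sum_congr rfl fun p _ => by ring

lemma div4_const_mul (c : ℝ) (hT : ∀ j k l m, DifferentiableAt ℝ (T j k l m) x)
    (j k l : Fin n) :
    div4 G (fun j k l m y => c * T j k l m y) j k l x = c * div4 G T j k l x := by
  simp only [div4, Finset.mul_sum, mul_add]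
  refine Finset.sum_congr rfl fun m _ => ?_
  rw [pd_const_mul m c (hT j k l m)]
  congr 1
  exact Finset.sum_congr rfl fun p _ => by ring

lemma div4_swap (T : Fin n → Fin n → Fin n → Fin n → EuclideanSpace ℝ (Fin n) → ℝ)
    (j k l : Fin n) :
    div4 G (fun j k l m y => T k j l m y) j k l x = div4 G T k j l x := by
  unfold div4
  refine Finset.sum_congr rfl fun m _ => ?_
  congr 1
  exact Finset.sum_congr rfl fun p _ => by ring

end Linear

/-- The Kronecker tensor is parallel, so the divergence index is simply transferred to the
derivative. -/
lemma div4_delta (hG : IsMetricOn G U) (hx : x ∈ U) {A : Components n} (hA : SmoothM A U)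
    (j k l : Fin n) :
    div4 G (fun j k l m y => delta j m * A y k l) j k l x = cov2 G A j x k l := by
  have e : ∀ m, pd m (fun y => delta j m * A y k l) x
      = delta j m * pd m (fun y => A y k l) x := fun m =>
    pd_const_mul m _ (hA.diffAt hG.isOpen hx k l)
  have e2 : ∀ m p, christoffel G m m p x * (delta j p * A x k l)
        - christoffel G p m j x * (delta p m * A x k l)
        - christoffel G p m k x * (delta j m * A x p l)
        - christoffel G p m l x * (delta j m * A x k p)
      = christoffel G m m p x * delta j p * A x k l
        - christoffel G p m j x * delta p m * A x k l
        - christoffel G p m k x * A x p l * delta j m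
        - christoffel G p m l x * A x k p * delta j m := fun m p => by ring
  simp only [div4, e, e2, Finset.sum_add_distrib, Finset.sum_sub_distrib]
  simp only [← Finset.sum_mul, sum_mul_delta' (fun p => christoffel G _ _ p x),
    sum_mul_delta (fun p => christoffel G p _ _ x), sum_delta_mul (fun m => pd m _ x),
    sum_mul_delta' (fun m => ∑ p, christoffel G p m k x * A x p l),
    sum_mul_delta' (fun m => ∑ p, christoffel G p m l x * A x k p), cov2_apply]
  ring

/-- The metric is parallel and factors out. The cofactor, the divergence of `B`, is left existential
because only the shape of the term matters later. -/
lemma div4_mul_metric (hG : IsMetricOn G U) (hx : x ∈ U) {B : Components n} (hB : SmoothM B U) :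
    ∃ X : Fin n → ℝ, ∀ j k l, div4 G (fun j k l m y => B y j m * G y k l) j k l x
      = X j * G x k l := by
  refine ⟨fun j => ∑ m, (pd m (fun y => B y j m) x
    + ∑ p, (christoffel G m m p x * B x j p - christoffel G p m j x * B x p m)),
    fun j k l => ?_⟩
  simp only [div4, Finset.sum_mul]
  refine Finset.sum_congr rfl fun m _ => ?_
  have e1 : pd m (fun y => G y k l) x = ∑ p, christoffel G p m k x * G x p l
      + ∑ p, G x k p * christoffel G p m l x := by
    have := congrFun (congrFun (hG.compat hx m) k) l
    simpa [pdM, Matrix.mul_apply, gam] using this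
  rw [pd_mul m (hB.diffAt hG.isOpen hx j m) (hG.smooth.diffAt hG.isOpen hx k l), e1, add_mul,
    Finset.sum_mul, mul_add, Finset.mul_sum, Finset.mul_sum, add_assoc]
  simp only [← Finset.sum_add_distrib]
  congr 1
  exact Finset.sum_congr rfl fun p _ => by ring

lemma IsMetricOn.smooth_riemann (hG : IsMetricOn G U) (j k l m : Fin n) :
    ContDiffOn ℝ ∞ (riemann G j k l m) U := by
  have := smoothM_curv hG.isOpen hG.smoothGam j k m l
  simpa only [curv_gam_apply] using this

lemma IsMetricOn.smoothM_ric (hG : IsMetricOn G U) : SmoothM (ric G) U := fun k l =>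
  (ContDiffOn.sum fun m _ => hG.smooth_riemann m k l m).neg

lemma IsMetricOn.smooth_scalarCurv (hG : IsMetricOn G U) : ContDiffOn ℝ ∞ (scalarCurv G) U :=
  ContDiffOn.sum fun k _ => ContDiffOn.sum fun l _ => (hG.smoothInv k l).mul (hG.smoothM_ric k l)

/-- The divergence of the Weyl tensor, up to terms proportional to the metric. -/
lemma IsMetricOn.weylDiv_eq (hG : IsMetricOn G U) (hx : x ∈ U) :
    ∃ X : Fin n → ℝ, ∀ j k l, weylDiv G j k l x = div4 G (riemann G) j k l x
      + ((n : ℝ) - 2)⁻¹ * (cov2 G (ric G) j x k l - cov2 G (ric G) k x j l)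
      + (X j * G x k l - X k * G x j l) := by
  have hU := hG.isOpen
  -- All terms of the Weyl tensor containing a metric factor are collected: `B` is the raised Ricci
  -- tensor over `n - 2`, less the scalar curvature multiple of the identity.
  set B : Components n := fun y => ((n : ℝ) - 2)⁻¹ • (ric G y * (G y)⁻¹)
    - (scalarCurv G y * (((n : ℝ) - 1) * ((n : ℝ) - 2))⁻¹) • (1 : Matrix (Fin n) (Fin n) ℝ)
    with hB
  have hBs : SmoothM B U := SmoothM.sub
    (SmoothM.smul contDiffOn_const (hG.smoothM_ric.mul hG.smoothInv))
    (SmoothM.smul (hG.smooth_scalarCurv.mul contDiffOn_const) fun _ _ => contDiffOn_const)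
  obtain ⟨X, hX⟩ := div4_mul_metric hG hx hBs
  refine ⟨X, fun j k l => ?_⟩
  set P : Fin n → Fin n → Fin n → Fin n → EuclideanSpace ℝ (Fin n) → ℝ :=
    fun j k l m y => delta j m * ric G y k l with hP
  set Q : Fin n → Fin n → Fin n → Fin n → EuclideanSpace ℝ (Fin n) → ℝ :=
    fun j k l m y => B y j m * G y k l with hQ
  have hRd : ∀ j k l m, DifferentiableAt ℝ (riemann G j k l m) x := fun j k l m =>
    (hG.smooth_riemann j k l m).differentiableAt_of_isOpen hU hx
  have hPd : ∀ j k l m, DifferentiableAt ℝ (P j k l m) x := fun j k l m =>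
    (hG.smoothM_ric.diffAt hU hx k l).const_mul _
  have hQd : ∀ j k l m, DifferentiableAt ℝ (Q j k l m) x := fun j k l m =>
    (hBs.diffAt hU hx j m).fun_mul (hG.smooth.diffAt hU hx k l)
  have hw : weyl G = fun j k l m y => riemann G j k l m y
      + (((n : ℝ) - 2)⁻¹ * (P j k l m y + -1 * P k j l m y)
        + (Q j k l m y + -1 * Q k j l m y)) := by
    funext j k l m y
    have hup : ∀ j, ricciUp G j m y = (ric G y * (G y)⁻¹) j m := fun j => rfl
    have h1 : ∀ j, (1 : Matrix (Fin n) (Fin n) ℝ) j m = delta j m := fun j => rfl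
    simp only [weyl, hP, hQ, hB, hup, Matrix.sub_apply, Matrix.smul_apply, smul_eq_mul, h1, ric,
      Matrix.of_apply]
    ring
  have hPs := fun j k l m => hPd k j l m
  have hQs := fun j k l m => hQd k j l m
  have hP1 := fun j k l m => (hPd k j l m).const_mul (-1)
  have hQ1 := fun j k l m => (hQd k j l m).const_mul (-1)
  have hP2 := fun j k l m => ((hPd j k l m).fun_add (hP1 j k l m))
  have hQ2 := fun j k l m => ((hQd j k l m).fun_add (hQ1 j k l m))
  have hP3 := fun j k l m => ((hP2 j k l m).const_mul ((n : ℝ) - 2)⁻¹)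
  rw [weylDiv_eq_div4, hw,
    div4_add (T := riemann G) hRd (fun j k l m => (hP3 j k l m).fun_add (hQ2 j k l m)),
    div4_add hP3 hQ2, div4_const_mul _ hP2, div4_add hPd hP1, div4_add hQd hQ1,
    div4_const_mul (T := fun j k l m y => P k j l m y) _ hPs,
    div4_const_mul (T := fun j k l m y => Q k j l m y) _ hQs, div4_swap P, div4_swap Q]
  have hPj : ∀ j k l, div4 G P j k l x = cov2 G (ric G) j x k l :=
    div4_delta hG hx hG.smoothM_ric
  simp only [hX, hPj]
  ring

/-- The contracted second Bianchi identity. -/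
lemma IsMetricOn.div4_riemann (hG : IsMetricOn G U) (hx : x ∈ U) (j k l : Fin n) :
    div4 G (riemann G) j k l x = cov2 G (ric G) k x j l - cov2 G (ric G) j x k l := by
  have hU := hG.isOpen
  set N : Fin n → Fin n → Fin n → Fin n → Fin n → ℝ := fun i j k l m =>
    pd i (riemann G j k l m) x
      + ∑ p, (christoffel G m i p x * riemann G j k l p x
        - christoffel G p i j x * riemann G p k l m x
        - christoffel G p i k x * riemann G j p l m x
        - christoffel G p i l x * riemann G j k p m x) with hN
  have hb : ∀ i j k l m, N i j k l m + N j k i l m + N k i j l m = 0 := by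
    intro i j k l m
    have h1 := congrFun (congrFun (curv_bianchi hU hG.smoothGam hx i j k) m) l
    have h2 : ∀ i j k, pdM i (curv (gam G) j k) x m l = pd i (riemann G j k l m) x := by
      intro i j k
      simp only [pdM, Matrix.of_apply, curv_gam_apply]
    have h3 : ∀ i (F : Matrix (Fin n) (Fin n) ℝ), (gam G i x * F) m l
        = ∑ p, christoffel G m i p x * F p l := fun i F => rfl
    have h4 : ∀ i (F : Matrix (Fin n) (Fin n) ℝ), (F * gam G i x) m l
        = ∑ p, christoffel G p i l x * F m p := fun i F => by
      simp only [Matrix.mul_apply, gam, Matrix.of_apply, mul_comm]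
    simp only [Matrix.add_apply, Matrix.sub_apply, h2, h3, h4, curv_gam_apply,
      Matrix.zero_apply] at h1
    rw [← h1]
    simp only [hN, Finset.sum_sub_distrib]
    -- `curv_bianchi` has no Christoffel corrections on the form indices, while `N` is the full `∇_i
    -- R_{jkl}{}^m`. In the cyclic sum these corrections cancel in pairs.
    have e1 : ∀ a b c, ∑ p, christoffel G p a b x * riemann G p c l m x
        = - ∑ p, christoffel G p b a x * riemann G c p l m x := by
      intro a b c
      rw [← Finset.sum_neg_distrib]
      exact Finset.sum_congr rfl fun p _ => by
        rw [IsMetricOn.riemann_antisymm G p c l m, hG.christoffel_symm hx p a b]; ring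
    rw [e1 i j k, e1 j k i, e1 k i j]
    ring
  have htr : ∀ i k l, ∑ m, N i m k l m = - cov2 G (ric G) i x k l := by
    intro i k l
    have hd : ∀ m ∈ Finset.univ, DifferentiableAt ℝ (riemann G m k l m) x := fun m _ =>
      (hG.smooth_riemann m k l m).differentiableAt_of_isOpen hU hx
    have e1 : pd i (fun y => ric G y k l) x = - ∑ m, pd i (riemann G m k l m) x := by
      rw [← pd_sum _ i hd, ← pd_neg]; rfl
    have e2 : ∀ k l, ric G x k l = - ∑ m, riemann G m k l m x := fun k l => rfl
    rw [cov2_apply, e1]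
    simp only [e2, hN, Finset.sum_add_distrib, Finset.sum_sub_distrib, mul_neg,
      Finset.sum_neg_distrib, Finset.mul_sum]
    rw [Finset.sum_comm (f := fun m p => christoffel G p i m x * riemann G p k l m x),
      Finset.sum_comm (f := fun m p => christoffel G p i k x * riemann G m p l m x),
      Finset.sum_comm (f := fun m p => christoffel G p i l x * riemann G m k p m x)]
    ring
  have hanti : ∀ i j k l m, N i j k l m = - N i k j l m := by
    intro i j k l m
    have e0 : pd i (riemann G j k l m) x = - pd i (riemann G k j l m) x := by
      rw [← pd_neg]
      exact pd_congr i hU hx fun y _ => IsMetricOn.riemann_antisymm G j k l m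
    simp only [hN, Finset.sum_sub_distrib, e0]
    have e1 : ∀ p, riemann G j k l p x = - riemann G k j l p x := fun p =>
      IsMetricOn.riemann_antisymm G j k l p
    have e2 : ∀ p, riemann G p k l m x = - riemann G k p l m x := fun p =>
      IsMetricOn.riemann_antisymm G p k l m
    have e3 : ∀ p, riemann G j p l m x = - riemann G p j l m x := fun p =>
      IsMetricOn.riemann_antisymm G j p l m
    have e4 : ∀ p, riemann G j k p m x = - riemann G k j p m x := fun p =>
      IsMetricOn.riemann_antisymm G j k p m
    simp only [e1, e2, e3, e4, mul_neg, Finset.sum_neg_distrib]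
    ring
  -- The Bianchi identity is traced over the derivative index and the upper index; the two other
  -- terms are derivatives of the Ricci tensor.
  have hsum : ∑ m, N m j k l m = ∑ m, N k j m l m - ∑ m, N j k m l m + 0 := by
    have : ∀ m, N m j k l m = N k j m l m - N j k m l m := fun m => by
      linarith [hb m j k l m, hanti k j m l m]
    simp only [this, Finset.sum_sub_distrib, add_zero]
  have e : ∀ j k l, ∑ m, N j k m l m = cov2 G (ric G) j x k l := by
    intro j k l
    rw [← neg_neg (cov2 G (ric G) j x k l), ← htr, ← Finset.sum_neg_distrib]
    exact Finset.sum_congr rfl fun m _ => hanti j k m l m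
  have e0 : div4 G (riemann G) j k l x = ∑ m, N m j k l m := rfl
  rw [e0, hsum, e, e, add_zero]

end Divergence

/-! ### Derivatives of the curvature contracted with the torse-forming field. -/

section TorseCurvature

variable {n : ℕ} {U : Set (EuclideanSpace ℝ (Fin n))} {x : EuclideanSpace ℝ (Fin n)}
  {G : Components n} {u w : EuclideanSpace ℝ (Fin n) → Fin n → ℝ}
  {f ξ : EuclideanSpace ℝ (Fin n) → ℝ}

lemma cov2_symm {T : Components n} (hU : IsOpen U) (hT : ∀ y ∈ U, ∀ k l, T y k l = T y l k)
    (hx : x ∈ U) (i k l : Fin n) : cov2 G T i x k l = cov2 G T i x l k := by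
  rw [cov2_apply, cov2_apply, pd_congr i hU hx fun y hy => hT y hy k l]
  simp only [hT x hx k, hT x hx _ l]
  ring

lemma cov2_sub {T S : Components n} (hU : IsOpen U) (hT : SmoothM T U) (hS : SmoothM S U)
    (hx : x ∈ U) (i : Fin n) :
    cov2 G (fun y => T y - S y) i x = cov2 G T i x - cov2 G S i x := by
  unfold cov2
  rw [pdM_sub i hU hT hS hx]
  noncomm_ring

lemma cov2_smul {T : Components n} {c : EuclideanSpace ℝ (Fin n) → ℝ} (hU : IsOpen U)
    (hc : ContDiffOn ℝ ∞ c U) (hT : SmoothM T U) (hx : x ∈ U) (i : Fin n) :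
    cov2 G (fun y => c y • T y) i x = pd i c x • T x + c x • cov2 G T i x := by
  unfold cov2
  rw [pdM_smul i hU hc hT hx]
  simp only [smul_sub, mul_smul_comm, smul_mul_assoc]
  abel

lemma cov2_metric (hG : IsMetricOn G U) (hx : x ∈ U) (i : Fin n) : cov2 G G i x = 0 := by
  unfold cov2
  rw [hG.compat hx]
  abel

/-- The trace of a covariant derivative is the derivative of the trace. -/
lemma trace_cov2 (hG : IsMetricOn G U) {T : Components n} (hT : SmoothM T U) (hx : x ∈ U)
    (i : Fin n) :
    ((G x)⁻¹ * cov2 G T i x).trace = pd i (fun y => ((G y)⁻¹ * T y).trace) x := by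
  have hU := hG.isOpen
  -- The inverse metric is parallel too, by differentiating `G⁻¹ G = 1`.
  have h1 : pdM i (fun y => (G y)⁻¹) x
      = -((G x)⁻¹ * (gam G i x)ᵀ) - gam G i x * (G x)⁻¹ := by
    have e1 : pdM i (fun y => (G y)⁻¹ * G y) x = 0 := by
      rw [pdM_congr i hU hx (B := fun _ => 1) fun y hy => hG.inv_mul hy]
      ext a b
      exact pd_const i _
    rw [pdM_mul i hU hG.smoothInv hG.smooth hx, hG.compat hx] at e1
    have e2 := congrArg (fun Z => Z * (G x)⁻¹) e1
    simp only [add_mul, zero_mul, mul_add, mul_assoc, hG.mul_inv hx, mul_one] at e2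
    have e3 : (G x)⁻¹ * (G x * (gam G i x * (G x)⁻¹)) = gam G i x * (G x)⁻¹ := by
      rw [← mul_assoc, hG.inv_mul hx, one_mul]
    rw [e3] at e2
    rw [← sub_eq_zero, ← e2]
    abel
  have h2 : pd i (fun y => ((G y)⁻¹ * T y).trace) x
      = (pdM i (fun y => (G y)⁻¹ * T y) x).trace := by
    simp only [Matrix.trace, Matrix.diag]
    rw [pd_sum (F := fun a y => ((G y)⁻¹ * T y) a a) _ i
      fun a _ => (hG.smoothInv.mul hT).diffAt hU hx a a]
    rfl
  rw [h2, pdM_mul i hU hG.smoothInv hT hx, h1]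
  have e4 : (gam G i x * ((G x)⁻¹ * T x)).trace = ((G x)⁻¹ * (T x * gam G i x)).trace := by
    rw [Matrix.trace_mul_comm, mul_assoc]
  simp only [cov2, sub_mul, neg_mul, mul_sub, Matrix.trace_add, Matrix.trace_sub,
    Matrix.trace_neg, e4, mul_assoc]
  ring

namespace IsTorseOn

lemma sum_christoffel (h : IsTorseOn G u w f ξ U) (hx : x ∈ U) (m j : Fin n) :
    pd m (fun y => w y j) x
      = f x * (delta m j + u x m * w x j) - ∑ p, christoffel G j m p x * w x p := by
  have := congrFun (h.pd_upper hx m) j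
  simpa [pdV, Matrix.mulVec, dotProduct, gam, delta, Pi.single_apply, eq_comm, mul_add] using this

lemma ric_mulVec (h : IsTorseOn G u w f ξ U) (hx : x ∈ U) : ric G x *ᵥ w x = ξ x • u x := by
  ext j
  exact h.eigen x hx j

/-- Smoothness of `ξ` is not part of the data; it follows from `ξ = -R_{jk} u^j u^k`. -/
lemma smooth_eigenvalue (h : IsTorseOn G u w f ξ U) : ContDiffOn ℝ ∞ ξ U := by
  have : ContDiffOn ℝ ∞ (fun y => - ∑ j, w y j * (ric G y *ᵥ w y) j) U :=
    (ContDiffOn.sum fun j _ => (h.smoothUp j).mul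
      (SmoothV.mulVec h.metric.smoothM_ric h.smoothUp j)).neg
  refine this.congr fun y hy => ?_
  have e : ∀ j, w y j * (ξ y • u y) j = ξ y * (w y j * u y j) := fun j => by
    simp only [Pi.smul_apply, smul_eq_mul]; ring
  rw [h.ric_mulVec hy]
  simp only [e, ← Finset.mul_sum, h.unit y hy]
  ring

/-- Leibniz rule `(∇_k T) u = ∇_k (T u) - T ∇_k u`, with `∇_k u^m = φ (δ_k^m + u_k u^m)` inserted.
-/
lemma cov2_mulVec_upper (h : IsTorseOn G u w f ξ U) {T : Components n} (hT : SmoothM T U)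
    {v : EuclideanSpace ℝ (Fin n) → Fin n → ℝ} (hv : ∀ y ∈ U, T y *ᵥ w y = v y) (hx : x ∈ U)
    (k : Fin n) :
    cov2 G T k x *ᵥ w x = pdV k v x - (gam G k x)ᵀ *ᵥ v x
      - f x • (T x *ᵥ Pi.single k 1 + u x k • v x) := by
  have h1 : pdV k v x = pdM k T x *ᵥ w x + T x *ᵥ pdV k w x := by
    rw [← pdV_mulVec k h.isOpen hT h.smoothUp hx,
      pdV_congr k h.isOpen hx fun y hy => (hv y hy).symm]
  rw [h1, h.pd_upper hx]
  simp only [cov2, Matrix.sub_mulVec, Matrix.mulVec_sub, Matrix.mulVec_add, Matrix.mulVec_smul,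
    ← Matrix.mulVec_mulVec, hv x hx]
  abel

lemma pdV_lower (h : IsTorseOn G u w f ξ U) (hx : x ∈ U) (k : Fin n) :
    pdV k u x = (gam G k x)ᵀ *ᵥ u x + f x • (G x k + u x k • u x) := by
  ext l
  simp only [pdV, h.pd_lower hx]
  rfl

/-- `u^j ∇_k R_{jl}`. -/
lemma cov2_ric_second (h : IsTorseOn G u w f ξ U) (hx : x ∈ U) (k l : Fin n) :
    ∑ j, w x j * cov2 G (ric G) k x j l
      = pd k ξ x * u x l - f x * ricci G k l x + ξ x * f x * G x k l := by
  have hm := h.metric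
  have h1 := congrFun (h.cov2_mulVec_upper hm.smoothM_ric (fun y hy => h.ric_mulVec hy) hx k) l
  have h2 : pdV k (fun y => ξ y • u y) x = pd k ξ x • u x + ξ x • pdV k u x := by
    ext l
    exact pd_mul k (h.smooth_eigenvalue.differentiableAt_of_isOpen h.isOpen hx)
      (h.smooth.diffAt h.isOpen hx l)
  have h3 : ∑ j, w x j * cov2 G (ric G) k x j l = (cov2 G (ric G) k x *ᵥ w x) l := by
    simp only [Matrix.mulVec, dotProduct]
    exact Finset.sum_congr rfl fun j _ => by
      rw [cov2_symm (T := ric G) h.isOpen (fun y hy k l => hm.ricci_symm hy k l) hx, mul_comm]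
  have h4 : (ric G x *ᵥ Pi.single k 1) l = ricci G k l x := by
    rw [hm.ricci_symm hx k l]; simp [ric]
  rw [h3, h1, h2, h.pdV_lower hx, Matrix.mulVec_smul]
  simp only [Pi.sub_apply, Pi.add_apply, Pi.smul_apply, smul_eq_mul, h4]
  ring

/-- `u^j ∇_m R_{jkl}{}^m`. -/
lemma div4_riemann_first (hn : 3 ≤ n) (h : IsTorseOn G u w f ξ U) (hx : x ∈ U) (k l : Fin n) :
    ∑ j, w x j * div4 G (riemann G) j k l x
      = f x * ricci G k l x
        - ((∑ m, w x m * pd m ξ x) / (n - 1) + ξ x * f x) * G x k l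
        + pd k ξ x / (n - 1) * u x l := by
  have hn' : (3 : ℝ) ≤ n := by exact_mod_cast hn
  have hn1 : (n : ℝ) - 1 ≠ 0 := by linarith
  have hm := h.metric
  have hU := h.isOpen
  set b : EuclideanSpace ℝ (Fin n) → ℝ := fun y => ξ y * ((n : ℝ) - 1)⁻¹ with hb
  have hbs : ContDiffOn ℝ ∞ b U := h.smooth_eigenvalue.mul contDiffOn_const
  have hξd := h.smooth_eigenvalue.differentiableAt_of_isOpen hU hx
  have hbd := hbs.differentiableAt_of_isOpen hU hx
  have hbpd : ∀ m, pd m b x = pd m ξ x * ((n : ℝ) - 1)⁻¹ := fun m => by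
    rw [hb, pd_mul m hξd (differentiableAt_const _), pd_const]; ring
  -- `V` is the explicit value of `u^j R_{jkl}{}^m`, valid on all of `U` and hence differentiable.
  -- Then `u^j ∇_m R_{jkl}{}^m = ∇_m V_{kl}{}^m - R_{jkl}{}^m ∇_m u^j`, and the `δ_m^j` in `∇_m u^j`
  -- yields the term `φ R_{kl}`.
  set V : Fin n → Fin n → Fin n → EuclideanSpace ℝ (Fin n) → ℝ := fun k l m y =>
    b y * (delta k m * u y l - w y m * G y k l) with hV
  have hRV : ∀ k l m, ∀ y ∈ U, ∑ j, riemann G j k l m y * w y j = V k l m y := by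
    intro k l m y hy
    rw [h.riemann_up_first hn hy]
    simp only [hV, hb]
    ring
  have hVpd : ∀ m, ∑ j, w x j * pd m (riemann G j k l m) x
      = pd m (V k l m) x - ∑ j, riemann G j k l m x * pd m (fun y => w y j) x := by
    intro m
    have hR := fun j => (hm.smooth_riemann j k l m).differentiableAt_of_isOpen hU hx
    have hw := fun j => h.smoothUp.diffAt hU hx j
    rw [← pd_congr m hU hx (hRV k l m), pd_sum (F := fun j y => riemann G j k l m y * w y j) _ m
      fun j _ => (hR j).fun_mul (hw j), ← Finset.sum_sub_distrib]
    exact Finset.sum_congr rfl fun j _ => by rw [pd_mul m (hR j) (hw j)]; ring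
  have hVpd' : ∀ m, pd m (V k l m) x = pd m b x * (delta k m * u x l - w x m * G x k l)
      + b x * (delta k m * pd m (fun y => u y l) x - (pd m (fun y => w y m) x * G x k l
        + w x m * pd m (fun y => G y k l) x)) := by
    intro m
    have hu := h.smooth.diffAt hU hx l
    have hw := h.smoothUp.diffAt hU hx m
    have hg := hm.smooth.diffAt hU hx k l
    rw [hV, pd_mul (h := fun y => delta k m * u y l - w y m * G y k l) m hbd
      ((hu.const_mul _).fun_sub (hw.fun_mul hg)), pd_sub (f := fun y => delta k m * u y l) m
      (hu.const_mul _) (hw.fun_mul hg), pd_const_mul m _ hu, pd_mul m hw hg]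
  have hgpd : ∀ m, pd m (fun y => G y k l) x = ∑ p, christoffel G p m k x * G x p l
      + ∑ p, christoffel G p m l x * G x k p := by
    intro m
    have := congrFun (congrFun (hm.compat hx m) k) l
    simpa [pdM, Matrix.mul_apply, gam, mul_comm] using this
  have hexp : ∑ j, w x j * div4 G (riemann G) j k l x
      = ∑ m, (pd m (V k l m) x
        + ∑ p, (christoffel G m m p x * V k l p x - christoffel G p m k x * V p l m x
          - christoffel G p m l x * V k p m x)
        - f x * (riemann G m k l m x + u x m * V k l m x)) := by
    simp only [div4, Finset.mul_sum]
    rw [Finset.sum_comm]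
    refine Finset.sum_congr rfl fun m _ => ?_
    simp only [mul_add, Finset.sum_add_distrib, Finset.mul_sum]
    rw [hVpd, Finset.sum_comm (γ := Fin n)]
    have e1 : ∀ p, ∑ j, w x j * (christoffel G m m p x * riemann G j k l p x
          - christoffel G p m j x * riemann G p k l m x
          - christoffel G p m k x * riemann G j p l m x
          - christoffel G p m l x * riemann G j k p m x)
        = christoffel G m m p x * V k l p x
          - riemann G p k l m x * (∑ j, christoffel G p m j x * w x j)
          - christoffel G p m k x * V p l m x - christoffel G p m l x * V k p m x := by
      intro p
      rw [← hRV k l p x hx, ← hRV p l m x hx, ← hRV k p m x hx]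
      simp only [Finset.mul_sum, ← Finset.sum_sub_distrib]
      exact Finset.sum_congr rfl fun j _ => by ring
    have e2 : ∀ j, riemann G j k l m x * pd m (fun y => w y j) x
        = f x * (riemann G j k l m x * delta m j) + f x * (u x m * (riemann G j k l m x * w x j))
          - riemann G j k l m x * ∑ p, christoffel G j m p x * w x p := by
      intro j
      rw [h.sum_christoffel hx]; ring
    simp only [e1, e2, Finset.sum_add_distrib, Finset.sum_sub_distrib]
    simp only [← Finset.mul_sum, hRV k l m x hx, sum_mul_delta' (fun j => riemann G j k l m x)]
    ring
  rw [hexp]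
  have e3 : ∀ m, ∑ p, (christoffel G m m p x * V k l p x - christoffel G p m k x * V p l m x
          - christoffel G p m l x * V k p m x)
      = b x * (christoffel G m m k x * u x l - (∑ p, christoffel G m m p x * w x p) * G x k l
        - christoffel G m m k x * u x l + w x m * ∑ p, christoffel G p m k x * G x p l
        - delta k m * (∑ p, christoffel G p m l x * u x p)
        + w x m * ∑ p, christoffel G p m l x * G x k p) := by
    intro m
    have e : ∀ p, christoffel G m m p x * V k l p x - christoffel G p m k x * V p l m x
          - christoffel G p m l x * V k p m x
        = b x * (christoffel G m m p x * delta k p * u x l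
          - christoffel G m m p x * w x p * G x k l
          - christoffel G p m k x * delta p m * u x l
          + w x m * (christoffel G p m k x * G x p l)
          - delta k m * (christoffel G p m l x * u x p)
          + w x m * (christoffel G p m l x * G x k p)) := fun p => by
      simp only [hV]; ring
    simp only [e, ← Finset.mul_sum, Finset.sum_add_distrib, Finset.sum_sub_distrib]
    simp only [← Finset.sum_mul, sum_mul_delta' (fun p => christoffel G m m p x),
      sum_mul_delta (fun p => christoffel G p m k x)]
  have e4 : ∀ m, pd m (V k l m) x
        + ∑ p, (christoffel G m m p x * V k l p x - christoffel G p m k x * V p l m x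
          - christoffel G p m l x * V k p m x)
        - f x * (riemann G m k l m x + u x m * V k l m x)
      = ((n : ℝ) - 1)⁻¹ * u x l * (pd m ξ x * delta k m)
        - ((n : ℝ) - 1)⁻¹ * G x k l * (w x m * pd m ξ x)
        + b x * f x * (delta k m * (G x m l + u x m * u x l))
        - b x * f x * G x k l * (delta m m + w x m * u x m)
        - f x * riemann G m k l m x - f x * b x * u x l * (u x m * delta k m)
        + f x * b x * G x k l * (w x m * u x m) := by
    intro m
    -- All Christoffel symbols cancel here, as they must for the divergence of a tensor built from
    -- `u`, `g` and `ξ`.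
    rw [e3, hVpd', h.sum_christoffel hx, hgpd, h.pd_lower hx, hbpd]
    simp only [hV]
    ring
  have hric : ∑ m, riemann G m k l m x = - ricci G k l x := by simp [ricci]
  rw [Finset.sum_congr rfl fun m _ => e4 m]
  simp only [Finset.sum_add_distrib, Finset.sum_sub_distrib]
  simp only [← Finset.mul_sum, Finset.sum_add_distrib, h.unit x hx, hric, sum_delta_self,
    sum_mul_delta' (fun m => pd m ξ x), sum_mul_delta' (fun m => u x m),
    sum_delta_mul (fun m => G x m l + u x m * u x l), hb]
  field_simp
  ring

/-- Contraction with `u` of the condition that the Weyl tensor is divergence-free. -/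
lemma ricci_of_weylDiv (hn : 3 < n) (h : IsTorseOn G u w f ξ U) (hx : x ∈ U)
    (hW : ∀ j k l, weylDiv G j k l x = 0) :
    (∃ (a : ℝ) (Y : Fin n → ℝ), ∀ k l, f x * ricci G k l x = a * G x k l + Y k * u x l)
    ∧ ∃ (a : ℝ) (Y : Fin n → ℝ), ∀ k l, ∑ j, w x j * cov2 G (ric G) j x k l
      = a * G x k l + Y k * u x l := by
  have hn' : (4 : ℝ) ≤ n := by exact_mod_cast hn
  have hm := h.metric
  obtain ⟨X, hX⟩ := hm.weylDiv_eq hx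
  set D : Fin n → Fin n → ℝ := fun k l => ∑ j, w x j * cov2 G (ric G) j x k l with hD
  set L : Fin n → Fin n → ℝ := fun k l =>
    pd k ξ x * u x l - f x * ricci G k l x + ξ x * f x * G x k l with hL
  have hdiv : ∀ k l, ∑ j, w x j * div4 G (riemann G) j k l x = L k l - D k l := by
    intro k l
    simp only [hm.div4_riemann hx, mul_sub, Finset.sum_sub_distrib, h.cov2_ric_second hx, hL, hD]
  have h1 : ∀ k l, D k l = L k l - (f x * ricci G k l x
        - ((∑ m, w x m * pd m ξ x) / (n - 1) + ξ x * f x) * G x k l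
        + pd k ξ x / (n - 1) * u x l) := by
    intro k l
    rw [← h.div4_riemann_first (by omega) hx, hdiv]; ring
  set t := ∑ j, w x j * X j with ht
  -- By the contracted Bianchi identity, `L - D` is both the contracted divergence of Riemann and
  -- minus the Ricci part of the Weyl divergence. The factor `1 - 1/(n - 2) = (n - 3)/(n - 2)` is
  -- invertible because `n > 3`.
  have h2 : ∀ k l, (L k l - D k l) * (1 - ((n : ℝ) - 2)⁻¹) = X k * u x l - t * G x k l := by
    intro k l
    have e : ∑ j, w x j * weylDiv G j k l x = 0 := by simp [hW]
    have e1 : ∀ j, w x j * weylDiv G j k l x = w x j * div4 G (riemann G) j k l x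
        + ((n : ℝ) - 2)⁻¹ * (w x j * cov2 G (ric G) j x k l - w x j * cov2 G (ric G) k x j l)
        + (w x j * X j * G x k l - X k * (w x j * G x j l)) := fun j => by
      rw [hX]; ring
    simp only [e1, Finset.sum_add_distrib, ← Finset.mul_sum, Finset.sum_sub_distrib,
      ← Finset.sum_mul, hdiv, h.cov2_ric_second hx, h.sum_upper_mul_metric hx] at e
    simp only [hL, hD] at e ⊢
    linear_combination e
  have hne : ((n : ℝ) - 2) ≠ 0 := by linarith
  have hne3 : ((n : ℝ) - 3) ≠ 0 := by linarith
  have h3 : ∀ k l, L k l - D k l = (n - 2) / (n - 3) * (X k * u x l - t * G x k l) := by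
    intro k l
    rw [← h2]
    field_simp
    ring
  constructor
  · refine ⟨(∑ m, w x m * pd m ξ x) / (n - 1) + ξ x * f x - (n - 2) / (n - 3) * t,
      fun k => (n - 2) / (n - 3) * X k - pd k ξ x / (n - 1), fun k l => ?_⟩
    linear_combination h3 k l + h1 k l
  -- `D` is `L` minus `L - D`, and the term `φ R_{kl}` inside `L` is eliminated through `h1`.
  · refine ⟨(2 * (n - 2) / (n - 3) * t + ξ x * f x)
      - ((∑ m, w x m * pd m ξ x) / (n - 1) + ξ x * f x),
      fun k => pd k ξ x + pd k ξ x / (n - 1) - 2 * (n - 2) / (n - 3) * X k, fun k l => ?_⟩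
    have e1 := h3 k l
    have e2 := h1 k l
    change D k l = _
    simp only [hL] at e1 e2
    linear_combination -2 * e1 - e2

end IsTorseOn

end TorseCurvature

/-! ## The trace-free spatial part of the Ricci tensor -/

section SpatialRicci

variable {n : ℕ} {U : Set (EuclideanSpace ℝ (Fin n))} {x : EuclideanSpace ℝ (Fin n)}
  {G : Components n} {u w : EuclideanSpace ℝ (Fin n) → Fin n → ℝ}
  {f ξ : EuclideanSpace ℝ (Fin n) → ℝ}

/-- The coefficient of the metric in the perfect fluid part of the Ricci tensor. -/
def fluidCoeff (G : Components n) (ξ : EuclideanSpace ℝ (Fin n) → ℝ)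
    (y : EuclideanSpace ℝ (Fin n)) : ℝ := (scalarCurv G y - ξ y) * ((n : ℝ) - 1)⁻¹

/-- The part of the Ricci tensor which is trace-free and orthogonal to `u`. -/
def spatialRic (G : Components n) (u : EuclideanSpace ℝ (Fin n) → Fin n → ℝ)
    (ξ : EuclideanSpace ℝ (Fin n) → ℝ) : Components n := fun y =>
  ric G y - fluidCoeff G ξ y • G y
    - (fluidCoeff G ξ y - ξ y) • Matrix.vecMulVec (u y) (u y)

namespace IsTorseOn

lemma smooth_fluidCoeff (h : IsTorseOn G u w f ξ U) : ContDiffOn ℝ ∞ (fluidCoeff G ξ) U :=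
  (h.metric.smooth_scalarCurv.sub h.smooth_eigenvalue).mul contDiffOn_const

lemma smoothM_vecMulVec (h : IsTorseOn G u w f ξ U) :
    SmoothM (fun y => Matrix.vecMulVec (u y) (u y)) U :=
  fun k l => (h.smooth k).mul (h.smooth l)

lemma smoothM_spatialRic (h : IsTorseOn G u w f ξ U) : SmoothM (spatialRic G u ξ) U :=
  (h.metric.smoothM_ric.sub (SmoothM.smul h.smooth_fluidCoeff h.metric.smooth)).sub
    (SmoothM.smul (h.smooth_fluidCoeff.sub h.smooth_eigenvalue) h.smoothM_vecMulVec)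

lemma vecMulVec_mulVec_upper (h : IsTorseOn G u w f ξ U) (hx : x ∈ U) :
    Matrix.vecMulVec (u x) (u x) *ᵥ w x = - u x := by
  ext k
  have e : ∀ l, u x k * u x l * w x l = u x k * (w x l * u x l) := fun l => by ring
  simp only [Matrix.mulVec, dotProduct, Matrix.vecMulVec_apply, e, ← Finset.mul_sum,
    h.unit x hx, Pi.neg_apply]
  ring

lemma spatialRic_mulVec (h : IsTorseOn G u w f ξ U) (hx : x ∈ U) :
    spatialRic G u ξ x *ᵥ w x = 0 := by
  simp only [spatialRic, Matrix.sub_mulVec, Matrix.smul_mulVec, h.ric_mulVec hx,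
    ← h.lower x hx, h.vecMulVec_mulVec_upper hx]
  module

lemma trace_inv_mul_vecMulVec (h : IsTorseOn G u w f ξ U) (hx : x ∈ U) :
    ((G x)⁻¹ * Matrix.vecMulVec (u x) (u x)).trace = -1 := by
  have e : (G x)⁻¹ *ᵥ u x = w x := by
    rw [h.lower x hx, Matrix.mulVec_mulVec, h.metric.inv_mul hx, Matrix.one_mulVec]
  rw [Matrix.mul_vecMulVec, e, Matrix.trace_vecMulVec]
  exact h.unit x hx

lemma trace_inv_mul_metric (h : IsTorseOn G u w f ξ U) (hx : x ∈ U) :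
    ((G x)⁻¹ * G x).trace = n := by
  rw [h.metric.inv_mul hx, Matrix.trace_one, Fintype.card_fin]

lemma trace_spatialRic (hn : 3 ≤ n) (h : IsTorseOn G u w f ξ U) (hx : x ∈ U) :
    ((G x)⁻¹ * spatialRic G u ξ x).trace = 0 := by
  have hn' : (3 : ℝ) ≤ n := by exact_mod_cast hn
  have hn1 : (n : ℝ) - 1 ≠ 0 := by linarith
  have e : ((G x)⁻¹ * ric G x).trace = scalarCurv G x := by
    simp only [Matrix.trace, Matrix.diag, Matrix.mul_apply, scalarCurv, ric, Matrix.of_apply]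
    exact Finset.sum_congr rfl fun k _ => Finset.sum_congr rfl fun l _ => by
      rw [h.metric.ricci_symm hx]
  simp only [spatialRic, mul_sub, mul_smul_comm, Matrix.trace_sub, Matrix.trace_smul, e,
    h.trace_inv_mul_metric hx, h.trace_inv_mul_vecMulVec hx, smul_eq_mul, fluidCoeff]
  field_simp
  ring

lemma spatialRic_symm (h : IsTorseOn G u w f ξ U) (hx : x ∈ U) (k l : Fin n) :
    spatialRic G u ξ x k l = spatialRic G u ξ x l k := by
  simp only [spatialRic, Matrix.sub_apply, Matrix.smul_apply, ric, Matrix.of_apply,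
    Matrix.vecMulVec_apply, smul_eq_mul, h.metric.ricci_symm hx k l, h.metric.symm x hx k l]
  ring

/-- A symmetric tensor of the form `a g_{kl} + Y_k u_l` is `a g_{kl} + b u_k u_l`. -/
lemma eq_of_symm (h : IsTorseOn G u w f ξ U) (hx : x ∈ U) {S : Matrix (Fin n) (Fin n) ℝ}
    (hS : ∀ k l, S k l = S l k) {a : ℝ} {Y : Fin n → ℝ}
    (hY : ∀ k l, S k l = a * G x k l + Y k * u x l) :
    ∃ b : ℝ, S = a • G x + b • Matrix.vecMulVec (u x) (u x) := by
  refine ⟨-∑ l, w x l * Y l, ?_⟩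
  have h1 : ∀ k l, Y k * u x l = Y l * u x k := fun k l => by
    have := hS k l
    rw [hY, hY, h.metric.symm x hx k l] at this
    linarith
  have h2 : ∀ k, Y k = -(∑ l, w x l * Y l) * u x k := by
    intro k
    have e1 : ∑ l, w x l * (Y k * u x l) = ∑ l, w x l * (Y l * u x k) :=
      Finset.sum_congr rfl fun l _ => by rw [h1]
    have e2 : ∀ l, w x l * (Y k * u x l) = Y k * (w x l * u x l) := fun l => by ring
    have e3 : ∀ l, w x l * (Y l * u x k) = w x l * Y l * u x k := fun l => by ring
    simp only [e2, e3, ← Finset.mul_sum, ← Finset.sum_mul, h.unit x hx] at e1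
    linarith
  ext k l
  rw [hY, h2 k, Matrix.add_apply, Matrix.smul_apply, Matrix.smul_apply, Matrix.vecMulVec_apply,
    smul_eq_mul, smul_eq_mul]
  ring

/-- Annihilating `u` forces `a = b`, so `S = a (g + u ⊗ u)`, whose trace is `(n - 1) a`. -/
lemma eq_zero_of_eq (hn : 3 ≤ n) (h : IsTorseOn G u w f ξ U) (hx : x ∈ U)
    {S : Matrix (Fin n) (Fin n) ℝ} {a b : ℝ}
    (hS : S = a • G x + b • Matrix.vecMulVec (u x) (u x)) (hw : S *ᵥ w x = 0)
    (ht : ((G x)⁻¹ * S).trace = 0) : S = 0 := by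
  have hn' : (3 : ℝ) ≤ n := by exact_mod_cast hn
  rw [hS, mul_add, mul_smul_comm, mul_smul_comm, Matrix.trace_add, Matrix.trace_smul,
    Matrix.trace_smul, h.trace_inv_mul_metric hx, h.trace_inv_mul_vecMulVec hx, smul_eq_mul,
    smul_eq_mul] at ht
  rw [hS, Matrix.add_mulVec, Matrix.smul_mulVec, Matrix.smul_mulVec, ← h.lower x hx,
    h.vecMulVec_mulVec_upper hx] at hw
  have hab : a = b := by
    have e : ∀ l, w x l * (a • u x + b • -u x) l = (a - b) * (w x l * u x l) := fun l => by
      simp only [Pi.add_apply, Pi.smul_apply, Pi.neg_apply, smul_eq_mul]; ring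
    have h1 : ∑ l, w x l * (a • u x + b • -u x) l = 0 := by rw [hw]; simp
    simp only [e, ← Finset.mul_sum, h.unit x hx] at h1
    linarith
  have ha : a * ((n : ℝ) - 1) = 0 := by rw [← hab] at ht; linarith
  have ha0 : a = 0 := (mul_eq_zero.1 ha).resolve_right (by linarith)
  rw [hS, ← hab, ha0]
  simp

/-- This criterion leaves `a` and `Y` free: it is visibly tensorial, which serves for changing
charts, and it is the form in which `ricci_of_weylDiv` delivers the Ricci tensor. -/
lemma spatialRic_eq_zero_iff (hn : 3 ≤ n) (h : IsTorseOn G u w f ξ U) (hx : x ∈ U) :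
    spatialRic G u ξ x = 0
      ↔ ∃ (a : ℝ) (Y : Fin n → ℝ), ∀ k l, ricci G k l x = a * G x k l + Y k * u x l := by
  constructor
  · intro h0
    refine ⟨fluidCoeff G ξ x, fun k => (fluidCoeff G ξ x - ξ x) * u x k, fun k l => ?_⟩
    have := congrFun (congrFun h0 k) l
    simp only [spatialRic, Matrix.sub_apply, Matrix.smul_apply, ric, Matrix.of_apply,
      Matrix.vecMulVec_apply, smul_eq_mul, Matrix.zero_apply] at this
    linarith
  · rintro ⟨a, Y, hY⟩
    have h1 : ∀ k l, spatialRic G u ξ x k l = (a - fluidCoeff G ξ x) * G x k l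
        + (Y k - (fluidCoeff G ξ x - ξ x) * u x k) * u x l := by
      intro k l
      simp only [spatialRic, Matrix.sub_apply, Matrix.smul_apply, ric, Matrix.of_apply,
        Matrix.vecMulVec_apply, smul_eq_mul, hY]
      ring
    obtain ⟨b, hb⟩ := h.eq_of_symm hx (h.spatialRic_symm hx) h1
    exact h.eq_zero_of_eq hn hx hb (h.spatialRic_mulVec hx) (h.trace_spatialRic hn hx)

lemma spatialRic_eq_zero_of_ne (hn : 3 < n) (h : IsTorseOn G u w f ξ U) (hx : x ∈ U)
    (hW : ∀ j k l, weylDiv G j k l x = 0) (hf : f x ≠ 0) : spatialRic G u ξ x = 0 := by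
  obtain ⟨a, Y, hY⟩ := (h.ricci_of_weylDiv hn hx hW).1
  refine (h.spatialRic_eq_zero_iff hn.le hx).2 ⟨a / f x, fun k => Y k / f x, fun k l => ?_⟩
  field_simp
  linarith [hY k l]

/-- If the Weyl tensor is divergence-free, the trace-free spatial part of the Ricci tensor is
covariantly constant along `u`. -/
lemma sum_cov2_spatialRic (hn : 3 < n) (h : IsTorseOn G u w f ξ U) (hx : x ∈ U)
    (hW : ∀ j k l, weylDiv G j k l x = 0) :
    ∑ i, w x i • cov2 G (spatialRic G u ξ) i x = 0 := by
  have hm := h.metric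
  have hU := h.isOpen
  obtain ⟨a, Y, hY⟩ := (h.ricci_of_weylDiv hn hx hW).2
  set S := ∑ i, w x i • cov2 G (spatialRic G u ξ) i x with hS
  have hSapp : ∀ k l, S k l = ∑ i, w x i * cov2 G (spatialRic G u ξ) i x k l := fun k l => by
    simp [hS, Matrix.sum_apply]
  have huu : ∀ i k l, cov2 G (fun y => Matrix.vecMulVec (u y) (u y)) i x k l
      = f x * (G x i k + u x i * u x k) * u x l + u x k * (f x * (G x i l + u x i * u x l)) := by
    intro i k l
    have e : pd i (fun y => Matrix.vecMulVec (u y) (u y) k l) x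
        = pd i (fun y => u y k) x * u x l + u x k * pd i (fun y => u y l) x :=
      pd_mul i (h.smooth.diffAt hU hx k) (h.smooth.diffAt hU hx l)
    rw [cov2_apply, e, h.pd_lower hx, h.pd_lower hx]
    simp only [Matrix.vecMulVec_apply, ← mul_assoc, ← Finset.sum_mul]
    have e2 : ∑ p, christoffel G p i l x * u x k * u x p
        = u x k * ∑ p, christoffel G p i l x * u x p := by
      rw [Finset.mul_sum]; exact Finset.sum_congr rfl fun _ _ => by ring
    rw [e2]
    ring
  have hE : ∀ i k l, cov2 G (spatialRic G u ξ) i x k l = cov2 G (ric G) i x k l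
      - pd i (fluidCoeff G ξ) x * G x k l
      - (pd i (fun y => fluidCoeff G ξ y - ξ y) x * (u x k * u x l)
        + (fluidCoeff G ξ x - ξ x) * (f x * (G x i k + u x i * u x k) * u x l
          + u x k * (f x * (G x i l + u x i * u x l)))) := by
    intro i k l
    have e1 : cov2 G (spatialRic G u ξ) i x = cov2 G (ric G) i x
        - (pd i (fluidCoeff G ξ) x • G x + fluidCoeff G ξ x • cov2 G G i x)
        - (pd i (fun y => fluidCoeff G ξ y - ξ y) x • Matrix.vecMulVec (u x) (u x)
          + (fluidCoeff G ξ x - ξ x) • cov2 G (fun y => Matrix.vecMulVec (u y) (u y)) i x) := by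
      unfold spatialRic
      rw [cov2_sub hU (hm.smoothM_ric.sub (SmoothM.smul h.smooth_fluidCoeff hm.smooth))
        (SmoothM.smul (h.smooth_fluidCoeff.sub h.smooth_eigenvalue) h.smoothM_vecMulVec) hx,
        cov2_sub hU hm.smoothM_ric (SmoothM.smul h.smooth_fluidCoeff hm.smooth) hx,
        cov2_smul hU h.smooth_fluidCoeff hm.smooth hx,
        cov2_smul hU (h.smooth_fluidCoeff.sub h.smooth_eigenvalue) h.smoothM_vecMulVec hx]
    rw [e1, cov2_metric hm hx]
    simp only [Matrix.sub_apply, Matrix.add_apply, Matrix.smul_apply, smul_eq_mul, huu,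
      Matrix.vecMulVec_apply, Matrix.zero_apply]
    ring
  -- Because `u^i ∇_i u_k = φ (u_k - u_k) = 0`, differentiating the perfect fluid part along `u`
  -- produces only multiples of `g` and `u ⊗ u`.
  have hform : ∀ k l, S k l = (a - ∑ i, w x i * pd i (fluidCoeff G ξ) x) * G x k l
      + (Y k - (∑ i, w x i * pd i (fun y => fluidCoeff G ξ y - ξ y) x) * u x k) * u x l := by
    intro k l
    have e : ∀ i, w x i * cov2 G (spatialRic G u ξ) i x k l
        = w x i * cov2 G (ric G) i x k l - w x i * pd i (fluidCoeff G ξ) x * G x k l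
          - w x i * pd i (fun y => fluidCoeff G ξ y - ξ y) x * (u x k * u x l)
          - (fluidCoeff G ξ x - ξ x) * f x * u x l
            * (w x i * G x i k + (w x i * u x i) * u x k)
          - (fluidCoeff G ξ x - ξ x) * f x * u x k
            * (w x i * G x i l + (w x i * u x i) * u x l) := fun i => by
      rw [hE]; ring
    rw [hSapp]
    simp only [e, Finset.sum_sub_distrib, ← Finset.mul_sum, ← Finset.sum_mul,
      Finset.sum_add_distrib, hY, h.sum_upper_mul_metric hx, h.unit x hx]
    ring
  have hsymm : ∀ k l, S k l = S l k := by
    intro k l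
    rw [hSapp, hSapp]
    exact Finset.sum_congr rfl fun i _ => by
      rw [cov2_symm hU (fun y hy => h.spatialRic_symm hy) hx]
  obtain ⟨b, hb⟩ := h.eq_of_symm hx hsymm hform
  -- Differentiating `E u = 0` gives `(u^i ∇_i E) u = -φ E u = 0`, and the trace of `∇_i E` is the
  -- derivative of the zero trace of `E`.
  refine h.eq_zero_of_eq hn.le hx hb ?_ ?_
  · have e : ∀ i, cov2 G (spatialRic G u ξ) i x *ᵥ w x
        = -f x • (spatialRic G u ξ x *ᵥ Pi.single i 1) := by
      intro i
      have h0 : pdV i (fun _ => (0 : Fin n → ℝ)) x = 0 := by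
        ext m; exact pd_const i _
      rw [h.cov2_mulVec_upper h.smoothM_spatialRic (v := fun _ => 0)
        (fun y hy => h.spatialRic_mulVec hy) hx, h0]
      simp
    have e2 : ∑ i, w x i • (Pi.single i 1 : Fin n → ℝ) = w x := by
      ext m; simp [Pi.single_apply]
    rw [hS, Matrix.sum_mulVec]
    simp only [Matrix.smul_mulVec, e, smul_comm (w x _), ← Matrix.mulVec_smul]
    rw [← Matrix.mulVec_sum, ← Finset.smul_sum, e2, Matrix.mulVec_smul, h.spatialRic_mulVec hx,
      smul_zero]
  · have e : ∀ i, ((G x)⁻¹ * cov2 G (spatialRic G u ξ) i x).trace = 0 := by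
      intro i
      rw [trace_cov2 hm h.smoothM_spatialRic hx,
        pd_congr i hU hx (h := fun _ => 0) fun y hy => h.trace_spatialRic hn.le hy, pd_const]
    rw [hS, Finset.mul_sum, Matrix.trace_sum]
    simp only [mul_smul_comm, Matrix.trace_smul, e, smul_zero, Finset.sum_const_zero]

/-- The transport equation for the trace-free spatial part of the Ricci tensor. -/
lemma sum_pd_spatialRic (hn : 3 < n) (h : IsTorseOn G u w f ξ U) (hx : x ∈ U)
    (hW : ∀ j k l, weylDiv G j k l x = 0) (k l : Fin n) :
    ∑ i, w x i * pd i (fun y => spatialRic G u ξ y k l) x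
      = ∑ p, (∑ i, w x i * christoffel G p i k x) * spatialRic G u ξ x p l
        + ∑ p, (∑ i, w x i * christoffel G p i l x) * spatialRic G u ξ x k p := by
  have h1 := congrFun (congrFun (h.sum_cov2_spatialRic hn hx hW) k) l
  simp only [Matrix.sum_apply, Matrix.smul_apply, smul_eq_mul, cov2_apply, mul_sub,
    Finset.sum_sub_distrib, Matrix.zero_apply, Finset.mul_sum, ← mul_assoc] at h1
  rw [Finset.sum_comm (f := fun i p => w x i * christoffel G p i k x * spatialRic G u ξ x p l),
    Finset.sum_comm (f := fun i p => w x i * christoffel G p i l x * spatialRic G u ξ x k p)]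
    at h1
  simp only [Finset.sum_mul]
  linarith

/-- The contraction `u_m C_{jkl}{}^m` vanishes if the Ricci tensor has the perfect fluid form. -/
lemma weyl_lower_fourth (hn : 3 ≤ n) (h : IsTorseOn G u w f ξ U) (hx : x ∈ U)
    (h0 : spatialRic G u ξ x = 0) (j k l : Fin n) : ∑ m, weyl G j k l m x * u x m = 0 := by
  have hn' : (3 : ℝ) ≤ n := by exact_mod_cast hn
  have h2 : (n : ℝ) - 2 ≠ 0 := by linarith
  have h1 : (n : ℝ) - 1 ≠ 0 := by linarith
  have hm := h.metric
  have hric : ∀ k l, ricci G k l x = fluidCoeff G ξ x * G x k l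
      + (fluidCoeff G ξ x - ξ x) * (u x k * u x l) := by
    intro k l
    have := congrFun (congrFun h0 k) l
    simp only [spatialRic, Matrix.sub_apply, Matrix.smul_apply, ric, Matrix.of_apply,
      Matrix.vecMulVec_apply, smul_eq_mul, Matrix.zero_apply] at this
    linarith
  have hup : ∀ j, ∑ m, ricciUp G j m x * u x m = ξ x * u x j := by
    intro j
    have e1 : (fun m => ricciUp G j m x) = (ric G x * (G x)⁻¹) j := rfl
    have e2 : ((ric G x * (G x)⁻¹) *ᵥ u x) j = ξ x * u x j := by
      rw [← Matrix.mulVec_mulVec, h.lower x hx, Matrix.mulVec_mulVec (w x), hm.inv_mul hx,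
        Matrix.one_mulVec, h.ric_mulVec hx, ← h.lower x hx]
      rfl
    exact e2
  have e : ∀ m, weyl G j k l m x * u x m = riemann G j k l m x * u x m
      + (delta j m * u x m * ricci G k l x - delta k m * u x m * ricci G j l x
        + ricciUp G j m x * u x m * G x k l - ricciUp G k m x * u x m * G x j l)
        * ((n : ℝ) - 2)⁻¹
      - (delta j m * u x m * G x k l - delta k m * u x m * G x j l)
        * (scalarCurv G x / (((n : ℝ) - 1) * ((n : ℝ) - 2))) := fun m => by
    rw [weyl]; ring
  -- Every term is a multiple of `u_j g_{kl} - u_k g_{jl}`; the Ricci and scalar terms contribute `ξ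
  -- / (n - 1)`, the Riemann term its negative.
  simp only [e, Finset.sum_add_distrib, Finset.sum_sub_distrib, ← Finset.sum_mul, hup,
    sum_delta_mul (fun m => u x m), h.riemann_lower_fourth hn hx, hric, fluidCoeff]
  field_simp
  ring

end IsTorseOn

end SpatialRicci

/-! ## Uniqueness for the linear transport equation -/

section Transport

variable {n : ℕ}

/-- The right-hand side of the transport equation for `(0,2)`-tensors. -/
def transportField (B : ℝ → Fin n → Fin n → ℝ) (t : ℝ) (E : Fin n → Fin n → ℝ) :
    Fin n → Fin n → ℝ :=
  fun k l => ∑ p, B t p k * E p l + ∑ p, B t p l * E k p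

lemma lipschitzOnWith_transportField {B : ℝ → Fin n → Fin n → ℝ} {t C : ℝ} (hC : 0 ≤ C)
    (hB : ∀ p k, |B t p k| ≤ C) :
    LipschitzOnWith (Real.toNNReal (2 * n * C)) (transportField B t) Set.univ := by
  refine LipschitzOnWith.of_dist_le_mul fun E _ E' _ => ?_
  rw [Real.coe_toNNReal _ (by positivity)]
  have hnn : 0 ≤ 2 * n * C * dist E E' := by positivity
  have hE : ∀ p l, |E p l - E' p l| ≤ dist E E' := fun p l => by
    rw [← Real.dist_eq]
    exact (dist_le_pi_dist (E p) (E' p) l).trans (dist_le_pi_dist E E' p)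
  refine (dist_pi_le_iff hnn).2 fun k => (dist_pi_le_iff hnn).2 fun l => ?_
  rw [Real.dist_eq]
  have e : transportField B t E k l - transportField B t E' k l
      = ∑ p, B t p k * (E p l - E' p l) + ∑ p, B t p l * (E k p - E' k p) := by
    simp only [transportField, mul_sub, Finset.sum_sub_distrib]; ring
  have hsum : ∀ (a c : Fin n → ℝ), (∀ p, |a p| ≤ C) → (∀ p, |c p| ≤ dist E E') →
      |∑ p, a p * c p| ≤ n * C * dist E E' := by
    intro a c ha hc
    calc |∑ p, a p * c p| ≤ ∑ p, |a p * c p| := Finset.abs_sum_le_sum_abs _ _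
      _ ≤ ∑ _p : Fin n, C * dist E E' := Finset.sum_le_sum fun p _ => by
          rw [abs_mul]; exact mul_le_mul (ha p) (hc p) (abs_nonneg _) hC
      _ = n * C * dist E E' := by simp [mul_assoc]
  rw [e]
  calc _ ≤ |∑ p, B t p k * (E p l - E' p l)| + |∑ p, B t p l * (E k p - E' k p)| :=
        abs_add_le _ _
    _ ≤ n * C * dist E E' + n * C * dist E E' :=
        add_le_add (hsum _ _ (fun p => hB p k) fun p => hE p l)
          (hsum _ _ (fun p => hB p l) fun p => hE k p)
    _ = _ := by ring

/-- Uniqueness compares `E` with the zero solution. The coefficients need only be continuous on the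
open interval, so the argument runs on a compact subinterval around both times, where they are
bounded and the field is Lipschitz. -/
lemma transport_eq_zero {B : ℝ → Fin n → Fin n → ℝ} {E : ℝ → Fin n → Fin n → ℝ} {a b : ℝ}
    (hB : ∀ p k, ContinuousOn (fun t => B t p k) (Set.Ioo a b))
    (hE : ∀ t ∈ Set.Ioo a b, ∀ k l,
      HasDerivAt (fun t => E t k l) (transportField B t (E t) k l) t)
    {t₀ t₁ : ℝ} (h₀ : t₀ ∈ Set.Ioo a b) (h₁ : t₁ ∈ Set.Ioo a b) (h : E t₀ = 0) : E t₁ = 0 := by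
  obtain ⟨a', ha, ha'⟩ := exists_between (lt_min h₀.1 h₁.1)
  obtain ⟨b', hb', hb⟩ := exists_between (max_lt h₀.2 h₁.2)
  rw [lt_min_iff] at ha'
  rw [max_lt_iff] at hb'
  have hsub : Set.Icc a' b' ⊆ Set.Ioo a b := fun t ht => ⟨ha.trans_le ht.1, ht.2.trans_lt hb⟩
  have hbd : ∃ C : ℝ, 0 ≤ C ∧ ∀ t ∈ Set.Icc a' b', ∀ p k, |B t p k| ≤ C := by
    have hcont : ContinuousOn B (Set.Icc a' b') :=
      continuousOn_pi.2 fun p => continuousOn_pi.2 fun k => (hB p k).mono hsub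
    obtain ⟨C, hC⟩ := isCompact_Icc.exists_bound_of_continuousOn hcont
    refine ⟨C, (norm_nonneg _).trans (hC a' ⟨le_rfl, (ha'.1.trans hb'.1).le⟩),
      fun t ht p k => ?_⟩
    exact ((norm_le_pi_norm (B t p) k).trans (norm_le_pi_norm (B t) p)).trans (hC t ht)
  obtain ⟨C, hC0, hC⟩ := hbd
  have huniq := ODE_solution_unique_of_mem_Ioo (v := transportField B) (s := fun _ => Set.univ)
    (a := a') (b := b') (t₀ := t₀) (f := E) (g := fun _ => 0)
    (fun t ht => lipschitzOnWith_transportField hC0 (hC t (Set.Ioo_subset_Icc_self ht)))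
    ⟨ha'.1, hb'.1⟩
    (fun t ht => ⟨hasDerivAt_pi.2 fun k => hasDerivAt_pi.2 fun l =>
      hE t (hsub (Set.Ioo_subset_Icc_self ht)) k l, trivial⟩)
    (fun t _ => ⟨by
      have : transportField B t 0 = 0 := by ext k l; simp [transportField]
      rw [this]; exact hasDerivAt_const _ _, trivial⟩) h
  exact huniq ⟨ha'.2, hb'.2⟩

end Transport

/-! ## Components of tensor fields in a chart -/

section Charts

variable {n : ℕ} {M : Type*} [TopologicalSpace M] [ChartedSpace (EuclideanSpace ℝ (Fin n)) M]
  [IsManifold (𝓡 n) ∞ M] {e e' : OpenPartialHomeomorph M (EuclideanSpace ℝ (Fin n))}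
  {x : EuclideanSpace ℝ (Fin n)}

lemma IsCoord.contMDiffOn (he : IsCoord (M := M) e) :
    ContMDiffOn (𝓡 n) (𝓡 n) ∞ e e.source := contMDiffOn_of_mem_maximalAtlas he

lemma IsCoord.contMDiffOn_symm (he : IsCoord (M := M) e) :
    ContMDiffOn (𝓡 n) (𝓡 n) ∞ e.symm e.target := contMDiffOn_symm_of_mem_maximalAtlas he

lemma IsCoord.mdifferentiable (he : IsCoord (M := M) e) : e.MDifferentiable (𝓡 n) (𝓡 n) :=
  ⟨he.contMDiffOn.mdifferentiableOn (by simp), he.contMDiffOn_symm.mdifferentiableOn (by simp)⟩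

/-- The components of a tangent vector at `p` in the chart `e`. -/
def comp (e : OpenPartialHomeomorph M (EuclideanSpace ℝ (Fin n))) (p : M)
    (v : TangentSpace (𝓡 n) p) (a : Fin n) : ℝ :=
  (show EuclideanSpace ℝ (Fin n) from mfderiv (𝓡 n) (𝓡 n) e p v) a

lemma upper_eq_comp (v : (p : M) → TangentSpace (𝓡 n) p) (i : Fin n) :
    upper v e x i = comp e (e.symm x) (v (e.symm x)) i := rfl

lemma clm_apply_eq_sum {F : Type*} [TopologicalSpace F] [AddCommGroup F] [Module ℝ F]
    (L : EuclideanSpace ℝ (Fin n) →L[ℝ] F) (v : EuclideanSpace ℝ (Fin n)) :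
    L v = ∑ i, v i • L (EuclideanSpace.single i 1) := by
  have hv : v = ∑ i, v i • EuclideanSpace.single i (1 : ℝ) := by
    ext j
    simp [Pi.single_apply]
  conv_lhs => rw [hv]
  simp only [map_sum, map_smul]

lemma IsCoord.eq_sum_coordVec (he : IsCoord (M := M) e) (hx : x ∈ e.target)
    (v : TangentSpace (𝓡 n) (e.symm x)) :
    v = ∑ i, comp e (e.symm x) v i • coordVec e i x := by
  have h1 := he.mdifferentiable.symm_comp_deriv (e.map_target hx)
  rw [e.right_inv hx] at h1
  have h2 : mfderiv (𝓡 n) (𝓡 n) e.symm x (mfderiv (𝓡 n) (𝓡 n) e (e.symm x) v) = v :=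
    congrFun (congrArg DFunLike.coe h1) v
  have h3 := clm_apply_eq_sum (F := TangentSpace (𝓡 n) (e.symm x))
    (mfderiv (𝓡 n) (𝓡 n) e.symm x) (mfderiv (𝓡 n) (𝓡 n) e (e.symm x) v)
  exact h2.symm.trans h3

lemma IsCoord.comp_sum_coordVec (he : IsCoord (M := M) e) (hx : x ∈ e.target) (c : Fin n → ℝ)
    (j : Fin n) : comp e (e.symm x) (∑ i, c i • coordVec e i x) j = c j := by
  have h1 := he.mdifferentiable.comp_symm_deriv hx
  have h2 : ∀ i, mfderiv (𝓡 n) (𝓡 n) e (e.symm x) (coordVec e i x)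
      = EuclideanSpace.single i (1 : ℝ) := fun i =>
    congrFun (congrArg DFunLike.coe h1) (EuclideanSpace.single i (1 : ℝ))
  unfold comp
  rw [map_sum]
  simp only [map_smul, h2]
  change (∑ i, c i • EuclideanSpace.single i (1 : ℝ) : EuclideanSpace ℝ (Fin n)) j = c j
  simp [Pi.single_apply]

namespace LorentzMetric

variable (g : LorentzMetric n M)

lemma val_eq_sum (he : IsCoord (M := M) e) (hx : x ∈ e.target)
    (v v' : TangentSpace (𝓡 n) (e.symm x)) :
    g.val (e.symm x) v v' = ∑ a, ∑ b, comp e (e.symm x) v a * comp e (e.symm x) v' b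
      * g.coord e x a b := by
  conv_lhs => rw [he.eq_sum_coordVec hx v, he.eq_sum_coordVec hx v']
  simp only [map_sum, map_smul, sum_apply, smul_apply,
    smul_eq_mul, Finset.mul_sum]
  rw [Finset.sum_comm]
  refine Finset.sum_congr rfl fun a _ => Finset.sum_congr rfl fun b _ => ?_
  simp only [coord, Matrix.of_apply]
  ring

lemma val_eq_sum_lower (he : IsCoord (M := M) e) (hx : x ∈ e.target)
    (u : (p : M) → TangentSpace (𝓡 n) p) (v : TangentSpace (𝓡 n) (e.symm x)) :
    g.val (e.symm x) v (u (e.symm x)) = ∑ a, comp e (e.symm x) v a * g.lower u e x a := by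
  conv_lhs => rw [he.eq_sum_coordVec hx v]
  simp only [map_sum, map_smul, sum_apply, smul_apply,
    smul_eq_mul]
  rfl

lemma lower_eq (he : IsCoord (M := M) e) (hx : x ∈ e.target)
    (u : (p : M) → TangentSpace (𝓡 n) p) :
    g.lower u e x = g.coord e x *ᵥ upper u e x := by
  ext i
  unfold lower
  conv_lhs => rw [he.eq_sum_coordVec hx (u (e.symm x))]
  simp only [map_sum, map_smul, smul_eq_mul, Matrix.mulVec, dotProduct]
  exact Finset.sum_congr rfl fun j _ => mul_comm _ _

lemma coord_symm (x : EuclideanSpace ℝ (Fin n)) (i j : Fin n) :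
    g.coord e x i j = g.coord e x j i := g.symm _ _ _

/-- A kernel vector would be orthogonal to every vector: to the time-like one, so the signature
gives it positive square, and to itself. -/
lemma coord_det (he : IsCoord (M := M) e) (hx : x ∈ e.target) : IsUnit (g.coord e x).det := by
  rw [isUnit_iff_ne_zero]
  intro hdet
  obtain ⟨c, hc, hmul⟩ := Matrix.exists_mulVec_eq_zero_iff.2 hdet
  set v : TangentSpace (𝓡 n) (e.symm x) := ∑ i, c i • coordVec e i x with hv
  have hcomp : ∀ j, comp e (e.symm x) v j = c j := he.comp_sum_coordVec hx c
  have h0 : ∀ w, g.val (e.symm x) w v = 0 := by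
    intro w
    rw [g.val_eq_sum he hx]
    refine Finset.sum_eq_zero fun a _ => ?_
    have := congrFun hmul a
    simp only [Matrix.mulVec, dotProduct, Pi.zero_apply] at this
    calc _ = comp e (e.symm x) w a * ∑ b, g.coord e x a b * c b := by
          rw [Finset.mul_sum]
          exact Finset.sum_congr rfl fun b _ => by rw [hcomp]; ring
      _ = 0 := by rw [this, mul_zero]
  obtain ⟨t, -, ht⟩ := g.signature (e.symm x)
  by_cases hv0 : v = 0
  · apply hc
    ext j
    rw [← hcomp j, hv0]
    simp only [comp, map_zero]
    rfl
  · exact absurd (h0 v) (ht v hv0 (h0 t)).ne'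

end LorentzMetric

/-- The coordinate field is the tangent map of `e.symm` applied to a constant section. -/
lemma IsCoord.contMDiffOn_coordVec (he : IsCoord (M := M) e) (i : Fin n) :
    ContMDiffOn (𝓡 n) (𝓡 n).tangent ∞
      (fun x => (⟨e.symm x, coordVec e i x⟩ : TangentBundle (𝓡 n) M)) e.target := by
  have hu : UniqueMDiffOn (𝓡 n) e.target := e.open_target.uniqueMDiffOn
  have h1 := he.contMDiffOn_symm.contMDiffOn_tangentMapWithin (m := ∞) (by simp) hu
  have h2 : ContMDiff (𝓡 n) (𝓡 n).tangent ∞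
      (fun x : EuclideanSpace ℝ (Fin n) =>
        (⟨x, (show TangentSpace (𝓡 n) x from EuclideanSpace.single i (1 : ℝ))⟩ :
          TangentBundle (𝓡 n) (EuclideanSpace ℝ (Fin n)))) := by
    intro y
    rw [Bundle.contMDiffAt_totalSpace]
    refine ⟨contMDiffAt_id, ?_⟩
    simpa using contMDiffAt_const
  refine (h1.comp h2.contMDiffOn fun y hy => hy).congr fun y hy => ?_
  simp only [Function.comp, tangentMapWithin, coordVec]
  rw [mfderivWithin_of_isOpen e.open_target hy]

namespace LorentzMetric

variable (g : LorentzMetric n M)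

/-- Vector fields along a map `b` are allowed, which covers both the components of the metric and
those of `u` in a chart. -/
lemma contDiffOn_val {s : Set (EuclideanSpace ℝ (Fin n))}
    {b : EuclideanSpace ℝ (Fin n) → M} {v v' : (x : EuclideanSpace ℝ (Fin n)) →
      TangentSpace (𝓡 n) (b x)}
    (hb : ContMDiffOn (𝓡 n) (𝓡 n) ∞ b s)
    (hv : ContMDiffOn (𝓡 n) (𝓡 n).tangent ∞
      (fun x => (⟨b x, v x⟩ : TangentBundle (𝓡 n) M)) s)
    (hv' : ContMDiffOn (𝓡 n) (𝓡 n).tangent ∞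
      (fun x => (⟨b x, v' x⟩ : TangentBundle (𝓡 n) M)) s) :
    ContDiffOn ℝ ∞ (fun x => g.val (b x) (v x) (v' x)) s := by
  rw [← contMDiffOn_iff_contDiffOn]
  intro x hx
  have : ContMDiffWithinAt (𝓡 n) ((𝓡 n).prod 𝓘(ℝ)) ∞
      (fun m ↦ Bundle.TotalSpace.mk' ℝ (E := Bundle.Trivial M ℝ) (b m)
        (g.val (b m) (v m) (v' m))) s x := by
    apply ContMDiffWithinAt.clm_bundle_apply₂ (F₁ := EuclideanSpace ℝ (Fin n))
      (F₂ := EuclideanSpace ℝ (Fin n))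
    · exact ContMDiffAt.comp_contMDiffWithinAt x g.contMDiff.contMDiffAt (hb x hx)
    · exact hv x hx
    · exact hv' x hx
  simp only [Bundle.contMDiffWithinAt_totalSpace] at this
  exact this.2

lemma smoothM_coord (he : IsCoord (M := M) e) : SmoothM (g.coord e) e.target := fun i j =>
  g.contDiffOn_val he.contMDiffOn_symm (he.contMDiffOn_coordVec i) (he.contMDiffOn_coordVec j)

lemma isMetricOn_coord (he : IsCoord (M := M) e) : IsMetricOn (g.coord e) e.target where
  isOpen := e.open_target
  smooth := g.smoothM_coord he
  symm y _ i j := g.coord_symm y i j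
  det _ hy := g.coord_det he hy

variable {g} {u : (p : M) → TangentSpace (𝓡 n) p} {φ : M → ℝ}

lemma IsTorseForming.smoothV_lower (h : g.IsTorseForming u φ) (he : IsCoord (M := M) e) :
    SmoothV (g.lower u e) e.target := fun i =>
  g.contDiffOn_val he.contMDiffOn_symm (he.contMDiffOn_coordVec i)
    (h.smooth.comp_contMDiffOn he.contMDiffOn_symm)

/-- A torse-forming vector field, in coordinates. -/
lemma IsTorseForming.isTorseOn (hn : 3 ≤ n) (h : g.IsTorseForming u φ) {ξ : M → ℝ}
    (hξ : ∀ e : OpenPartialHomeomorph M (EuclideanSpace ℝ (Fin n)), IsCoord e →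
      ∀ x ∈ e.target, ∀ j : Fin n,
      ∑ k, ricci (g.coord e) j k x * upper u e x k = ξ (e.symm x) * g.lower u e x j)
    (he : IsCoord (M := M) e) :
    IsTorseOn (g.coord e) (g.lower u e) (upper u e) (fun x => φ (e.symm x))
      (fun x => ξ (e.symm x)) e.target := by
  have hm := g.isMetricOn_coord he
  have hl := h.smoothV_lower he
  have hlow := fun y hy => g.lower_eq he hy u (x := y)
  have hup : ∀ y ∈ e.target, upper u e y = (g.coord e y)⁻¹ *ᵥ g.lower u e y := fun y hy => by
    rw [hlow y hy, Matrix.mulVec_mulVec, hm.inv_mul hy, Matrix.one_mulVec]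
  have hus : SmoothV (upper u e) e.target := fun m =>
    (SmoothV.mulVec hm.smoothInv hl m).congr fun y hy => by rw [hup y hy]
  have hunit : ∀ y ∈ e.target, ∑ l, upper u e y l * g.lower u e y l = -1 := fun y hy => by
    rw [← h.unit (e.symm y), g.val_eq_sum_lower he hy u]
    rfl
  refine ⟨hm, hl, hus, ?_, hlow, hunit, fun y hy k l => h.torse e he y hy k l,
    fun y hy j => hξ e he y hy j⟩
  have hn' : (3 : ℝ) ≤ n := by exact_mod_cast hn
  have hn1 : (n : ℝ) - 1 ≠ 0 := by linarith
  have hcov : ∀ k l, ContDiffOn ℝ ∞ (covDeriv (g.coord e) (g.lower u e) k l) e.target :=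
    fun k l => (contDiffOn_pd k hm.isOpen (hl l)).sub
      (ContDiffOn.sum fun m _ => (hm.smoothGam k m l).mul (hl m))
  -- No smoothness of `φ` is assumed; it is recovered as `(n - 1)⁻¹` times the divergence of `u`.
  have hs : ContDiffOn ℝ ∞ (fun y => ((n : ℝ) - 1)⁻¹ *
      ∑ k, ∑ l, (g.coord e y)⁻¹ k l * covDeriv (g.coord e) (g.lower u e) l k y) e.target :=
    contDiffOn_const.mul (ContDiffOn.sum fun k _ => ContDiffOn.sum fun l _ =>
      (hm.smoothInv k l).mul (hcov l k))
  refine hs.congr fun y hy => ?_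
  have e1 : ∀ k, ∑ l, (g.coord e y)⁻¹ k l * covDeriv (g.coord e) (g.lower u e) l k y
      = φ (e.symm y) * (delta k k + upper u e y k * g.lower u e y k) := by
    intro k
    have e2 : upper u e y k = ∑ l, (g.coord e y)⁻¹ k l * g.lower u e y l := by
      rw [hup y hy]; rfl
    rw [← hm.sum_inv_mul hy k k, e2, Finset.sum_mul, ← Finset.sum_add_distrib, Finset.mul_sum]
    exact Finset.sum_congr rfl fun l _ => by rw [h.torse e he y hy]; ring
  simp only [e1, ← Finset.mul_sum, Finset.sum_add_distrib, hunit y hy, IsTorseOn.sum_delta_self]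
  field_simp
  ring

end LorentzMetric

lemma IsCoord.pd_symm_comp (he : IsCoord (M := M) e) (hx : x ∈ e.target) {F : M → ℝ}
    (hF : MDifferentiableAt (𝓡 n) 𝓘(ℝ, ℝ) F (e.symm x)) (i : Fin n) :
    pd i (fun y => F (e.symm y)) x = dirDeriv F (e.symm x) (coordVec e i x) := by
  have h1 := mfderiv_comp x hF (he.mdifferentiable.mdifferentiableAt_symm hx)
  have h2 : pd i (fun y => F (e.symm y)) x
      = mfderiv (𝓡 n) 𝓘(ℝ, ℝ) (F ∘ e.symm) x (EuclideanSpace.single i (1 : ℝ)) := by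
    rw [mfderiv_eq_fderiv]; rfl
  rw [h2, h1]
  rfl

lemma IsCoord.sum_upper_mul_pd (he : IsCoord (M := M) e) (hx : x ∈ e.target) {F : M → ℝ}
    (hF : MDifferentiableAt (𝓡 n) 𝓘(ℝ, ℝ) F (e.symm x)) (u : (p : M) → TangentSpace (𝓡 n) p) :
    ∑ i, upper u e x i * pd i (fun y => F (e.symm y)) x
      = dirDeriv F (e.symm x) (u (e.symm x)) := by
  unfold dirDeriv
  conv_rhs => rw [he.eq_sum_coordVec hx (u (e.symm x)), map_sum]
  refine Finset.sum_congr rfl fun i _ => ?_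
  rw [he.pd_symm_comp hx hF, map_smul]
  rfl

/-- Needed for `negRate`, whose smoothness is established chart by chart. -/
lemma IsCoord.mdifferentiableAt_of_contDiffOn (he : IsCoord (M := M) e) (hx : x ∈ e.target)
    {F : M → ℝ} (hF : ContDiffOn ℝ ∞ (fun y => F (e.symm y)) e.target) :
    MDifferentiableAt (𝓡 n) 𝓘(ℝ, ℝ) F (e.symm x) := by
  have h1 : MDifferentiableAt (𝓡 n) 𝓘(ℝ, ℝ) (fun y => F (e.symm y)) (e (e.symm x)) := by
    rw [e.right_inv hx]
    exact (hF.differentiableAt_of_isOpen e.open_target hx).mdifferentiableAt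
  have h2 := h1.comp (e.symm x) (he.mdifferentiable.mdifferentiableAt (e.map_target hx))
  refine h2.congr_of_eventuallyEq ?_
  filter_upwards [e.open_source.mem_nhds (e.map_target hx)] with p hp
  simp [e.left_inv hp]

lemma contDiffOn_of_contMDiff (he : IsCoord (M := M) e) {F : M → ℝ}
    (hF : ContMDiff (𝓡 n) 𝓘(ℝ, ℝ) ∞ F) : ContDiffOn ℝ ∞ (fun y => F (e.symm y)) e.target := by
  rw [← contMDiffOn_iff_contDiffOn]
  exact hF.comp_contMDiffOn he.contMDiffOn_symm

end Charts

/-! ### From coordinate statements to the manifold. -/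

section Main

variable {n : ℕ} {M : Type*} [TopologicalSpace M] [ChartedSpace (EuclideanSpace ℝ (Fin n)) M]
  [IsManifold (𝓡 n) ∞ M] {e e' : OpenPartialHomeomorph M (EuclideanSpace ℝ (Fin n))}
  {x : EuclideanSpace ℝ (Fin n)} {g : LorentzMetric n M}
  {u : (p : M) → TangentSpace (𝓡 n) p} {φ ξ : M → ℝ}

/-! ### Change of charts -/

lemma IsMetricOn.mono {G : Components n} {U V : Set (EuclideanSpace ℝ (Fin n))}
    (h : IsMetricOn G U) (hV : IsOpen V) (hVU : V ⊆ U) : IsMetricOn G V where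
  isOpen := hV
  smooth a b := (h.smooth a b).mono hVU
  symm y hy := h.symm y (hVU hy)
  det y hy := h.det y (hVU hy)

/-- The coordinate change from the chart `e'` to the chart `e`. -/
def transition (e e' : OpenPartialHomeomorph M (EuclideanSpace ℝ (Fin n)))
    (y : EuclideanSpace ℝ (Fin n)) : EuclideanSpace ℝ (Fin n) := e (e'.symm y)

/-- The domain of the coordinate change from the chart `e'` to the chart `e`. -/
def overlap (e e' : OpenPartialHomeomorph M (EuclideanSpace ℝ (Fin n))) :
    Set (EuclideanSpace ℝ (Fin n)) := e'.target ∩ e'.symm ⁻¹' e.source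

lemma isOpen_overlap : IsOpen (overlap e e') :=
  e'.continuousOn_symm.isOpen_inter_preimage e'.open_target e.open_source

lemma mapsTo_transition : Set.MapsTo (transition e e') (overlap e e') e.target :=
  fun _ hy => e.map_source hy.2

lemma contDiffOn_transition (he : IsCoord (M := M) e) (he' : IsCoord (M := M) e') :
    ContDiffOn ℝ ∞ (transition e e') (overlap e e') := by
  rw [← contMDiffOn_iff_contDiffOn]
  exact he.contMDiffOn.comp (he'.contMDiffOn_symm.mono Set.inter_subset_left) fun y hy => hy.2

lemma comp_coordVec (he : IsCoord (M := M) e) (he' : IsCoord (M := M) e')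
    (hx : x ∈ overlap e e') (i a : Fin n) :
    comp e (e'.symm x) (coordVec e' i x) a = jac (transition e e') x a i := by
  have h1 := mfderiv_comp x (he.mdifferentiable.mdifferentiableAt hx.2)
    (he'.mdifferentiable.mdifferentiableAt_symm hx.1)
  rw [← fderiv_apply_single isOpen_overlap (contDiffOn_transition he he') hx,
    ← mfderiv_eq_fderiv]
  change _ = (show EuclideanSpace ℝ (Fin n) from mfderiv (𝓡 n) (𝓡 n) (e ∘ e'.symm) x
    (show TangentSpace (𝓡 n) x from EuclideanSpace.single i (1 : ℝ))) a
  rw [h1]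
  rfl

namespace LorentzMetric

lemma val_eq_sum_of_mem (g : LorentzMetric n M) (he : IsCoord (M := M) e) {p : M}
    (hp : p ∈ e.source) (v v' : TangentSpace (𝓡 n) p) :
    g.val p v v' = ∑ a, ∑ b, comp e p v a * comp e p v' b * g.coord e (e p) a b := by
  obtain ⟨y, hy, rfl⟩ : ∃ y ∈ e.target, e.symm y = p := ⟨e p, e.map_source hp, e.left_inv hp⟩
  rw [g.val_eq_sum he hy, e.right_inv hy]

lemma val_eq_sum_lower_of_mem (g : LorentzMetric n M) (he : IsCoord (M := M) e) {p : M}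
    (hp : p ∈ e.source) (u : (p : M) → TangentSpace (𝓡 n) p) (v : TangentSpace (𝓡 n) p) :
    g.val p v (u p) = ∑ a, comp e p v a * g.lower u e (e p) a := by
  obtain ⟨y, hy, rfl⟩ : ∃ y ∈ e.target, e.symm y = p := ⟨e p, e.map_source hp, e.left_inv hp⟩
  rw [g.val_eq_sum_lower he hy, e.right_inv hy]

lemma coord_transition (g : LorentzMetric n M) (he : IsCoord (M := M) e)
    (he' : IsCoord (M := M) e') (hx : x ∈ overlap e e') :
    g.coord e' x = (jac (transition e e') x)ᵀ * g.coord e (transition e e' x)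
      * jac (transition e e') x := by
  ext i j
  have h1 : g.coord e' x i j = g.val (e'.symm x) (coordVec e' i x) (coordVec e' j x) := rfl
  rw [h1, g.val_eq_sum_of_mem he hx.2]
  simp only [comp_coordVec he he' hx, Matrix.mul_apply, Matrix.transpose_apply, Finset.sum_mul]
  rw [Finset.sum_comm]
  exact Finset.sum_congr rfl fun b _ => Finset.sum_congr rfl fun a _ => by
    rw [transition]; ring

lemma lower_transition (g : LorentzMetric n M) (he : IsCoord (M := M) e)
    (he' : IsCoord (M := M) e') (hx : x ∈ overlap e e')
    (u : (p : M) → TangentSpace (𝓡 n) p) (i : Fin n) :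
    g.lower u e' x i = ∑ a, jac (transition e e') x a i * g.lower u e (transition e e' x) a := by
  have h1 : g.lower u e' x i = g.val (e'.symm x) (coordVec e' i x) (u (e'.symm x)) := rfl
  rw [h1, g.val_eq_sum_lower_of_mem he hx.2]
  simp only [comp_coordVec he he' hx]
  rfl

/-- The function `ξ` is the eigenvalue of the Ricci tensor for the eigenvector `u`. -/
def IsRicciEigenvalue (g : LorentzMetric n M) (u : (p : M) → TangentSpace (𝓡 n) p)
    (ξ : M → ℝ) : Prop :=
  ∀ e : OpenPartialHomeomorph M (EuclideanSpace ℝ (Fin n)), IsCoord e → ∀ x ∈ e.target,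
    ∀ j : Fin n, ∑ k, ricci (g.coord e) j k x * upper u e x k = ξ (e.symm x) * g.lower u e x j

/-- The trace-free spatial part of the Ricci tensor vanishes at `p`. -/
def IsFluidAt (g : LorentzMetric n M) (u : (p : M) → TangentSpace (𝓡 n) p) (ξ : M → ℝ)
    (p : M) : Prop :=
  ∀ e : OpenPartialHomeomorph M (EuclideanSpace ℝ (Fin n)), IsCoord e → p ∈ e.source →
    spatialRic (g.coord e) (g.lower u e) (fun y => ξ (e.symm y)) (e p) = 0

/-- One chart suffices: the relation `R_{kl} = a g_{kl} + Y_k u_l` is carried over with the same `a`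
and with `Y` transformed as a covector. -/
lemma IsTorseForming.isFluidAt (hn : 3 ≤ n) (h : g.IsTorseForming u φ)
    (hξ : g.IsRicciEigenvalue u ξ) {p : M} (he : IsCoord (M := M) e) (hp : p ∈ e.source)
    (h0 : spatialRic (g.coord e) (g.lower u e) (fun y => ξ (e.symm y)) (e p) = 0) :
    g.IsFluidAt u ξ p := by
  intro e' he' hp'
  have hT := h.isTorseOn hn hξ he
  have hT' := h.isTorseOn hn hξ he'
  have hx : e' p ∈ overlap e e' := ⟨e'.map_source hp', by simpa [e'.left_inv hp'] using hp⟩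
  have hψ : transition e e' (e' p) = e p := by rw [transition, e'.left_inv hp']
  obtain ⟨a, Y, hY⟩ := (hT.spatialRic_eq_zero_iff hn (e.map_source hp)).1 h0
  have hric := hT.metric.ric_transform
    (hT'.metric.mono isOpen_overlap Set.inter_subset_left)
    (contDiffOn_transition he he') mapsTo_transition
    (fun y hy => g.coord_transition he he' hy) hx
  have hG := g.coord_transition he he' hx
  have hl := g.lower_transition he he' hx u
  rw [hψ] at hric hG
  simp only [hψ] at hl
  set J := jac (transition e e') (e' p)
  refine (hT'.spatialRic_eq_zero_iff hn hx.1).2 ⟨a, fun k => ∑ b, J b k * Y b, fun k l => ?_⟩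
  have h1 : ricci (g.coord e') k l (e' p) = ric (g.coord e') (e' p) k l := rfl
  rw [h1, hric, hG, hl]
  simp only [Matrix.mul_apply, Matrix.transpose_apply, Finset.mul_sum, Finset.sum_mul]
  rw [← Finset.sum_add_distrib]
  refine Finset.sum_congr rfl fun c _ => ?_
  rw [← Finset.sum_add_distrib]
  refine Finset.sum_congr rfl fun b _ => ?_
  have h2 : ric (g.coord e) (e p) b c = _ := hY b c
  rw [h2]
  ring

/-! ### Propagation along integral curves -/

lemma comp_eq_upper {p : M} (hp : p ∈ e.source) (i : Fin n) :
    comp e p (u p) i = upper u e (e p) i := by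
  obtain ⟨y, hy, rfl⟩ : ∃ y ∈ e.target, e.symm y = p := ⟨e p, e.map_source hp, e.left_inv hp⟩
  rw [e.right_inv hy, upper_eq_comp]

lemma hasDerivAt_along {γ : ℝ → M} {a b t : ℝ} (hγ : IsMIntegralCurveOn γ u (Set.Ioo a b))
    (ht : t ∈ Set.Ioo a b) (he : IsCoord (M := M) e) (hp : γ t ∈ e.source)
    {F : EuclideanSpace ℝ (Fin n) → ℝ} (hF : ContDiffOn ℝ ∞ F e.target) :
    HasDerivAt (fun s => F (e (γ s)))
      (∑ i, upper u e (e (γ t)) i * pd i F (e (γ t))) t := by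
  have h1 := (hγ.isMIntegralCurveAt (Ioo_mem_nhds ht.1 ht.2)).hasMFDerivAt
  have h2 := (he.mdifferentiable.mdifferentiableAt hp).hasMFDerivAt.comp t h1
  have h3 : HasFDerivAt (e ∘ γ) _ t := h2.hasFDerivAt
  have h4 := (hF.differentiableAt_of_isOpen e.open_target (e.map_source hp)).hasFDerivAt
  have h5 := (h4.comp t h3).hasDerivAt
  have h6 : ∑ i, upper u e (e (γ t)) i * pd i F (e (γ t))
      = fderiv ℝ F (e (γ t)) (mfderiv (𝓡 n) (𝓡 n) e (γ t) (u (γ t))) := by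
    refine Eq.trans ?_ (fderiv_eq_sum_pd (f := F) (x := e (γ t))
      (show EuclideanSpace ℝ (Fin n) from mfderiv (𝓡 n) (𝓡 n) e (γ t) (u (γ t)))).symm
    exact Finset.sum_congr rfl fun i _ => by rw [← comp_eq_upper hp]; rfl
  rw [h6]
  refine h5.congr_deriv ?_
  have h7 : ((mfderiv (𝓡 n) (𝓡 n) e (γ t)).comp
      ((1 : ℝ →L[ℝ] ℝ).smulRight (u (γ t)))) (1 : ℝ)
      = mfderiv (𝓡 n) (𝓡 n) e (γ t) (u (γ t)) := by
    simp
  exact congrArg (fderiv ℝ F (e (γ t))) h7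

/-- Within a chart `E` satisfies a homogeneous linear ODE along the curve, so its vanishing is a
locally constant property; connectedness of the interval carries it across charts. -/
lemma IsTorseForming.isFluidAt_propagates (hn : 3 < n) (h : g.IsTorseForming u φ)
    (hξ : g.IsRicciEigenvalue u ξ) (hW : g.WeylDivFree) {γ : ℝ → M} {a b : ℝ}
    (hγ : IsMIntegralCurveOn γ u (Set.Ioo a b)) {t t' : ℝ} (ht : t ∈ Set.Ioo a b)
    (ht' : t' ∈ Set.Ioo a b) (h0 : g.IsFluidAt u ξ (γ t)) : g.IsFluidAt u ξ (γ t') := by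
  -- As an equivalence the claim is a symmetric and transitive relation between times, which
  -- `IsPreconnected.induction₂` extends from small neighbourhoods to the whole interval.
  suffices hiff : g.IsFluidAt u ξ (γ t) ↔ g.IsFluidAt u ξ (γ t') from hiff.1 h0
  refine isPreconnected_Ioo.induction₂
    (fun t t' => g.IsFluidAt u ξ (γ t) ↔ g.IsFluidAt u ξ (γ t')) (fun t₀ ht₀ => ?_)
    (fun _ _ _ _ _ _ h1 h2 => h1.trans h2) (fun _ _ _ _ h1 => h1.symm) ht ht'
  set e := chartAt (EuclideanSpace ℝ (Fin n)) (γ t₀)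
  have he : IsCoord (M := M) e := IsManifold.chart_mem_maximalAtlas (γ t₀)
  have hT := h.isTorseOn hn.le hξ he
  have hcont := (hγ.continuousOn.continuousAt (Ioo_mem_nhds ht₀.1 ht₀.2))
  have hnhds : {t | t ∈ Set.Ioo a b ∧ γ t ∈ e.source} ∈ nhds t₀ :=
    Filter.inter_mem (Ioo_mem_nhds ht₀.1 ht₀.2)
      (hcont.preimage_mem_nhds (e.open_source.mem_nhds (mem_chart_source _ _)))
  obtain ⟨c, d, htcd, hcd⟩ := mem_nhds_iff_exists_Ioo_subset.1 hnhds
  refine mem_nhdsWithin_of_mem_nhds ?_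
  filter_upwards [Ioo_mem_nhds htcd.1 htcd.2] with t ht
  have key : ∀ t ∈ Set.Ioo c d, ∀ t' ∈ Set.Ioo c d, g.IsFluidAt u ξ (γ t) →
      g.IsFluidAt u ξ (γ t') := by
    intro t ht t' ht' h1
    have hmem := fun s (hs : s ∈ Set.Ioo c d) => e.map_source (hcd hs).2
    refine h.isFluidAt hn.le hξ he (hcd ht').2 ?_
    have h2 := h1 e he (hcd ht).2
    set G := g.coord e
    set E : ℝ → Fin n → Fin n → ℝ := fun s k l =>
      spatialRic G (g.lower u e) (fun y => ξ (e.symm y)) (e (γ s)) k l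
    set B : ℝ → Fin n → Fin n → ℝ := fun s p k =>
      ∑ i, upper u e (e (γ s)) i * christoffel G p i k (e (γ s))
    have hB : ∀ p k, ContinuousOn (fun s => B s p k) (Set.Ioo c d) := by
      intro p k
      have hs : ContDiffOn ℝ ∞ (fun y => ∑ i, upper u e y i * christoffel G p i k y)
          e.target :=
        ContDiffOn.sum fun i _ => (hT.smoothUp i).mul (hT.metric.smoothGam i p k)
      exact fun s hs' => (hasDerivAt_along hγ (hcd hs').1 he
        (hcd hs').2 hs).continuousAt.continuousWithinAt
    have hE : ∀ s ∈ Set.Ioo c d, ∀ k l,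
        HasDerivAt (fun s => E s k l) (transportField B s (E s) k l) s := by
      intro s hs k l
      have h3 := hasDerivAt_along hγ (hcd hs).1 he (hcd hs).2 (hT.smoothM_spatialRic k l)
      rw [hT.sum_pd_spatialRic hn (hmem s hs) (fun j k l => hW e he _ (hmem s hs) j k l)] at h3
      exact h3
    have h4 : E t' = 0 := transport_eq_zero hB hE ht ht' h2
    exact h4
  exact ⟨key t₀ htcd t ht, key t ht t₀ htcd⟩

/-- The hypothesis on `φ` supplies on each curve one point where `φ` can be divided out; transport
does the rest. -/
lemma IsTorseForming.isFluidAt_of_nonvanishing (hn : 3 < n) (h : g.IsTorseForming u φ)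
    (hξ : g.IsRicciEigenvalue u ξ) (hW : g.WeylDivFree) (hφ : NonvanishingAlong φ u) (p : M) :
    g.IsFluidAt u ξ p := by
  obtain ⟨γ, a, b, hγ, s, hs, t, ht, rfl, hft⟩ := hφ p
  refine h.isFluidAt_propagates hn hξ hW hγ ht hs fun e he hp => ?_
  have hx := e.map_source hp
  exact (h.isTorseOn hn.le hξ he).spatialRic_eq_zero_of_ne hn hx
    (fun j k l => hW e he _ hx j k l) (by simpa only [e.left_inv hp] using hft)

/-! ### Conformal change -/

variable {σ : M → ℝ} {hσ : ContMDiff (𝓡 n) 𝓘(ℝ, ℝ) ∞ σ}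

lemma coord_conformal : (g.conformal σ hσ).coord e
    = confMetric (fun y => σ (e.symm y)) (g.coord e) := rfl

lemma lower_conformal (y : EuclideanSpace ℝ (Fin n)) (l : Fin n) :
    (g.conformal σ hσ).lower (fun p => Real.exp (-σ p) • u p) e y l
      = Real.exp (σ (e.symm y)) * g.lower u e y l := by
  have h1 : (g.conformal σ hσ).lower (fun p => Real.exp (-σ p) • u p) e y l
      = Real.exp (2 * σ (e.symm y)) * g.val (e.symm y) (coordVec e l y)
        (Real.exp (-σ (e.symm y)) • u (e.symm y)) := rfl
  rw [h1, map_smul, smul_eq_mul, ← mul_assoc, ← Real.exp_add, lower]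
  congr 2
  ring

lemma upper_smul (c : M → ℝ) (y : EuclideanSpace ℝ (Fin n)) (l : Fin n) :
    upper (fun p => c p • u p) e y l = c (e.symm y) * upper u e y l := by
  unfold upper
  rw [map_smul]
  rfl

end LorentzMetric

/-- The rate `- u^m ∇_m σ`. -/
def negRate (σ : M → ℝ) (u : (p : M) → TangentSpace (𝓡 n) p) (p : M) : ℝ :=
  - dirDeriv σ p (u p)

namespace LorentzMetric

variable {σ : M → ℝ}

/-- This is the gradient condition in the coordinate form `∂_k σ = s u_k`, with `negRate` as `s`. -/
lemma pd_potential (hσ : ContMDiff (𝓡 n) 𝓘(ℝ, ℝ) ∞ σ)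
    (hgrad : ∀ (p : M) (v : TangentSpace (𝓡 n) p),
      dirDeriv σ p v = -(g.val p (u p) v * dirDeriv σ p (u p)))
    (he : IsCoord (M := M) e) (hx : x ∈ e.target) (k : Fin n) :
    pd k (fun y => σ (e.symm y)) x = negRate σ u (e.symm x) * g.lower u e x k := by
  rw [he.pd_symm_comp hx (hσ.mdifferentiable (by simp) _), hgrad, g.symm, negRate, lower]
  ring

lemma IsTorseForming.smooth_negRate (hn : 3 ≤ n) (h : g.IsTorseForming u φ)
    (hξ : g.IsRicciEigenvalue u ξ) (hσ : ContMDiff (𝓡 n) 𝓘(ℝ, ℝ) ∞ σ)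
    (he : IsCoord (M := M) e) :
    ContDiffOn ℝ ∞ (fun y => negRate σ u (e.symm y)) e.target := by
  have hs : ContDiffOn ℝ ∞
      (fun y => - ∑ i, upper u e y i * pd i (fun y => σ (e.symm y)) y) e.target :=
    (ContDiffOn.sum fun i _ => ((h.isTorseOn hn hξ he).smoothUp i).mul
      (contDiffOn_pd i e.open_target (contDiffOn_of_contMDiff he hσ))).neg
  refine hs.congr fun y hy => ?_
  rw [he.sum_upper_mul_pd hy (hσ.mdifferentiable (by simp) _)]
  rfl

/-- The rescaling by `e^{-σ}` keeps the field unit for the new metric; since `negRate` is `-σ̇`, its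
new scalar is `e^{-σ} (φ + σ̇)`. -/
lemma IsTorseForming.conformal (hn : 3 ≤ n) (h : g.IsTorseForming u φ)
    (hξ : g.IsRicciEigenvalue u ξ) (hσ : ContMDiff (𝓡 n) 𝓘(ℝ, ℝ) ∞ σ)
    (hgrad : ∀ (p : M) (v : TangentSpace (𝓡 n) p),
      dirDeriv σ p v = -(g.val p (u p) v * dirDeriv σ p (u p))) :
    (g.conformal σ hσ).IsTorseForming (fun p => Real.exp (-σ p) • u p)
      (fun p => Real.exp (-σ p) * (φ p - negRate σ u p)) := by
  have key := fun (e : OpenPartialHomeomorph M (EuclideanSpace ℝ (Fin n)))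
    (he : IsCoord (M := M) e) =>
    (h.isTorseOn hn hξ he).conf hn (contDiffOn_of_contMDiff he hσ)
      (h.smooth_negRate hn hξ hσ he) (fun y hy k => pd_potential hσ hgrad he hy k)
  have hlow : ∀ e : OpenPartialHomeomorph M (EuclideanSpace ℝ (Fin n)),
      (g.conformal σ hσ).lower (fun p => Real.exp (-σ p) • u p) e
        = fun y l => Real.exp (σ (e.symm y)) * g.lower u e y l := fun e => by
    funext y l; exact lower_conformal y l
  refine ⟨?_, fun p => ?_, fun e he y hy k l => ?_,
    ⟨fun p => Real.exp (-(2 * σ p)) * (ξ p - (n - 1) *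
      (dirDeriv (negRate σ u) p (u p) + negRate σ u p * φ p)), fun e he y hy j => ?_⟩⟩
  · have hexp : ContMDiff (𝓡 n) 𝓘(ℝ, ℝ) ∞ (fun p => Real.exp (-σ p)) :=
      (Real.contDiff_exp.comp contDiff_neg).contMDiff.comp hσ
    exact hexp.smul_section h.smooth
  · have h1 : (g.conformal σ hσ).val p (Real.exp (-σ p) • u p) (Real.exp (-σ p) • u p)
        = Real.exp (2 * σ p) * g.val p (Real.exp (-σ p) • u p) (Real.exp (-σ p) • u p) := rfl
    have h2 : Real.exp (2 * σ p) * Real.exp (-σ p) * Real.exp (-σ p) = 1 := by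
      rw [← Real.exp_add, ← Real.exp_add]
      ring_nf
      exact Real.exp_zero
    rw [h1]
    simp only [map_smul, smul_apply, smul_eq_mul, h.unit]
    linear_combination -h2
  · rw [hlow, coord_conformal]
    exact (key e he).torse y hy k l
  · have h1 := (key e he).eigen y hy j
    rw [hlow, coord_conformal]
    simp only [upper_smul (fun p => Real.exp (-σ p))]
    have h2 := he.sum_upper_mul_pd hy (he.mdifferentiableAt_of_contDiffOn hy
      (h.smooth_negRate hn hξ hσ he)) u
    rw [h2] at h1
    exact h1

end LorentzMetric

end Main

end GRW
end

theorem proposition6p2 {n : ℕ} (hn : 3 ≤ n) {M : Type*} [TopologicalSpace M]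
    [ChartedSpace (EuclideanSpace ℝ (Fin n)) M] [IsManifold (𝓡 n) ∞ M]
    (g : GRW.LorentzMetric n M)
    (u : (p : M) → TangentSpace (𝓡 n) p) (φ : M → ℝ)
    (hGRW : g.IsTorseForming u φ)
    (hφ : GRW.NonvanishingAlong φ u)
    (hWeyl : g.WeylDivFree)
    (σ : M → ℝ) (hσ : ContMDiff (𝓡 n) 𝓘(ℝ, ℝ) ∞ σ)
    (hgrad : ∀ (p : M) (v : TangentSpace (𝓡 n) p),
      GRW.dirDeriv σ p v = -(g.val p (u p) v * GRW.dirDeriv σ p (u p))) :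
    (g.conformal σ hσ).IsGRW ∧ (g.conformal σ hσ).WeylDivFree := by
  obtain ⟨ξ, hξ⟩ := hGRW.eigen
  refine ⟨⟨_, _, hGRW.conformal hn hξ hσ hgrad⟩, fun e he x hx j k l => ?_⟩
  have hT := hGRW.isTorseOn hn hξ he
  rw [GRW.LorentzMetric.coord_conformal,
    hT.weylDiv_conf hn (GRW.contDiffOn_of_contMDiff he hσ) (hGRW.smooth_negRate hn hξ hσ he)
      (fun y hy k => GRW.LorentzMetric.pd_potential hσ hgrad he hy k) hx,
    hWeyl e he x hx j k l, zero_add]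
  -- What remains is `(n - 3) s u_m C_{jkl}{}^m`: the coefficient vanishes for `n = 3`, the
  -- contraction for `n > 3`.
  rcases hn.eq_or_lt with h3 | h3
  · have : (n : ℝ) = 3 := by exact_mod_cast h3.symm
    simp [this]
  · have h0 := hGRW.isFluidAt_of_nonvanishing h3 hξ hWeyl hφ (e.symm x) e he (e.map_target hx)
    rw [e.right_inv hx] at h0
    rw [hT.weyl_lower_fourth hn hx h0, mul_zero]
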